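/- Let $f\in C^2(\mathbb R)$ (no assumption on its inflection points). For an open set $\Omega\subset(0,\infty)\times\mathbb R$ and $g_E\in L^\infty(\Omega)$, a continuous distributional solution on $\Omega$ of the balance law $$\partial_t u+\partial_x\big(f(u)\big)=g_E \qquad (1)$$ is a function $u\in C(\Omega)$ with $\iint_\Omega\{\varphi_t\,u+\varphi_x\,f(u)\}\,dt\,dx=-\iint_\Omega\varphi\,g_E\,dt\,dx$ for all $\varphi\in C_c^\infty(\Omega)$. (i) (Entropy equality.) Let $u$ be a continuous distributional solution of (1) on $\Omega$. For every entropy–entropy flux pair, i.e. every $\eta\in C^1(\mathbb R)$ and every $q$ with $q'=\eta' f'$, $$\partial_t\,\eta(u)+\partial_x\,q(u)=\eta'(u)\,g_E\quad\text{in the sense of distributions on }\Omega,$$ and $u$ is Kruzkov iso-entropic: for every $k\in\mathbb R$, with $\operatorname{sgn}0=0$, $$\partial_t|u-k|+\partial_x\big[\operatorname{sgn}(u-k)(f(u)-f(k))\big]=\operatorname{sgn}(u-k)\,g_E\quad\text{in the sense of distributions on }\Omega.$$ (ii) (Uniqueness for the Cauchy problem.) Let $T>0$, $g_E\in L^\infty((0,T)\times\mathbb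 R)$, and let $u$ be a bounded continuous function on $[0,T)\times\mathbb R$ that is a distributional solution of (1) on $(0,T)\times\mathbb R$, with $u(0,\cdot)=u_0$. Call $v\in L^\infty((0,T)\times\mathbb R)$ a Kruzkov entropy solution of the Cauchy problem for (1) with datum $u_0$ if $$\iint_{(0,T)\times\mathbb R}\big\{|v-k|\,\varphi_t+\operatorname{sgn}(v-k)(f(v)-f(k))\,\varphi_x+\operatorname{sgn}(v-k)\,g_E\,\varphi\big\}\,dt\,dx\ \ge\ 0$$ for all $k\in\mathbb R$ and all $0\le\varphi\in C_c^\infty((0,T)\times\mathbb R)$, and there is a Lebesgue-null set $E$ of times such that $v(t,\cdot)\to u_0$ in $L^1([-R,R])$ for every $R>0$ as $t\downarrow0$, $t\notin E$. Then $u$ is a Kruzkov entropy solution of this Cauchy problem; every Kruzkov entropy solution $v$ with the same source $g_E$ and datum $u_0$ equals $u$ almost everywhere on $(0,T)\times\mathbb R$; and every bounded continuous function on $[0,T)\times\mathbb R$ that is a distributional solution of (1) on $(0,T)\times\mathbb R$ with the same $g_E$ and equals $u_0$ at $t=0$ coincides with $u$ on all of $[0,T)\times\mathbb R$. -/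

import Mathlib

open MeasureTheory Set Filter Topology
open scoped ContDiff

/-- Smooth functions of `(t, x)` whose support is a compact subset of `Ω`. -/
structure IsTestFunction (Ω : Set (ℝ × ℝ)) (φ : ℝ × ℝ → ℝ) : Prop where
  smooth : ContDiff ℝ ∞ φ
  compact : HasCompactSupport φ
  support_subset : tsupport φ ⊆ Ω

/-- The partial derivative in the first variable (time). -/
noncomputable def partialT (φ : ℝ × ℝ → ℝ) (p : ℝ × ℝ) : ℝ := fderiv ℝ φ p (1, 0)

/-- The partial derivative in the second variable (space). -/
noncomputable def partialX (φ : ℝ × ℝ → ℝ) (p : ℝ × ℝ) : ℝ := fderiv ℝ φ p (0, 1)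

/-- `∂ₜ A + ∂ₓ B = h` in the sense of distributions on `Ω`
(used only for `A`, `B`, `h` that are locally integrable on `Ω`). -/
def DistribBalance (Ω : Set (ℝ × ℝ)) (A B h : ℝ × ℝ → ℝ) : Prop :=
  ∀ φ : ℝ × ℝ → ℝ, IsTestFunction Ω φ →
    ∫ p in Ω, (partialT φ p * A p + partialX φ p * B p) = - ∫ p in Ω, φ p * h p

/-- `u` is a continuous distributional solution of `∂ₜ u + ∂ₓ f(u) = g` on `Ω`, with `g ∈ L^∞(Ω)`. -/
structure IsContinuousDistribSolution (f : ℝ → ℝ) (g : ℝ × ℝ → ℝ) (Ω : Set (ℝ × ℝ))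
    (u : ℝ × ℝ → ℝ) : Prop where
  source : MemLp g ⊤ (volume.restrict Ω)
  continuousOn : ContinuousOn u Ω
  equation : DistribBalance Ω u (fun p => f (u p)) g

/-- Entropy–entropy flux pairs: `η` is of class `C¹` and `q' = η' f'`. -/
structure IsEntropyPair (f η q : ℝ → ℝ) : Prop where
  contDiff : ContDiff ℝ 1 η
  flux : ∀ z : ℝ, HasDerivAt q (deriv η z * deriv f z) z

/-- The open strip `(0, T) × ℝ`. -/
def strip (T : ℝ) : Set (ℝ × ℝ) := Ioo 0 T ×ˢ univ

/-- The strip `[0, T) × ℝ`, which contains the initial line. -/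
def strip₀ (T : ℝ) : Set (ℝ × ℝ) := Ico 0 T ×ˢ univ

/-- Bounded continuous solutions on `[0, T) × ℝ` of the Cauchy problem
`∂ₜ u + ∂ₓ f(u) = g`, `u(0, ·) = u₀`. -/
structure IsContinuousCauchySolution (f : ℝ → ℝ) (g : ℝ × ℝ → ℝ) (T : ℝ) (u₀ : ℝ → ℝ)
    (u : ℝ × ℝ → ℝ) : Prop where
  solution : IsContinuousDistribSolution f g (strip T) u
  continuousOn : ContinuousOn u (strip₀ T)
  bounded : ∃ M : ℝ, ∀ p ∈ strip₀ T, |u p| ≤ M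
  initial : ∀ x : ℝ, u (0, x) = u₀ x

/-- Kruzkov's (bounded measurable) entropy solutions on `(0, T) × ℝ` of the Cauchy problem
`∂ₜ v + ∂ₓ f(v) = g`, `v(0, ·) = v₀`: the entropy inequality for all entropies `|v - k|`, and
`v(t, ·) → v₀` in `L¹_loc` as `t ↓ 0` outside a negligible set of times. -/
structure IsKruzkovEntropySolution (f : ℝ → ℝ) (g : ℝ × ℝ → ℝ) (T : ℝ) (v₀ : ℝ → ℝ)
    (v : ℝ × ℝ → ℝ) : Prop where
  bounded : MemLp v ⊤ (volume.restrict (strip T))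
  entropy : ∀ (k : ℝ) (φ : ℝ × ℝ → ℝ), IsTestFunction (strip T) φ → (∀ p, 0 ≤ φ p) →
    0 ≤ ∫ p in strip T,
      (partialT φ p * |v p - k|
        + partialX φ p * (Real.sign (v p - k) * (f (v p) - f k))
        + φ p * (Real.sign (v p - k) * g p))
  initial : ∃ E : Set ℝ, volume E = 0 ∧ ∀ R : ℝ,
    Tendsto (fun t : ℝ => ∫⁻ x in Icc (-R) R, ‖v (t, x) - v₀ x‖ₑ) (𝓝[Ioi 0 \ E] 0) (𝓝 0)

/-! ### Approximation of the identity built from the smooth step -/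

/-! The core is a statement without entropies, `WeakBalance.setIntegral_pos_eq_zero`. Let `∂ₜ w + ∂ₓ
B = h` weakly on the plane with compactly supported data, `w` and `B` continuous, `h` bounded, and
suppose that `B` vanishes where `w` does and `h` vanishes a.e. there. Then `h` has integral zero
over `{w > 0}`. Formally no flux crosses the boundary of `{w > 0}`, but its time slices may have
infinitely many components and need not vary regularly in time.

The slice is therefore replaced by a union of `m` intervals, possibly empty, that maximizes the mass
of `w (t, ·)`. At a maximizer the first variation vanishes, so every endpoint that is not cancelled
by coinciding ones is a zero of `w`, hence of `B`: the net flux is zero (`sum_flux_eq_zero`). Freeze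
the maximizer during a short time step. Its mass changes by the source it contains, up to a flux
that is small by uniform continuity, and optimizing again at the end of the step can only increase
the mass. Telescoping between two times at which `w` vanishes bounds the source on `{w > 0}` above
by an arbitrarily small number (`WeakBalance.integral_truncatedSource_le`). The reflection `p ↦ -p`
gives the opposite inequality.

Applied to `w = φ (u - k)` with `φ ≥ 0`, this gives the balance of `(u - k)⁺` for every level `k`
whose level set is null, hence for a dense set of `k`. Limits from above and below give all `k`, on
`{u > k}` and on `{u ≥ k}`; combining the two yields the Kruzkov equality. Superposition gives
piecewise affine entropies, and uniform approximation of `η'` gives `C¹` entropies.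

For uniqueness, the Kruzkov equality for `u` and the inequality for `v` enter a doubling of
variables (`doubling_nonneg`). The limit on the diagonal uses continuity of `u` and Lebesgue points
of `g` (`comparison_nonneg`). Test functions on backward cones, with a strictly decreasing time
factor, then turn equal initial data into equality almost everywhere. -/

theorem hasCompactSupport_of_norm_ge {E : Type*} [NormedAddCommGroup E] [ProperSpace E]
    {W : E → ℝ} {R : ℝ} (hW : ∀ p, R ≤ ‖p‖ → W p = 0) : HasCompactSupport W :=
  HasCompactSupport.intro (isCompact_closedBall (0 : E) R) fun p hp => hW p <| by
    simp only [Metric.mem_closedBall, dist_zero_right, not_le] at hp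
    exact hp.le

/-- The derivative of `s ↦ smoothTransition (n * (s - t))`. -/
noncomputable def stepKernel (n : ℕ) (t s : ℝ) : ℝ :=
  n * deriv Real.smoothTransition (n * (s - t))

theorem hasDerivAt_smoothTransition (x : ℝ) :
    HasDerivAt Real.smoothTransition (deriv Real.smoothTransition x) x :=
  ((Real.smoothTransition.contDiff (n := 1)).differentiable (by norm_num) x).hasDerivAt

theorem hasDerivAt_step (n : ℕ) (t s : ℝ) :
    HasDerivAt (fun s => Real.smoothTransition (n * (s - t))) (stepKernel n t s) s := by
  have h := (hasDerivAt_smoothTransition (n * (s - t))).comp s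
    (((hasDerivAt_id s).sub_const t).const_mul (n : ℝ))
  simpa [stepKernel, Function.comp_def, mul_comm] using h

theorem continuous_deriv_smoothTransition : Continuous (deriv Real.smoothTransition) :=
  (Real.smoothTransition.contDiff (n := 1)).continuous_deriv (by norm_num)

theorem continuous_stepKernel (n : ℕ) (t : ℝ) : Continuous (stepKernel n t) := by
  unfold stepKernel
  exact continuous_const.mul (continuous_deriv_smoothTransition.comp (by fun_prop))

theorem deriv_smoothTransition_nonneg (x : ℝ) : 0 ≤ deriv Real.smoothTransition x :=
  Real.smoothTransition.monotone.deriv_nonneg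

theorem deriv_smoothTransition_of_neg {x : ℝ} (hx : x < 0) :
    deriv Real.smoothTransition x = 0 := by
  have : Real.smoothTransition =ᶠ[𝓝 x] fun _ => 0 := by
    filter_upwards [Iio_mem_nhds hx] with y hy
    exact Real.smoothTransition.zero_of_nonpos (le_of_lt hy)
  rw [this.deriv_eq]; simp

theorem deriv_smoothTransition_of_gt {x : ℝ} (hx : 1 < x) :
    deriv Real.smoothTransition x = 0 := by
  have : Real.smoothTransition =ᶠ[𝓝 x] fun _ => 1 := by
    filter_upwards [Ioi_mem_nhds hx] with y hy
    exact Real.smoothTransition.one_of_one_le (le_of_lt hy)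
  rw [this.deriv_eq]; simp

theorem hasCompactSupport_deriv_smoothTransition :
    HasCompactSupport (deriv Real.smoothTransition) :=
  HasCompactSupport.intro (isCompact_Icc (a := (0 : ℝ)) (b := 1)) fun x hx => by
    by_cases h : x < 0
    · exact deriv_smoothTransition_of_neg h
    · refine deriv_smoothTransition_of_gt ?_
      by_contra h'
      exact hx ⟨not_lt.1 h, not_lt.1 h'⟩

theorem integrable_deriv_smoothTransition : Integrable (deriv Real.smoothTransition) :=
  continuous_deriv_smoothTransition.integrable_of_hasCompactSupport
    hasCompactSupport_deriv_smoothTransition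

theorem integral_deriv_smoothTransition : ∫ x, deriv Real.smoothTransition x = 1 := by
  have := integral_of_hasDerivAt_of_tendsto (f := Real.smoothTransition) (m := 0) (n := 1)
    hasDerivAt_smoothTransition integrable_deriv_smoothTransition
    (tendsto_const_nhds.congr' (by
      filter_upwards [eventually_le_atBot 0] with x hx
      exact (Real.smoothTransition.zero_of_nonpos hx).symm))
    (tendsto_const_nhds.congr' (by
      filter_upwards [eventually_ge_atTop 1] with x hx
      exact (Real.smoothTransition.one_of_one_le hx).symm))
  simpa using this

/-- The substitution `s = t + σ / n` exhibits the kernel as a one-sided approximate identity, of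
unit mass and living on `[t, t + 1 / n]`. -/
theorem integral_stepKernel_mul {n : ℕ} (hn : n ≠ 0) (t : ℝ) (W : ℝ → ℝ) :
    ∫ s, stepKernel n t s * W s = ∫ σ, deriv Real.smoothTransition σ * W (t + σ / n) := by
  have hn' : (0 : ℝ) < n := by positivity
  rw [← integral_add_left_eq_self _ t]
  have := Measure.integral_comp_mul_left
    (fun σ => (n : ℝ) * deriv Real.smoothTransition σ * W (t + σ / n)) (n : ℝ)
  rw [abs_of_pos (by positivity)] at this
  simp only [stepKernel, add_sub_cancel_left]
  have e : (fun x : ℝ => (n : ℝ) * deriv Real.smoothTransition (n * x) * W (t + x)) =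
      fun x : ℝ => (n : ℝ) * deriv Real.smoothTransition (n * x) * W (t + (n * x) / n) := by
    ext x; rw [mul_div_cancel_left₀ _ hn'.ne']
  rw [e, this]
  simp only [mul_assoc]
  rw [integral_const_mul, smul_eq_mul, inv_mul_cancel_left₀ hn'.ne']

theorem abs_integral_stepKernel_mul_le (n : ℕ) (t : ℝ) {W : ℝ → ℝ} {C : ℝ}
    (hW : ∀ s, |W s| ≤ C) : |∫ s, stepKernel n t s * W s| ≤ C := by
  have hC : 0 ≤ C := (abs_nonneg _).trans (hW 0)
  rcases eq_or_ne n 0 with rfl | hn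
  · simpa [stepKernel] using hC
  rw [integral_stepKernel_mul hn]
  calc |∫ σ, deriv Real.smoothTransition σ * W (t + σ / n)|
      ≤ ∫ σ, deriv Real.smoothTransition σ * C := by
        rw [← Real.norm_eq_abs]
        refine norm_integral_le_of_norm_le (integrable_deriv_smoothTransition.mul_const C)
          (ae_of_all _ fun σ => ?_)
        rw [norm_mul, Real.norm_of_nonneg (deriv_smoothTransition_nonneg σ)]
        exact mul_le_mul_of_nonneg_left (hW _) (deriv_smoothTransition_nonneg σ)
    _ = C := by rw [integral_mul_const, integral_deriv_smoothTransition, one_mul]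

theorem tendsto_integral_stepKernel_mul (t : ℝ) {W : ℝ → ℝ} {C : ℝ} (hc : Continuous W)
    (hW : ∀ s, |W s| ≤ C) :
    Tendsto (fun n : ℕ => ∫ s, stepKernel n t s * W s) atTop (𝓝 (W t)) := by
  have h : Tendsto (fun n : ℕ => ∫ σ, deriv Real.smoothTransition σ * W (t + σ / n)) atTop
      (𝓝 (∫ σ, deriv Real.smoothTransition σ * W t)) := by
    refine tendsto_integral_of_dominated_convergence (fun σ => deriv Real.smoothTransition σ * C)
      (fun n => ?_) (integrable_deriv_smoothTransition.mul_const C)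
      (fun n => ae_of_all _ fun σ => ?_) (ae_of_all _ fun σ => ?_)
    · exact (continuous_deriv_smoothTransition.mul (hc.comp (by fun_prop))).aestronglyMeasurable
    · rw [norm_mul, Real.norm_of_nonneg (deriv_smoothTransition_nonneg σ)]
      exact mul_le_mul_of_nonneg_left (hW _) (deriv_smoothTransition_nonneg σ)
    · refine Tendsto.const_mul _ ?_
      have : Tendsto (fun n : ℕ => t + σ / (n : ℝ)) atTop (𝓝 (t + 0)) :=
        (tendsto_const_div_atTop_nhds_zero_nat σ).const_add t
      rw [add_zero] at this
      exact (hc.tendsto t).comp this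
  rw [integral_mul_const, integral_deriv_smoothTransition, one_mul] at h
  refine h.congr' ?_
  filter_upwards [eventually_ne_atTop 0] with n hn
  rw [integral_stepKernel_mul hn]

theorem integral_prod_stepKernel_mul (n : ℕ) (t : ℝ) {W : ℝ × ℝ → ℝ} {R : ℝ}
    (hc : Continuous W) (hW : ∀ p, R ≤ ‖p‖ → W p = 0) {b : ℝ → ℝ} (hb : Continuous b) :
    ∫ p : ℝ × ℝ, stepKernel n t p.1 * b p.2 * W p =
      ∫ y, b y * ∫ s, stepKernel n t s * W (s, y) := by
  have hi : Integrable (fun p : ℝ × ℝ => stepKernel n t p.1 * b p.2 * W p) :=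
    ((((continuous_stepKernel n t).comp continuous_fst).mul (hb.comp continuous_snd)).mul
      hc).integrable_of_hasCompactSupport (hasCompactSupport_of_norm_ge hW).mul_left
  rw [Measure.volume_eq_prod, integral_prod_symm _ hi]
  refine integral_congr_ae (ae_of_all _ fun y => ?_)
  simp only
  rw [← integral_const_mul]
  refine integral_congr_ae (ae_of_all _ fun s => ?_)
  simp only
  ring

/-- The kernel concentrates at `t` in the first variable. The second factor may vary with `n`
because the time and space cutoffs are sharpened together; the bound by `1` makes dominated
convergence applicable. -/
theorem tendsto_integral_prod_stepKernel_mul (t : ℝ) {W : ℝ × ℝ → ℝ} {R : ℝ}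
    (hc : Continuous W) (hW : ∀ p, R ≤ ‖p‖ → W p = 0) {b : ℕ → ℝ → ℝ} {b' : ℝ → ℝ}
    (hb : ∀ n, Continuous (b n)) (hb1 : ∀ n y, |b n y| ≤ 1)
    (hbb : ∀ y, Tendsto (fun n => b n y) atTop (𝓝 (b' y))) :
    Tendsto (fun n : ℕ => ∫ p : ℝ × ℝ, stepKernel n t p.1 * b n p.2 * W p) atTop
      (𝓝 (∫ y, b' y * W (t, y))) := by
  obtain ⟨C, hC⟩ := (hasCompactSupport_of_norm_ge hW).exists_bound_of_continuous hc
  simp only [integral_prod_stepKernel_mul _ t hc hW (hb _)]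
  have hC0 : 0 ≤ C := (norm_nonneg _).trans (hC 0)
  refine tendsto_integral_of_dominated_convergence ((Icc (-R) R).indicator fun _ => C)
    (fun n => ?_) ?_ (fun n => ae_of_all _ fun y => ?_) (ae_of_all _ fun y => ?_)
  · refine (hb n).aestronglyMeasurable.mul ?_
    have : AEStronglyMeasurable (fun p : ℝ × ℝ => stepKernel n t p.2 * W p.swap)
        ((volume : Measure ℝ).prod volume) :=
      (((continuous_stepKernel n t).comp continuous_snd).mul
        (hc.comp continuous_swap)).aestronglyMeasurable
    exact this.integral_prod_right'
  · exact (integrable_indicator_iff measurableSet_Icc).2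
      (integrableOn_const (by simp) (by simp))
  · by_cases hy : y ∈ Icc (-R) R
    · rw [indicator_of_mem hy, norm_mul]
      calc ‖b n y‖ * ‖∫ s, stepKernel n t s * W (s, y)‖ ≤ 1 * C := by
            refine mul_le_mul (hb1 n y) (abs_integral_stepKernel_mul_le n t fun s => hC _)
              (norm_nonneg _) zero_le_one
        _ = C := one_mul C
    · rw [indicator_of_notMem hy]
      have : ∀ s, W (s, y) = 0 := fun s => hW _ <| by
        rw [Prod.norm_def]
        refine le_max_of_le_right ?_
        rw [Real.norm_eq_abs]
        by_contra h
        exact hy (abs_le.1 (not_le.1 h).le)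
      simp [this]
  · exact (hbb y).mul (tendsto_integral_stepKernel_mul t (hc.comp (by fun_prop)) fun s => hC _)

theorem tendsto_step (t s : ℝ) :
    Tendsto (fun n : ℕ => Real.smoothTransition (n * (s - t))) atTop
      (𝓝 ((Ioi t).indicator (fun _ => 1) s)) := by
  by_cases h : t < s
  · rw [indicator_of_mem (by exact h)]
    refine tendsto_const_nhds.congr' ?_
    obtain ⟨N, hN⟩ := exists_nat_ge (1 / (s - t))
    filter_upwards [eventually_ge_atTop N] with n hn
    have h' : 0 < s - t := sub_pos.2 h
    refine (Real.smoothTransition.one_of_one_le ?_).symm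
    rw [← div_le_iff₀ h']
    exact hN.trans (by exact_mod_cast hn)
  · rw [indicator_of_notMem (by exact h)]
    refine tendsto_const_nhds.congr fun n => ?_
    refine (Real.smoothTransition.zero_of_nonpos ?_).symm
    exact mul_nonpos_of_nonneg_of_nonpos (by positivity) (by linarith [not_lt.1 h])

theorem contDiff_step (n : ℕ) (t : ℝ) :
    ContDiff ℝ ∞ fun s : ℝ => Real.smoothTransition (n * (s - t)) :=
  Real.smoothTransition.contDiff.comp (by fun_prop)

theorem abs_smoothTransition_le_one (x : ℝ) : |Real.smoothTransition x| ≤ 1 := by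
  rw [abs_of_nonneg (Real.smoothTransition.nonneg x)]
  exact Real.smoothTransition.le_one x

/-! ### Product test functions -/

theorem partialT_mul_prod {a b : ℝ → ℝ} {a' : ℝ} {p : ℝ × ℝ} (ha : HasDerivAt a a' p.1)
    (hb : DifferentiableAt ℝ b p.2) :
    partialT (fun q : ℝ × ℝ => a q.1 * b q.2) p = a' * b p.2 := by
  have h1 : HasFDerivAt (fun q : ℝ × ℝ => a q.1)
      ((ContinuousLinearMap.toSpanSingleton ℝ a').comp (ContinuousLinearMap.fst ℝ ℝ ℝ)) p :=
    ha.hasFDerivAt.comp p hasFDerivAt_fst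
  have h2 := hb.hasFDerivAt.comp p (hasFDerivAt_snd (𝕜 := ℝ) (E := ℝ) (F := ℝ) (p := p))
  have h3 := (h1.mul h2).fderiv
  simp only [Function.comp_def] at h3
  have h4 : fderiv ℝ (fun q : ℝ × ℝ => a q.1 * b q.2) p = _ := h3
  rw [partialT, h4]
  simp [mul_comm]

theorem partialX_mul_prod {a b : ℝ → ℝ} {b' : ℝ} {p : ℝ × ℝ} (ha : DifferentiableAt ℝ a p.1)
    (hb : HasDerivAt b b' p.2) :
    partialX (fun q : ℝ × ℝ => a q.1 * b q.2) p = a p.1 * b' := by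
  have h1 := ha.hasFDerivAt.comp p (hasFDerivAt_fst (𝕜 := ℝ) (E := ℝ) (F := ℝ) (p := p))
  have h2 : HasFDerivAt (fun q : ℝ × ℝ => b q.2)
      ((ContinuousLinearMap.toSpanSingleton ℝ b').comp (ContinuousLinearMap.snd ℝ ℝ ℝ)) p :=
    hb.hasFDerivAt.comp p hasFDerivAt_snd
  have h3 := (h1.mul h2).fderiv
  simp only [Function.comp_def] at h3
  have h4 : fderiv ℝ (fun q : ℝ × ℝ => a q.1 * b q.2) p = _ := h3
  rw [partialX, h4]
  simp [mul_comm]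

/-! ### The balance on half-strips -/

/-- Compactly supported data `w`, `B`, `h` with `∂ₜ w + ∂ₓ B = h` weakly on the whole plane. -/
structure WeakBalance (w B h : ℝ × ℝ → ℝ) (R C : ℝ) : Prop where
  continuous_w : Continuous w
  continuous_B : Continuous B
  measurable_h : Measurable h
  w_eq_zero : ∀ p, R ≤ ‖p‖ → w p = 0
  B_eq_zero : ∀ p, R ≤ ‖p‖ → B p = 0
  h_eq_zero : ∀ p, R ≤ ‖p‖ → h p = 0
  bound : ∀ p, |h p| ≤ C
  weak : ∀ ψ : ℝ × ℝ → ℝ, ContDiff ℝ ∞ ψ →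
    ∫ p, (partialT ψ p * w p + partialX ψ p * B p) = - ∫ p, ψ p * h p

theorem integrable_of_bounded {h : ℝ × ℝ → ℝ} {R C : ℝ} (hm : Measurable h)
    (hz : ∀ p, R ≤ ‖p‖ → h p = 0) (hb : ∀ p, |h p| ≤ C) : Integrable h := by
  have h1 : IntegrableOn h (Metric.closedBall 0 R) :=
    Measure.integrableOn_of_bounded (M := C) (measure_closedBall_lt_top).ne
      hm.aestronglyMeasurable (ae_of_all _ hb)
  refine (integrableOn_iff_integrable_of_support_subset fun p hp => ?_).1 h1
  by_contra hp'
  simp only [Metric.mem_closedBall, dist_zero_right, not_le] at hp'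
  exact hp (hz p hp'.le)

/-- The mass of `w` on the right of `x` at time `t`. -/
noncomputable def tailMass (w : ℝ × ℝ → ℝ) (t x : ℝ) : ℝ := ∫ y in Ioi x, w (t, y)

/-- Testing with smoothed indicators of `(t, t'] × (x, ∞)`: their derivatives are approximate Dirac
masses at `t`, `t'` and `x`, which produce the two tail masses and the flux through `x`. The
half-strip is unbounded, which is why `weak` allows test functions without compact support. -/
theorem WeakBalance.tailMass_sub {w B h : ℝ × ℝ → ℝ} {R C : ℝ} (H : WeakBalance w B h R C)
    {t t' : ℝ} (htt : t ≤ t') (x : ℝ) :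
    tailMass w t' x - tailMass w t x =
      (∫ p in Ioc t t' ×ˢ Ioi x, h p) + ∫ s in Ioc t t', B (s, x) := by
  set a : ℕ → ℝ → ℝ := fun n s =>
    Real.smoothTransition (n * (s - t)) - Real.smoothTransition (n * (s - t')) with ha
  set b : ℕ → ℝ → ℝ := fun n y => Real.smoothTransition (n * (y - x)) with hb
  have had : ∀ n s, HasDerivAt (a n) (stepKernel n t s - stepKernel n t' s) s := fun n s =>
    (hasDerivAt_step n t s).sub (hasDerivAt_step n t' s)
  have hbd : ∀ n s, HasDerivAt (b n) (stepKernel n x s) s := fun n s => hasDerivAt_step n x s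
  have hac : ∀ n, Continuous (a n) := fun n =>
    (contDiff_step n t).continuous.sub (contDiff_step n t').continuous
  have hbc : ∀ n, Continuous (b n) := fun n => (contDiff_step n x).continuous
  have hb1 : ∀ n y, |b n y| ≤ 1 := fun n y => abs_smoothTransition_le_one _
  have ha1 : ∀ n y, |a n y| ≤ 1 := fun n y => by
    simp only [ha]
    have := Real.smoothTransition.nonneg (n * (y - t))
    have := Real.smoothTransition.nonneg (n * (y - t'))
    have := Real.smoothTransition.le_one (n * (y - t))
    have := Real.smoothTransition.le_one (n * (y - t'))
    rw [abs_le]; constructor <;> linarith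
  have hbl : ∀ y, Tendsto (fun n => b n y) atTop (𝓝 ((Ioi x).indicator (fun _ => 1) y)) :=
    fun y => tendsto_step x y
  have hal : ∀ s, Tendsto (fun n => a n s) atTop (𝓝 ((Ioc t t').indicator (fun _ => 1) s)) := by
    intro s
    have := (tendsto_step t s).sub (tendsto_step t' s)
    convert! this using 2
    by_cases h1 : t < s
    · by_cases h2 : t' < s
      · simp [indicator, h1, h2, not_le.2 h2]
      · simp [indicator, h1, h2, not_lt.1 h2]
    · have h2 : ¬ t' < s := fun h2 => h1 (htt.trans_lt h2)
      simp [indicator, h1, h2]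
  have hweak : ∀ n, (∫ p : ℝ × ℝ, stepKernel n t p.1 * b n p.2 * w p) -
      (∫ p : ℝ × ℝ, stepKernel n t' p.1 * b n p.2 * w p) +
      (∫ p : ℝ × ℝ, stepKernel n x p.1 * a n p.2 * B p.swap) =
      - ∫ p : ℝ × ℝ, a n p.1 * b n p.2 * h p := by
    intro n
    have hsm : ContDiff ℝ ∞ fun p : ℝ × ℝ => a n p.1 * b n p.2 :=
      (((contDiff_step n t).sub (contDiff_step n t')).comp contDiff_fst).mul
        ((contDiff_step n x).comp contDiff_snd)
    have hi : ∀ τ, Integrable fun p : ℝ × ℝ => stepKernel n τ p.1 * b n p.2 * w p := fun τ =>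
      ((((continuous_stepKernel n τ).comp continuous_fst).mul ((hbc n).comp continuous_snd)).mul
        H.continuous_w).integrable_of_hasCompactSupport
        (hasCompactSupport_of_norm_ge H.w_eq_zero).mul_left
    have hi' : Integrable fun p : ℝ × ℝ => a n p.1 * stepKernel n x p.2 * B p :=
      ((((hac n).comp continuous_fst).mul ((continuous_stepKernel n x).comp continuous_snd)).mul
        H.continuous_B).integrable_of_hasCompactSupport
        (hasCompactSupport_of_norm_ge H.B_eq_zero).mul_left
    rw [← H.weak _ hsm]
    have hsw : ∫ p : ℝ × ℝ, stepKernel n x p.1 * a n p.2 * B p.swap =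
        ∫ p : ℝ × ℝ, a n p.1 * stepKernel n x p.2 * B p := by
      rw [Measure.volume_eq_prod, ← integral_prod_swap]
      refine integral_congr_ae (ae_of_all _ fun p => ?_)
      simp [mul_comm]
    have hi2 : Integrable fun p : ℝ × ℝ => stepKernel n t p.1 * b n p.2 * w p -
        stepKernel n t' p.1 * b n p.2 * w p := (hi t).sub (hi t')
    rw [hsw, ← integral_sub (hi t) (hi t'), ← integral_add hi2 hi']
    refine integral_congr_ae (ae_of_all _ fun p => ?_)
    simp only
    rw [partialT_mul_prod (had n p.1) (hbd n p.2).differentiableAt,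
      partialX_mul_prod (had n p.1).differentiableAt (hbd n p.2)]
    ring
  have L1 := fun τ => tendsto_integral_prod_stepKernel_mul τ H.continuous_w H.w_eq_zero hbc hb1 hbl
  -- The limit lemma concentrates in the first variable, so the coordinates of `B` are swapped.
  have L2 := tendsto_integral_prod_stepKernel_mul x (H.continuous_B.comp continuous_swap)
    (R := R) (fun p hp => H.B_eq_zero _ (by
      rwa [Prod.norm_def, Prod.fst_swap, Prod.snd_swap, max_comm, ← Prod.norm_def])) hac ha1 hal
  have L3 : Tendsto (fun n => ∫ p : ℝ × ℝ, a n p.1 * b n p.2 * h p) atTop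
      (𝓝 (∫ p : ℝ × ℝ, (Ioc t t').indicator (fun _ => 1) p.1 *
        (Ioi x).indicator (fun _ => 1) p.2 * h p)) := by
    refine tendsto_integral_of_dominated_convergence (fun p => |h p|) (fun n => ?_)
      (integrable_of_bounded H.measurable_h H.h_eq_zero H.bound).abs
      (fun n => ae_of_all _ fun p => ?_) (ae_of_all _ fun p => ?_)
    · exact ((((hac n).comp continuous_fst).mul ((hbc n).comp continuous_snd)).measurable.mul
        H.measurable_h).aestronglyMeasurable
    · rw [norm_mul, norm_mul]
      calc ‖a n p.1‖ * ‖b n p.2‖ * ‖h p‖ ≤ 1 * 1 * ‖h p‖ := by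
            gcongr
            · exact ha1 n _
            · exact hb1 n _
        _ = |h p| := by simp
    · exact ((hal _).mul (hbl _)).mul_const _
  have key := tendsto_nhds_unique ((((L1 t).sub (L1 t')).add L2).congr hweak) L3.neg
  have e1 : ∀ τ, ∫ y, (Ioi x).indicator (fun _ => (1 : ℝ)) y * w (τ, y) = tailMass w τ x := by
    intro τ
    rw [tailMass, ← integral_indicator measurableSet_Ioi]
    refine integral_congr_ae (ae_of_all _ fun y => ?_)
    by_cases hy : y ∈ Ioi x <;> simp [hy, indicator]
  have e2 : ∫ y, (Ioc t t').indicator (fun _ => (1 : ℝ)) y * (B ∘ Prod.swap) (x, y) =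
      ∫ s in Ioc t t', B (s, x) := by
    rw [← integral_indicator measurableSet_Ioc]
    refine integral_congr_ae (ae_of_all _ fun y => ?_)
    simp [indicator]
  have e3 : (∫ p : ℝ × ℝ, (Ioc t t').indicator (fun _ => (1 : ℝ)) p.1 *
        (Ioi x).indicator (fun _ => 1) p.2 * h p) = ∫ p in Ioc t t' ×ˢ Ioi x, h p := by
    rw [← integral_indicator (measurableSet_Ioc.prod measurableSet_Ioi)]
    refine integral_congr_ae (ae_of_all _ fun p => ?_)
    by_cases h1 : p.1 ∈ Ioc t t' <;> by_cases h2 : p.2 ∈ Ioi x <;>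
      simp [indicator, mem_prod, h1, h2]
  rw [e1, e1, e2, e3] at key
  linarith

/-! ### Finite unions of intervals, encoded by their ordered endpoints -/

/-- Sequences in `[-R, R]` whose first `n` terms are ordered. -/
def configSet (R : ℝ) (n : ℕ) : Set (ℕ → ℝ) :=
  {x | (∀ i, x i ∈ Icc (-R) R) ∧ ∀ i j, i ≤ j → j < n → x i ≤ x j}

/-- For ordered endpoints, the indicator function of `(x 0, x 1] ∪ (x 2, x 3] ∪ ⋯`. -/
noncomputable def layer (n : ℕ) (x : ℕ → ℝ) (y : ℝ) : ℝ :=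
  ∑ i ∈ Finset.range n, (-1) ^ i * (Ioi (x i)).indicator (fun _ => (1 : ℝ)) y

/-- The mass of `w` at time `t` on the union of intervals with endpoints `x`. -/
noncomputable def layerMass (w : ℝ × ℝ → ℝ) (n : ℕ) (t : ℝ) (x : ℕ → ℝ) : ℝ :=
  ∑ i ∈ Finset.range n, (-1) ^ i * tailMass w t (x i)

theorem isCompact_configSet (R : ℝ) (n : ℕ) : IsCompact (configSet R n) := by
  have h1 : IsCompact (Set.pi univ fun _ : ℕ => Icc (-R) R) :=
    isCompact_univ_pi fun _ => isCompact_Icc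
  have h2 : IsClosed {x : ℕ → ℝ | ∀ i j, i ≤ j → j < n → x i ≤ x j} := by
    simp only [ofPred_forall]
    exact isClosed_iInter fun i => isClosed_iInter fun j => isClosed_iInter fun _ =>
      isClosed_iInter fun _ => isClosed_le (continuous_apply i) (continuous_apply j)
  have h3 : configSet R n = Set.pi univ (fun _ : ℕ => Icc (-R) R) ∩
      {x : ℕ → ℝ | ∀ i j, i ≤ j → j < n → x i ≤ x j} := by
    ext x; simp only [configSet, mem_inter_iff, Set.mem_pi, mem_univ, true_imp_iff]; rfl
  rw [h3]
  exact h1.inter_right h2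

/-- At a point `y` the sum runs over an initial segment of the ordered endpoints, and a partial sum
of `1 - 1 + 1 - ⋯` is `0` or `1`. -/
theorem layer_mem_Icc {n : ℕ} {x : ℕ → ℝ} (hx : ∀ i j, i ≤ j → j < n → x i ≤ x j) (y : ℝ) :
    layer n x y ∈ Icc (0 : ℝ) 1 := by
  induction n with
  | zero => simp [layer]
  | succ n ih =>
    by_cases h : x n < y
    · have : layer (n + 1) x y = ∑ i ∈ Finset.range (n + 1), (-1 : ℝ) ^ i := by
        refine Finset.sum_congr rfl fun i hi => ?_
        have hi' : i ≤ n := Nat.lt_succ_iff.1 (Finset.mem_range.1 hi)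
        have : x i < y := (hx i n hi' (Nat.lt_succ_self n)).trans_lt h
        simp [this]
      rw [this, neg_one_geom_sum]
      split_ifs <;> simp
    · have : layer (n + 1) x y = layer n x y := by
        simp [layer, Finset.sum_range_succ, h]
      rw [this]
      exact ih fun i j hij hj => hx i j hij (hj.trans (Nat.lt_succ_self n))

theorem measurable_layer (n : ℕ) (x : ℕ → ℝ) : Measurable (layer n x) := by
  unfold layer
  exact Finset.measurable_sum _ fun i _ =>
    ((measurable_const.indicator measurableSet_Ioi).const_mul _)

/-! ### Maximizing the mass of a fixed time slice over configurations -/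

section Slice

variable {w : ℝ × ℝ → ℝ} {R : ℝ}

theorem slice_eq_zero (hw : ∀ p, R ≤ ‖p‖ → w p = 0) (t : ℝ) {y : ℝ} (hy : R ≤ |y|) :
    w (t, y) = 0 :=
  hw _ (by rw [Prod.norm_def]; exact le_max_of_le_right hy)

theorem integrable_slice (hc : Continuous w) (hw : ∀ p, R ≤ ‖p‖ → w p = 0) (t : ℝ) :
    Integrable fun y => w (t, y) :=
  (hc.comp (by fun_prop)).integrable_of_hasCompactSupport
    (hasCompactSupport_of_norm_ge (R := R) fun _ hy => slice_eq_zero hw t hy)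

theorem tailMass_sub_tailMass (hc : Continuous w) (hw : ∀ p, R ≤ ‖p‖ → w p = 0) (t a b : ℝ) :
    tailMass w t a - tailMass w t b = ∫ y in a..b, w (t, y) :=
  intervalIntegral.integral_Ioi_sub_Ioi' (integrable_slice hc hw t).integrableOn
    (integrable_slice hc hw t).integrableOn

theorem hasDerivAt_tailMass (hc : Continuous w) (hw : ∀ p, R ≤ ‖p‖ → w p = 0) (t x : ℝ) :
    HasDerivAt (tailMass w t) (-w (t, x)) x := by
  have hs : Continuous fun y => w (t, y) := hc.comp (by fun_prop)
  have h1 : HasDerivAt (fun x => ∫ y in (0 : ℝ)..x, w (t, y)) (w (t, x)) x :=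
    hs.integral_hasStrictDerivAt 0 x |>.hasDerivAt
  have h2 : tailMass w t = fun x => tailMass w t 0 - ∫ y in (0 : ℝ)..x, w (t, y) := by
    ext x; rw [← tailMass_sub_tailMass hc hw]; ring
  rw [h2]
  exact h1.const_sub _

theorem integral_layer_mul (hc : Continuous w) (hw : ∀ p, R ≤ ‖p‖ → w p = 0) (n : ℕ) (t : ℝ)
    (x : ℕ → ℝ) : ∫ y, layer n x y * w (t, y) = layerMass w n t x := by
  have e : (fun y => layer n x y * w (t, y)) = fun y => ∑ i ∈ Finset.range n,
      (-1) ^ i * (Ioi (x i)).indicator (fun y => w (t, y)) y := by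
    ext y
    rw [layer, Finset.sum_mul]
    refine Finset.sum_congr rfl fun i _ => ?_
    by_cases h : y ∈ Ioi (x i) <;> simp [indicator, h]
  rw [e, integral_finsetSum]
  · refine Finset.sum_congr rfl fun i _ => ?_
    rw [integral_const_mul, integral_indicator measurableSet_Ioi, tailMass]
  · exact fun i _ => ((integrable_slice hc hw t).indicator measurableSet_Ioi).const_mul _

theorem exists_isMaxOn_layerMass (hR : 0 ≤ R) (hc : Continuous w)
    (hw : ∀ p, R ≤ ‖p‖ → w p = 0) (n : ℕ) (t : ℝ) :
    ∃ x ∈ configSet R n, IsMaxOn (layerMass w n t) (configSet R n) x := by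
  refine (isCompact_configSet R n).exists_isMaxOn ⟨fun _ => 0, ?_⟩ ?_
  · exact ⟨fun _ => ⟨by linarith, hR⟩, fun _ _ _ _ => le_rfl⟩
  · have : Continuous (tailMass w t) :=
      continuous_iff_continuousAt.2 fun x => (hasDerivAt_tailMass hc hw t x).continuousAt
    unfold layerMass
    exact (continuous_finsetSum _ fun i _ =>
      continuous_const.mul (this.comp (continuous_apply i))).continuousOn

/-- At an optimal configuration, moving a cluster of endpoints shows that the fluxes cancel. -/
theorem cluster_mul_eq_zero (hc : Continuous w) (hw : ∀ p, R ≤ ‖p‖ → w p = 0) {n : ℕ} {t : ℝ}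
    {x : ℕ → ℝ} (hx : x ∈ configSet R n) (hmax : IsMaxOn (layerMass w n t) (configSet R n) x)
    {y : ℝ} (hy : |y| < R) :
    (∑ i ∈ Finset.range n with x i = y, (-1 : ℝ) ^ i) * w (t, y) = 0 := by
  classical
  set m : ℝ := ∑ i ∈ Finset.range n with x i = y, (-1 : ℝ) ^ i with hm
  -- All endpoints located at `y` move together, so coinciding endpoints cannot get out of order and
  -- the variation is admissible for both signs of `τ`.
  set X : ℝ → ℕ → ℝ := fun τ i => if x i = y then x i + τ else x i with hX
  have hX0 : X 0 = x := by ext i; simp [hX]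
  have hcont : ∀ i, Continuous fun τ => X τ i := fun i => by
    by_cases h : x i = y <;> simp only [hX, h, if_true, if_false] <;> fun_prop
  have hval : ∀ τ, layerMass w n t (X τ) =
      (∑ i ∈ Finset.range n with ¬ x i = y, (-1 : ℝ) ^ i * tailMass w t (x i)) +
        m * tailMass w t (y + τ) := by
    intro τ
    rw [layerMass, ← Finset.sum_filter_add_sum_filter_not (Finset.range n) (fun i => x i = y),
      add_comm, hm, Finset.sum_mul]
    congr 1
    · refine Finset.sum_congr rfl fun i hi => ?_
      simp [hX, (Finset.mem_filter.1 hi).2]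
    · refine Finset.sum_congr rfl fun i hi => ?_
      simp [hX, (Finset.mem_filter.1 hi).2]
  have hmem : ∀ᶠ τ in 𝓝 (0 : ℝ), X τ ∈ configSet R n := by
    have h1 : ∀ᶠ τ in 𝓝 (0 : ℝ), y + τ ∈ Icc (-R) R := by
      have : ContinuousAt (fun τ : ℝ => y + τ) 0 := by fun_prop
      refine this.eventually_mem (Icc_mem_nhds ?_ ?_) <;> simp only [add_zero]
      · exact (abs_lt.1 hy).1
      · exact (abs_lt.1 hy).2
    -- Endpoints at distinct positions stay strictly ordered for small `τ`; those at equal positions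
    -- remain equal.
    have h2 : ∀ᶠ τ in 𝓝 (0 : ℝ), ∀ j ∈ Finset.range n, ∀ i ∈ Finset.range n, i ≤ j →
        X τ i ≤ X τ j := by
      rw [Finset.eventually_all]
      intro j hj
      rw [Finset.eventually_all]
      intro i hi
      by_cases hij : i ≤ j
      swap
      · exact Eventually.of_forall fun τ h => absurd h hij
      rcases (hx.2 i j hij (Finset.mem_range.1 hj)).lt_or_eq with h | h
      · have : ∀ᶠ τ in 𝓝 (0 : ℝ), X τ i < X τ j :=
          (hcont i).continuousAt.eventually_lt (hcont j).continuousAt (by rwa [hX0])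
        filter_upwards [this] with τ hτ _ using hτ.le
      · exact Eventually.of_forall fun τ _ => by simp [hX, h]
    filter_upwards [h1, h2] with τ h1 h2
    refine ⟨fun i => ?_, fun i j hij hj => h2 j (Finset.mem_range.2 hj) i
      (Finset.mem_range.2 (hij.trans_lt hj)) hij⟩
    by_cases h : x i = y
    · simpa [hX, h] using h1
    · simpa [hX, h] using hx.1 i
  have hloc : IsLocalMax (fun τ => layerMass w n t (X τ)) 0 := by
    filter_upwards [hmem] with τ hτ
    rw [hX0]
    exact hmax hτ
  have hder : HasDerivAt (fun τ => layerMass w n t (X τ)) (m * -w (t, y)) 0 := by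
    have h := hasDerivAt_tailMass hc hw t (y + 0)
    have h' : HasDerivAt (fun τ => tailMass w t (y + τ)) (-w (t, y + 0)) 0 := h.comp_const_add y 0
    rw [add_zero] at h'
    rw [funext hval]
    exact (h'.const_mul m).const_add _
  have := hloc.hasDerivAt_eq_zero hder
  linarith

/-- Group the endpoints by position. In each group either the signs cancel, or stationarity forces
`w = 0` and hence `B = 0`; at positions with `R ≤ |y|` both functions vanish anyway. -/
theorem sum_flux_eq_zero {B : ℝ × ℝ → ℝ} (hc : Continuous w) (hw : ∀ p, R ≤ ‖p‖ → w p = 0)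
    (hB : ∀ p, w p = 0 → B p = 0) {n : ℕ} {t : ℝ} {x : ℕ → ℝ} (hx : x ∈ configSet R n)
    (hmax : IsMaxOn (layerMass w n t) (configSet R n) x) :
    ∑ i ∈ Finset.range n, (-1 : ℝ) ^ i * B (t, x i) = 0 := by
  classical
  rw [← Finset.sum_fiberwise_of_maps_to (t := (Finset.range n).image x) (g := x)
    fun i hi => Finset.mem_image_of_mem x hi]
  refine Finset.sum_eq_zero fun y _ => ?_
  have e : ∑ i ∈ Finset.range n with x i = y, (-1 : ℝ) ^ i * B (t, x i) =
      (∑ i ∈ Finset.range n with x i = y, (-1 : ℝ) ^ i) * B (t, y) := by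
    rw [Finset.sum_mul]
    exact Finset.sum_congr rfl fun i hi => by rw [(Finset.mem_filter.1 hi).2]
  rw [e]
  by_cases hy : |y| < R
  · rcases mul_eq_zero.1 (cluster_mul_eq_zero hc hw hx hmax hy) with h | h
    · rw [h, zero_mul]
    · rw [hB _ h, mul_zero]
  · rw [hB _ (slice_eq_zero hw t (not_lt.1 hy)), mul_zero]

theorem sum_range_two_mul (f : ℕ → ℝ) (m : ℕ) :
    ∑ i ∈ Finset.range (2 * m), f i = ∑ j ∈ Finset.range m, (f (2 * j) + f (2 * j + 1)) := by
  induction m with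
  | zero => simp
  | succ m ih =>
    rw [Nat.mul_succ, Finset.sum_range_succ, Finset.sum_range_succ, ih, Finset.sum_range_succ]
    ring

theorem integral_posPart_eq (hw : ∀ p, R ≤ ‖p‖ → w p = 0) (t : ℝ) :
    ∫ y, max (w (t, y)) 0 = ∫ y in (-R)..R, max (w (t, y)) 0 := by
  refine (intervalIntegral.integral_eq_integral_of_support_subset fun y hy => ?_).symm
  have : |y| < R := by
    by_contra h
    exact hy (by simp [slice_eq_zero hw t (not_lt.1 h)])
  exact ⟨(abs_lt.1 this).1, (abs_lt.1 this).2.le⟩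

/-- Unions of grid cells almost exhaust the positive part of `w (t, ·)`. -/
theorem exists_config_deficit_le (hR : 0 < R) (hc : Continuous w) (hw : ∀ p, R ≤ ‖p‖ → w p = 0)
    {m : ℕ} (hm : 0 < m) {t ε : ℝ}
    (hε : ∀ a b, |a - b| ≤ 2 * R / m → |w (t, a) - w (t, b)| ≤ ε) :
    ∃ x ∈ configSet R (2 * m),
      (∫ y, max (w (t, y)) 0) - layerMass w (2 * m) t x ≤ 2 * R * ε := by
  classical
  have hm' : (0 : ℝ) < m := by exact_mod_cast hm
  -- A grid of `m` equal cells on `[-R, R]`; the minimum makes the sequence stop at `R`.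
  set g : ℕ → ℝ := fun j => min R (-R + 2 * R / m * j) with hg
  have hstep : 0 < 2 * R / m := by positivity
  have hgmono : Monotone g := fun i j hij => by
    simp only [hg]
    gcongr
  have hg0 : g 0 = -R := by simp [hg]; linarith
  have hgm : g m = R := by
    simp only [hg]
    rw [div_mul_cancel₀ _ hm'.ne']
    exact min_eq_left (by linarith)
  have hgR : ∀ j, g j ∈ Icc (-R) R := fun j =>
    ⟨hg0 ▸ hgmono (Nat.zero_le j), min_le_left _ _⟩
  have hgs : ∀ j, g (j + 1) - g j ≤ 2 * R / m := fun j => by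
    simp only [hg]
    push_cast
    rcases min_cases R (-R + 2 * R / m * j) with ⟨h, h'⟩ | ⟨h, h'⟩
    · rw [h]; linarith [min_le_left R (-R + 2 * R / m * (j + 1))]
    · rw [h]; linarith [min_le_right R (-R + 2 * R / m * (j + 1))]
  have hgs0 : ∀ j, g j ≤ g (j + 1) := fun j => hgmono (Nat.le_succ j)
  -- A cell is selected when `w` is positive at its left end. Otherwise its interval is empty, which
  -- keeps the number of endpoints equal to `2 * m`.
  set r : ℕ → ℝ := fun j => if 0 < w (t, g j) then g (j + 1) else g j with hr
  have hrl : ∀ j, g j ≤ r j := fun j => by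
    simp only [hr]; split_ifs
    exacts [hgs0 j, le_rfl]
  have hru : ∀ j, r j ≤ g (j + 1) := fun j => by
    simp only [hr]; split_ifs
    exacts [le_rfl, hgs0 j]
  -- Even indices open the interval of a cell and odd indices close it.
  set x : ℕ → ℝ := fun i => if i % 2 = 0 then g (i / 2) else r (i / 2) with hx
  have hxl : ∀ i, g (i / 2) ≤ x i := fun i => by
    simp only [hx]; split_ifs
    exacts [le_rfl, hrl _]
  have hxu : ∀ i, x i ≤ g (i / 2 + 1) := fun i => by
    simp only [hx]; split_ifs
    exacts [hgs0 _, hru _]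
  have hx0 : ∀ j, x (2 * j) = g j := fun j => by simp [hx]
  have hx1 : ∀ j, x (2 * j + 1) = r j := fun j => by
    have h1 : (2 * j + 1) % 2 = 1 := by omega
    have h2 : (2 * j + 1) / 2 = j := by omega
    simp [hx, h1, h2]
  refine ⟨x, ⟨fun i => ⟨(hgR _).1.trans (hxl i), (hxu i).trans (hgR _).2⟩, fun i j hij _ => ?_⟩, ?_⟩
  · rcases Nat.lt_or_ge (i / 2) (j / 2) with h | h
    · exact (hxu i).trans ((hgmono h).trans (hxl j))
    · have h2 : i / 2 = j / 2 := le_antisymm (Nat.div_le_div_right hij) h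
      by_cases hi : i % 2 = 0
      · have : x i = g (j / 2) := by simp [hx, hi, h2]
        rw [this]; exact hxl j
      · have : i = j := by omega
        rw [this]
  · have hs : Continuous fun y => w (t, y) := hc.comp (by fun_prop)
    have hs' : Continuous fun y => max (w (t, y)) 0 := hs.max continuous_const
    rw [layerMass, sum_range_two_mul, integral_posPart_eq hw, ← hg0, ← hgm,
      ← intervalIntegral.sum_integral_adjacent_intervals
        fun k _ => hs'.intervalIntegrable _ _, ← Finset.sum_sub_distrib]
    have hsum : 2 * R * ε = ∑ j ∈ Finset.range m, ε * (g (j + 1) - g j) := by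
      rw [← Finset.mul_sum, Finset.sum_range_sub, hgm, hg0]; ring
    rw [hgm, hsum]
    refine Finset.sum_le_sum fun j _ => ?_
    have e : (-1 : ℝ) ^ (2 * j) * tailMass w t (x (2 * j)) +
        (-1) ^ (2 * j + 1) * tailMass w t (x (2 * j + 1)) = ∫ y in (g j)..(r j), w (t, y) := by
      rw [hx0, hx1, ← tailMass_sub_tailMass hc hw, pow_succ, pow_mul]; simp; ring
    rw [e]
    -- The oscillation bound controls both kinds of error: `w ≥ -ε` on a selected cell and `w ≤ ε`
    -- on a rejected one.
    have hosc : ∀ y ∈ Icc (g j) (g (j + 1)), |w (t, y) - w (t, g j)| ≤ ε := fun y hy =>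
      hε _ _ (by
        rw [abs_of_nonneg (by linarith [hy.1])]
        linarith [hy.2, hgs j])
    have hconst : ε * (g (j + 1) - g j) = ∫ _ in (g j)..(g (j + 1)), ε := by
      rw [intervalIntegral.integral_const, smul_eq_mul, mul_comm]
    rw [hconst]
    by_cases hpos : 0 < w (t, g j)
    · have : r j = g (j + 1) := by simp [hr, hpos]
      rw [this, ← intervalIntegral.integral_sub (hs'.intervalIntegrable _ _)
        (hs.intervalIntegrable _ _)]
      refine intervalIntegral.integral_mono_on (hgs0 j) ((hs'.sub hs).intervalIntegrable _ _)
        (continuous_const.intervalIntegrable _ _) fun y hy => ?_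
      have := abs_le.1 (hosc y hy)
      rcases max_cases (w (t, y)) 0 with h | h <;> linarith [this.1, this.2]
    · have : r j = g j := by simp [hr, hpos]
      rw [this, intervalIntegral.integral_same, sub_zero]
      refine intervalIntegral.integral_mono_on (hgs0 j) (hs'.intervalIntegrable _ _)
        (continuous_const.intervalIntegrable _ _) fun y hy => ?_
      have := abs_le.1 (hosc y hy)
      have hε0 : 0 ≤ ε := (abs_nonneg _).trans (hosc y hy)
      rcases max_cases (w (t, y)) 0 with h | h <;> linarith [this.1, this.2]

end Slice

/-! ### The source has zero mass on the positivity set -/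

/-- The quantity `a⁺ - θ a` equals `|a|` times the distance from `θ` to the indicator of `a > 0`.
Hence for `|a| ≥ δ` replacing that indicator by `θ` costs at most `C / δ * (a⁺ - θ a)`, while on
`|a| ≤ δ` the cost is at most `|h|`. A small mass deficit thus controls the source on a suboptimal
set. -/
theorem abs_layer_sub_mul_le {θ a h C δ : ℝ} (hθ : θ ∈ Icc (0 : ℝ) 1) (hδ : 0 < δ)
    (hC : |h| ≤ C) :
    (Ioi (0 : ℝ)).indicator (fun _ => h) a - (Icc (-δ) δ).indicator (fun _ => |h|) a
      - C / δ * (max a 0 - θ * a) ≤ θ * h := by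
  have hC0 : 0 ≤ C := (abs_nonneg h).trans hC
  have hCδ : 0 ≤ C / δ := by positivity
  have hh := abs_le.1 (le_refl |h|)
  have hn := abs_nonneg h
  have h01 := hθ.1
  have h02 := hθ.2
  by_cases ha : a ∈ Icc (-δ) δ
  · rw [indicator_of_mem ha]
    by_cases hp : a ∈ Ioi (0 : ℝ)
    · rw [indicator_of_mem hp, max_eq_left (le_of_lt hp)]
      have : 0 ≤ C / δ * (a - θ * a) := mul_nonneg hCδ (by
        have : (0 : ℝ) < a := hp
        nlinarith)
      nlinarith
    · rw [indicator_of_notMem hp, max_eq_right (not_lt.1 hp)]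
      have : 0 ≤ C / δ * (0 - θ * a) := mul_nonneg hCδ (by
        have : a ≤ 0 := not_lt.1 hp
        nlinarith)
      nlinarith
  · rw [indicator_of_notMem ha]
    by_cases hp : a ∈ Ioi (0 : ℝ)
    · rw [indicator_of_mem hp, max_eq_left (le_of_lt hp)]
      have hp' : (0 : ℝ) < a := hp
      have hda : δ ≤ a := by
        by_contra h
        exact ha ⟨by linarith, by linarith⟩
      have : C * (1 - θ) ≤ C / δ * (a - θ * a) := by
        have : C / δ * (a - θ * a) = C * (1 - θ) * (a / δ) := by field_simp
        rw [this]
        exact le_mul_of_one_le_right (mul_nonneg hC0 (by linarith)) ((one_le_div hδ).2 hda)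
      nlinarith
    · rw [indicator_of_notMem hp, max_eq_right (not_lt.1 hp)]
      have hp' : a ≤ 0 := not_lt.1 hp
      have hda : δ ≤ -a := by
        by_contra h
        exact ha ⟨by linarith, by linarith⟩
      have : C * θ ≤ C / δ * (0 - θ * a) := by
        have : C / δ * (0 - θ * a) = C * θ * (-a / δ) := by field_simp; ring
        rw [this]
        exact le_mul_of_one_le_right (mul_nonneg hC0 h01) ((one_le_div hδ).2 hda)
      nlinarith

/-- For `θ ∈ [0, 1]` the map `a ↦ a⁺ - θ a` has slopes `1 - θ` and `-θ`, so it is 1-Lipschitz. This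
keeps the deficit of a frozen configuration small for a short time. -/
theorem posPart_sub_mul_le {θ a b e : ℝ} (hθ : θ ∈ Icc (0 : ℝ) 1) (h : |a - b| ≤ e) :
    max a 0 - θ * a ≤ max b 0 - θ * b + e := by
  have h01 := hθ.1
  have h02 := hθ.2
  have := abs_le.1 h
  rcases max_cases a 0 with h1 | h1 <;> rcases max_cases b 0 with h2 | h2 <;>
    rw [h1.1, h2.1] <;> nlinarith

theorem posPart_sub_mul_nonneg {θ a : ℝ} (hθ : θ ∈ Icc (0 : ℝ) 1) : 0 ≤ max a 0 - θ * a := by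
  have h01 := hθ.1
  have h02 := hθ.2
  rcases max_cases a 0 with h1 | h1 <;> rw [h1.1] <;> nlinarith

/-- The mass of `w (t, ·)` on its positivity set that is missed by a configuration. -/
theorem deficit_slice_le {w : ℝ × ℝ → ℝ} {R : ℝ} (hR : 0 < R) (hc : Continuous w)
    (hw : ∀ p, R ≤ ‖p‖ → w p = 0) {n : ℕ} {x : ℕ → ℝ} (hx : x ∈ configSet R n) {t s d e : ℝ}
    (hd : (∫ y, max (w (t, y)) 0) - layerMass w n t x ≤ d)
    (he : ∀ y, |w (s, y) - w (t, y)| ≤ e) :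
    ∫ y, (max (w (s, y)) 0 - layer n x y * w (s, y)) ≤ d + 2 * R * e := by
  have hi : ∀ τ, Integrable fun y => layer n x y * w (τ, y) := fun τ =>
    (integrable_slice hc hw τ).bdd_mul (measurable_layer n x).aestronglyMeasurable
      (c := 1) (ae_of_all _ fun y => by
        have := layer_mem_Icc hx.2 y
        rw [Real.norm_of_nonneg this.1]; exact this.2)
  have hi' : ∀ τ, Integrable fun y => max (w (τ, y)) 0 := fun τ =>
    (integrable_slice hc hw τ).pos_part
  have hi'' : Integrable ((Icc (-R) R).indicator fun _ : ℝ => e) :=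
    (integrable_indicator_iff measurableSet_Icc).2 (integrableOn_const (by simp) (by simp))
  calc ∫ y, (max (w (s, y)) 0 - layer n x y * w (s, y))
      ≤ ∫ y, ((max (w (t, y)) 0 - layer n x y * w (t, y)) +
          (Icc (-R) R).indicator (fun _ => e) y) := by
        refine integral_mono ((hi' s).sub (hi s)) (((hi' t).sub (hi t)).add hi'') fun y => ?_
        by_cases hy : y ∈ Icc (-R) R
        · simp only [indicator_of_mem hy]
          exact posPart_sub_mul_le (layer_mem_Icc hx.2 y) (he y)
        · have : R ≤ |y| := by
            by_contra h
            exact hy (abs_le.1 (not_le.1 h).le)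
          simp [indicator_of_notMem hy, slice_eq_zero hw _ this]
    _ = ((∫ y, max (w (t, y)) 0) - layerMass w n t x) + 2 * R * e := by
        have e1 : ∫ y, (max (w (t, y)) 0 - layer n x y * w (t, y)) =
            (∫ y, max (w (t, y)) 0) - layerMass w n t x := by
          rw [integral_sub (hi' t) (hi t), integral_layer_mul hc hw]
        have hi3 : Integrable fun y => max (w (t, y)) 0 - layer n x y * w (t, y) :=
          (hi' t).sub (hi t)
        rw [← e1, integral_add hi3 hi'', integral_indicator measurableSet_Icc, setIntegral_const,
          Real.volume_real_Icc_of_le (by linarith), smul_eq_mul]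
        ring
    _ ≤ _ := by linarith

theorem WeakBalance.layerMass_sub {w B h : ℝ × ℝ → ℝ} {R C : ℝ} (H : WeakBalance w B h R C)
    {t t' : ℝ} (htt : t ≤ t') (n : ℕ) (x : ℕ → ℝ) :
    layerMass w n t' x - layerMass w n t x =
      (∫ p in Ioc t t' ×ˢ univ, layer n x p.2 * h p) +
        ∫ s in Ioc t t', ∑ i ∈ Finset.range n, (-1) ^ i * B (s, x i) := by
  have hB : ∀ i, IntegrableOn (fun s => B (s, x i)) (Ioc t t') := fun i =>
    ((H.continuous_B.comp (by fun_prop)).integrableOn_Icc (a := t) (b := t')).mono_set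
      Ioc_subset_Icc_self
  have hh := integrable_of_bounded H.measurable_h H.h_eq_zero H.bound
  have e1 : (∫ p in Ioc t t' ×ˢ univ, layer n x p.2 * h p) =
      ∑ i ∈ Finset.range n, (-1) ^ i * ∫ p in Ioc t t' ×ˢ Ioi (x i), h p := by
    have : ∀ p : ℝ × ℝ, layer n x p.2 * h p =
        ∑ i ∈ Finset.range n, (-1) ^ i * (univ ×ˢ Ioi (x i)).indicator h p := by
      intro p
      rw [layer, Finset.sum_mul]
      refine Finset.sum_congr rfl fun i _ => ?_
      by_cases hp : p.2 ∈ Ioi (x i) <;> simp [indicator, hp, mem_prod]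
    simp only [this]
    have hm : ∀ i, MeasurableSet ((univ : Set ℝ) ×ˢ Ioi (x i)) := fun i =>
      MeasurableSet.univ.prod measurableSet_Ioi
    rw [integral_finsetSum]
    · refine Finset.sum_congr rfl fun i _ => ?_
      rw [integral_const_mul, setIntegral_indicator (hm i), prod_inter_prod, inter_univ, univ_inter]
    · exact fun i _ => ((hh.indicator (hm i)).const_mul _).integrableOn
  have e2 : ∫ s in Ioc t t', ∑ i ∈ Finset.range n, (-1) ^ i * B (s, x i) =
      ∑ i ∈ Finset.range n, (-1) ^ i * ∫ s in Ioc t t', B (s, x i) := by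
    rw [integral_finsetSum]
    · exact Finset.sum_congr rfl fun i _ => integral_const_mul _ _
    · exact fun i _ => (hB i).const_mul _
  rw [e1, e2, layerMass, layerMass, ← Finset.sum_sub_distrib, ← Finset.sum_add_distrib]
  refine Finset.sum_congr rfl fun i _ => ?_
  rw [← mul_sub, H.tailMass_sub htt, mul_add]

/-- A lower bound for the source, up to the error committed on `{|w| ≤ δ}`. -/
noncomputable def truncatedSource (w h : ℝ × ℝ → ℝ) (δ : ℝ) (p : ℝ × ℝ) : ℝ :=
  (Ioi (0 : ℝ)).indicator (fun _ => h p) (w p) - (Icc (-δ) δ).indicator (fun _ => |h p|) (w p)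

theorem WeakBalance.integrable_truncatedSource {w B h : ℝ × ℝ → ℝ} {R C : ℝ}
    (H : WeakBalance w B h R C) (δ : ℝ) : Integrable (truncatedSource w h δ) := by
  have hh := integrable_of_bounded H.measurable_h H.h_eq_zero H.bound
  have m1 : MeasurableSet (w ⁻¹' Ioi 0) := H.continuous_w.measurable measurableSet_Ioi
  have m2 : MeasurableSet (w ⁻¹' Icc (-δ) δ) := H.continuous_w.measurable measurableSet_Icc
  exact (hh.indicator m1).sub (hh.abs.indicator m2)

/-- The configuration is frozen on `(t, t']`. The pointwise inequality `abs_layer_sub_mul_le`,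
integrated over the slab, converts the deficit `d` into a source error `C / δ * d`, to which the net
flux adds at most `b`. -/
theorem WeakBalance.layerMass_increment {w B h : ℝ × ℝ → ℝ} {R C : ℝ} (H : WeakBalance w B h R C)
    {δ d b t t' : ℝ} (hδ : 0 < δ) (htt : t ≤ t') {n : ℕ} {x : ℕ → ℝ}
    (hx : x ∈ configSet R n)
    (hd : ∀ s ∈ Ioc t t', ∫ y, (max (w (s, y)) 0 - layer n x y * w (s, y)) ≤ d)
    (hb : ∀ s ∈ Ioc t t', |∑ i ∈ Finset.range n, (-1) ^ i * B (s, x i)| ≤ b) :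
    (∫ p in Ioc t t' ×ˢ univ, truncatedSource w h δ p) - (C / δ * d + b) * (t' - t) ≤
      layerMass w n t' x - layerMass w n t x := by
  have hC0 : 0 ≤ C := (abs_nonneg _).trans (H.bound 0)
  have hl : Measurable fun p : ℝ × ℝ => layer n x p.2 := (measurable_layer n x).comp measurable_snd
  have hl1 : ∀ p : ℝ × ℝ, ‖layer n x p.2‖ ≤ 1 := fun p => by
    have := layer_mem_Icc hx.2 p.2
    rw [Real.norm_of_nonneg this.1]; exact this.2
  have hh := integrable_of_bounded H.measurable_h H.h_eq_zero H.bound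
  have hwi : Integrable w := H.continuous_w.integrable_of_hasCompactSupport
    (hasCompactSupport_of_norm_ge H.w_eq_zero)
  have hi1 : Integrable fun p : ℝ × ℝ => layer n x p.2 * h p :=
    hh.bdd_mul hl.aestronglyMeasurable (ae_of_all _ hl1)
  have hi2 : Integrable fun p : ℝ × ℝ => max (w p) 0 - layer n x p.2 * w p :=
    hwi.pos_part.sub (hwi.bdd_mul hl.aestronglyMeasurable (ae_of_all _ hl1))
  have hvol : volume.real (Ioc t t') = t' - t := by simp [htt]
  have k1 : (∫ p in Ioc t t' ×ˢ univ, truncatedSource w h δ p) -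
      C / δ * (∫ p in Ioc t t' ×ˢ univ, (max (w p) 0 - layer n x p.2 * w p)) ≤
      ∫ p in Ioc t t' ×ˢ univ, layer n x p.2 * h p := by
    rw [← integral_const_mul, ← integral_sub (H.integrable_truncatedSource δ).integrableOn
      (hi2.const_mul _).integrableOn]
    refine integral_mono ((H.integrable_truncatedSource δ).sub (hi2.const_mul _)).integrableOn
      hi1.integrableOn fun p => ?_
    exact abs_layer_sub_mul_le (layer_mem_Icc hx.2 p.2) hδ (H.bound p)
  have k2 : ∫ p in Ioc t t' ×ˢ univ, (max (w p) 0 - layer n x p.2 * w p) ≤ d * (t' - t) := by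
    rw [Measure.volume_eq_prod, setIntegral_prod _ hi2.integrableOn, ← hvol]
    refine (Real.le_norm_self _).trans (norm_setIntegral_le_of_norm_le_const measure_Ioc_lt_top fun s hs => ?_)
    rw [setIntegral_univ, Real.norm_of_nonneg]
    · exact hd s hs
    · exact integral_nonneg fun y => posPart_sub_mul_nonneg (layer_mem_Icc hx.2 y)
  have k3 : |∫ s in Ioc t t', ∑ i ∈ Finset.range n, (-1) ^ i * B (s, x i)| ≤ b * (t' - t) := by
    rw [← hvol, ← Real.norm_eq_abs]
    exact norm_setIntegral_le_of_norm_le_const measure_Ioc_lt_top fun s hs => by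
      rw [Real.norm_eq_abs]; exact hb s hs
  rw [H.layerMass_sub htt]
  have k4 := mul_le_mul_of_nonneg_left k2 (div_nonneg hC0 hδ.le)
  have k5 := (abs_le.1 k3).1
  nlinarith

/-- Optimize, freeze for one time step, optimize again, and telescope. The number of endpoints is
fixed before the time step is chosen, so the step can be made small enough for the sum of all the
fluxes. -/
theorem WeakBalance.integral_truncatedSource_le {w B h : ℝ × ℝ → ℝ} {R C : ℝ}
    (H : WeakBalance w B h R C) (hR : 0 < R) (hB : ∀ p, w p = 0 → B p = 0) {δ ε : ℝ}
    (hδ : 0 < δ) (hε : 0 < ε) : ∫ p, truncatedSource w h δ p ≤ 2 * R * ε := by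
  have hC0 : 0 ≤ C := (abs_nonneg _).trans (H.bound 0)
  -- One term `2 * R * e₁` is the deficit of the grid configuration, the other the variation of `w`
  -- during a time step. The `+ 1` in the denominator covers `C = 0`.
  obtain ⟨e₁, he₁, hCe⟩ : ∃ e₁ > 0, C / δ * (2 * R * e₁ + 2 * R * e₁) ≤ ε / 2 := by
    have hD : 0 < C / δ * (4 * R) + 1 := by positivity
    refine ⟨ε / 2 / (C / δ * (4 * R) + 1), by positivity, ?_⟩
    calc _ = (C / δ * (4 * R)) * (ε / 2 / (C / δ * (4 * R) + 1)) := by ring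
      _ ≤ (C / δ * (4 * R) + 1) * (ε / 2 / (C / δ * (4 * R) + 1)) := by
        gcongr; linarith
      _ = ε / 2 := by field_simp
  obtain ⟨κ₁, hκ₁, hw₁⟩ := Metric.uniformContinuous_iff.1
    ((hasCompactSupport_of_norm_ge H.w_eq_zero).uniformContinuous_of_continuous H.continuous_w)
    e₁ he₁
  obtain ⟨m, hm⟩ := exists_nat_gt (2 * R / κ₁)
  have hm' : (0 : ℝ) < m := lt_of_le_of_lt (by positivity) hm
  have hm0 : 0 < m := by exact_mod_cast hm'
  have hmκ : 2 * R / m < κ₁ := by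
    rw [div_lt_iff₀ hκ₁] at hm
    rw [div_lt_iff₀ hm']; linarith
  set n := 2 * m with hn
  have hn' : (0 : ℝ) < n := by rw [hn]; push_cast; linarith
  -- The tolerance is divided by `n` because `n` endpoint fluxes are added.
  obtain ⟨κ₂, hκ₂, hB₂⟩ := Metric.uniformContinuous_iff.1
    ((hasCompactSupport_of_norm_ge H.B_eq_zero).uniformContinuous_of_continuous H.continuous_B)
    (ε / 2 / n) (by positivity)
  -- The maximizers are chosen independently at each time; no regularity of `X` in `t` is needed.
  choose X hX hmax using fun t => exists_isMaxOn_layerMass hR.le H.continuous_w H.w_eq_zero n t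
  have hdef : ∀ t, (∫ y, max (w (t, y)) 0) - layerMass w n t (X t) ≤ 2 * R * e₁ := by
    intro t
    obtain ⟨x, hx, hxd⟩ := exists_config_deficit_le (t := t) (ε := e₁) hR H.continuous_w
      H.w_eq_zero hm0 (fun a b hab => by
        refine (hw₁ (a := (t, a)) (b := (t, b)) ?_).le
        rw [Prod.dist_eq, dist_self, Real.dist_eq, max_eq_right (abs_nonneg _)]
        exact hab.trans_lt hmκ)
    have := hmax t hx
    simp only [mem_ofPred_eq] at this
    linarith
  obtain ⟨K, hK⟩ := exists_nat_gt (2 * R / min κ₁ κ₂)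
  have hκ : 0 < min κ₁ κ₂ := lt_min hκ₁ hκ₂
  have hK' : (0 : ℝ) < K := lt_of_le_of_lt (by positivity) hK
  set σ := 2 * R / K with hσ
  have hσ0 : 0 < σ := by positivity
  have hσκ : σ < min κ₁ κ₂ := by
    rw [div_lt_iff₀ hκ] at hK
    rw [hσ, div_lt_iff₀ hK']; linarith
  -- In one step of length `σ`, half of the error rate `ε` comes from the deficit and half from the
  -- flux, whose sum is exactly zero at the initial time of the step.
  have hstep : ∀ t, (∫ p in Ioc t (t + σ) ×ˢ univ, truncatedSource w h δ p) - ε * σ ≤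
      layerMass w n (t + σ) (X (t + σ)) - layerMass w n t (X t) := by
    intro t
    have hdist : ∀ s ∈ Ioc t (t + σ), ∀ y : ℝ, dist (s, y) (t, y) < min κ₁ κ₂ := fun s hs y => by
      rw [Prod.dist_eq, dist_self, Real.dist_eq, max_eq_left (abs_nonneg _),
        abs_of_pos (by linarith [hs.1])]
      linarith [hs.2]
    have h1 := H.layerMass_increment hδ (t := t) (t' := t + σ) (by linarith) (hX t)
      (d := 2 * R * e₁ + 2 * R * e₁) (b := ε / 2)
      (fun s hs => deficit_slice_le hR H.continuous_w H.w_eq_zero (hX t) (hdef t) fun y =>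
        (hw₁ ((hdist s hs y).trans_le (min_le_left _ _))).le)
      (fun s hs => by
        have h0 := sum_flux_eq_zero H.continuous_w H.w_eq_zero hB (hX t) (hmax t)
        rw [← sub_zero (∑ i ∈ Finset.range n, (-1 : ℝ) ^ i * B (s, X t i)), ← h0,
          ← Finset.sum_sub_distrib]
        refine (Finset.abs_sum_le_sum_abs _ _).trans ?_
        calc _ ≤ ∑ i ∈ Finset.range n, ε / 2 / n := by
              refine Finset.sum_le_sum fun i _ => ?_
              rw [← mul_sub, abs_mul, abs_pow, abs_neg, abs_one, one_pow, one_mul]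
              exact (hB₂ ((hdist s hs _).trans_le (min_le_right _ _))).le
          _ = ε / 2 := by
              rw [Finset.sum_const, Finset.card_range, nsmul_eq_mul]; field_simp)
    -- The old configuration is still admissible, so optimizing again does not lose mass.
    have h2 : layerMass w n (t + σ) (X t) ≤ layerMass w n (t + σ) (X (t + σ)) :=
      hmax (t + σ) (hX t)
    have h3 : (C / δ * (2 * R * e₁ + 2 * R * e₁) + ε / 2) * (t + σ - t) ≤ ε * σ := by
      rw [add_sub_cancel_left]
      gcongr
      linarith
    linarith
  have hind : ∀ j : ℕ, (∫ p in Ioc (-R) (-R + j * σ) ×ˢ univ, truncatedSource w h δ p) -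
      ε * (j * σ) ≤
      layerMass w n (-R + j * σ) (X (-R + j * σ)) - layerMass w n (-R) (X (-R)) := by
    intro j
    induction j with
    | zero => simp
    | succ j ih =>
      have hj := hstep (-R + j * σ)
      have e : -R + ((j + 1 : ℕ) : ℝ) * σ = -R + j * σ + σ := by push_cast; ring
      rw [e]
      have hsplit : Ioc (-R) (-R + j * σ + σ) ×ˢ (univ : Set ℝ) =
          Ioc (-R) (-R + j * σ) ×ˢ univ ∪ Ioc (-R + j * σ) (-R + j * σ + σ) ×ˢ univ := by
        rw [← union_prod, Ioc_union_Ioc_eq_Ioc]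
        · have : 0 ≤ j * σ := by positivity
          linarith
        · linarith
      rw [hsplit, setIntegral_union ?_ (measurableSet_Ioc.prod MeasurableSet.univ)
        (H.integrable_truncatedSource δ).integrableOn (H.integrable_truncatedSource δ).integrableOn]
      · push_cast
        linarith
      · rw [Set.disjoint_prod]
        left
        rw [Set.disjoint_left]
        exact fun y hy hy' => absurd hy.2 (not_le.2 hy'.1)
  have hlast := hind K
  have e1 : (K : ℝ) * σ = 2 * R := by rw [hσ]; field_simp
  have e2 : -R + 2 * R = R := by ring
  -- `K` steps lead from time `-R` to time `R`, and at both times the slice of `w` is zero, so the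
  -- telescoped mass difference vanishes.
  have hzero : ∀ τ, R ≤ |τ| → ∀ x, layerMass w n τ x = 0 := fun τ hτ x => by
    have : ∀ y, w (τ, y) = 0 := fun y => H.w_eq_zero _ (by
      rw [Prod.norm_def]; exact le_max_of_le_left hτ)
    simp [layerMass, tailMass, this]
  rw [e1, e2, hzero R (le_abs_self R), hzero (-R) (by rw [abs_neg]; exact le_abs_self R),
    setIntegral_eq_integral_of_forall_compl_eq_zero] at hlast
  · linarith
  · intro p hp
    have : R ≤ ‖p‖ := by
      rw [Prod.norm_def]
      refine le_max_of_le_left ?_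
      by_contra h
      have := abs_lt.1 (not_le.1 h)
      exact hp ⟨⟨this.1, this.2.le⟩, mem_univ _⟩
    simp [truncatedSource, H.h_eq_zero p this, indicator]

/-- Let the threshold `δ` tend to zero: the error set `{|w| ≤ δ}` shrinks to `{w = 0}`, where `h`
vanishes almost everywhere. -/
theorem WeakBalance.setIntegral_pos_nonpos {w B h : ℝ × ℝ → ℝ} {R C : ℝ}
    (H : WeakBalance w B h R C) (hR : 0 < R) (hB : ∀ p, w p = 0 → B p = 0)
    (h0 : ∀ᵐ p, w p = 0 → h p = 0) : ∫ p in {p | 0 < w p}, h p ≤ 0 := by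
  have hh := integrable_of_bounded H.measurable_h H.h_eq_zero H.bound
  have m1 : MeasurableSet (w ⁻¹' Ioi 0) := H.continuous_w.measurable measurableSet_Ioi
  have hδ : ∀ δ > 0, ∫ p, truncatedSource w h δ p ≤ 0 := fun δ hδ => by
    refine le_of_forall_pos_le_add fun ε hε => ?_
    have := H.integral_truncatedSource_le hR hB hδ (ε := ε / (2 * R)) (by positivity)
    rwa [mul_div_cancel₀ _ (by positivity), ← zero_add ε] at this
  have hlim : Tendsto (fun k : ℕ => ∫ p, truncatedSource w h (1 / ((k : ℝ) + 1)) p) atTop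
      (𝓝 (∫ p, (w ⁻¹' Ioi 0).indicator h p)) := by
    refine tendsto_integral_of_dominated_convergence (fun p => |h p| + |h p|)
      (fun k => (H.integrable_truncatedSource _).aestronglyMeasurable) (hh.abs.add hh.abs)
      (fun k => ae_of_all _ fun p => ?_) ?_
    · rw [truncatedSource]
      refine (norm_sub_le _ _).trans (add_le_add ?_ ?_)
      · exact norm_indicator_le_norm_self _ _
      · exact (norm_indicator_le_norm_self _ _).trans (by simp)
    · filter_upwards [h0] with p hp
      by_cases hwp : w p = 0
      · simp [truncatedSource, hp hwp, indicator]
      · have : Tendsto (fun k : ℕ => 1 / ((k : ℝ) + 1)) atTop (𝓝 0) :=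
          tendsto_one_div_add_atTop_nhds_zero_nat
        refine tendsto_const_nhds.congr' ?_
        filter_upwards [this.eventually_lt_const (abs_pos.2 hwp)] with k hk
        have hnot : w p ∉ Icc (-(1 / ((k : ℝ) + 1))) (1 / ((k : ℝ) + 1)) := fun h =>
          absurd (abs_le.2 h) (not_le.2 hk)
        rw [truncatedSource, indicator_of_notMem hnot, sub_zero]
        rfl
  rw [integral_indicator m1] at hlim
  exact le_of_tendsto' hlim fun k => hδ _ (by positivity)

/-- Reflection reverses both first derivatives, hence the sign of the source, while the sign of `w`
at corresponding points is kept. It turns the one-sided bound on the source into an equality. -/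
theorem WeakBalance.neg {w B h : ℝ × ℝ → ℝ} {R C : ℝ} (H : WeakBalance w B h R C) :
    WeakBalance (fun p => w (-p)) (fun p => B (-p)) (fun p => -h (-p)) R C where
  continuous_w := H.continuous_w.comp continuous_neg
  continuous_B := H.continuous_B.comp continuous_neg
  measurable_h := (H.measurable_h.comp measurable_neg).neg
  w_eq_zero p hp := H.w_eq_zero _ (by rwa [norm_neg])
  B_eq_zero p hp := H.B_eq_zero _ (by rwa [norm_neg])
  h_eq_zero p hp := by rw [H.h_eq_zero _ (by rwa [norm_neg]), neg_zero]
  bound p := by rw [abs_neg]; exact H.bound _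
  weak ψ hψ := by
    have hψ' : ContDiff ℝ ∞ fun p => ψ (-p) := hψ.comp contDiff_neg
    have hw := H.weak _ hψ'
    have hf : ∀ p, fderiv ℝ (fun p => ψ (-p)) p = -fderiv ℝ ψ (-p) := fun p => by
      have h1 : HasFDerivAt (fun p : ℝ × ℝ => -p) (-ContinuousLinearMap.id ℝ (ℝ × ℝ)) p :=
        (hasFDerivAt_id p).neg
      have h2 := ((hψ.differentiable (by simp) (-p)).hasFDerivAt.comp p h1).fderiv
      simpa [Function.comp_def] using h2
    have e1 : ∫ p, (partialT ψ p * w (-p) + partialX ψ p * B (-p)) =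
        ∫ p, (partialT ψ (-p) * w p + partialX ψ (-p) * B p) := by
      rw [← integral_neg_eq_self]; simp
    have e2 : ∫ p, ψ p * -h (-p) = ∫ p, ψ (-p) * -h p := by
      rw [← integral_neg_eq_self]; simp
    rw [e1, e2]
    simp only [partialT, partialX, hf, neg_apply, neg_mul, mul_neg,
      integral_neg, neg_neg] at hw ⊢
    rw [← neg_inj, ← hw, ← integral_neg]
    refine integral_congr_ae (ae_of_all _ fun p => ?_)
    simp only
    ring

/-- If `∂ₜ w + ∂ₓ B = h` with compactly supported `w`, `B` and `B`, `h` vanish where `w` does, then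
the positivity set of `w` carries no net source. -/
theorem WeakBalance.setIntegral_pos_eq_zero {w B h : ℝ × ℝ → ℝ} {R C : ℝ}
    (H : WeakBalance w B h R C) (hR : 0 < R) (hB : ∀ p, w p = 0 → B p = 0)
    (h0 : ∀ᵐ p, w p = 0 → h p = 0) : ∫ p in {p | 0 < w p}, h p = 0 := by
  refine le_antisymm (H.setIntegral_pos_nonpos hR hB h0) ?_
  have h0' : ∀ᵐ p : ℝ × ℝ, w (-p) = 0 → -h (-p) = 0 := by
    have := (Measure.measurePreserving_neg (volume : Measure (ℝ × ℝ))).quasiMeasurePreserving.ae h0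
    filter_upwards [this] with p hp hwp
    rw [hp hwp, neg_zero]
  have := H.neg.setIntegral_pos_nonpos hR (fun p hp => hB _ hp) h0'
  have m1 : MeasurableSet {p | 0 < w p} := H.continuous_w.measurable measurableSet_Ioi
  have m2 : MeasurableSet {p | 0 < w (-p)} :=
    (H.continuous_w.comp continuous_neg).measurable measurableSet_Ioi
  rw [← integral_indicator m2, ← integral_neg_eq_self] at this
  rw [← integral_indicator m1]
  have e : (fun p : ℝ × ℝ => {p | 0 < w (-p)}.indicator (fun p => -h (-p)) (-p)) =
      fun p => -({p | 0 < w p}.indicator h p) := by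
    ext p
    by_cases hp : 0 < w p <;> simp [indicator, hp]
  rw [e, integral_neg] at this
  linarith

/-! ### Calculus of test functions -/

section TestFunction

variable {Ω : Set (ℝ × ℝ)} {φ ψ : ℝ × ℝ → ℝ}

theorem partialT_eq_zero {p : ℝ × ℝ} (hp : p ∉ tsupport φ) : partialT φ p = 0 := by
  rw [partialT, Function.notMem_support.1 fun h => hp (support_fderiv_subset ℝ h)]; rfl

theorem partialX_eq_zero {p : ℝ × ℝ} (hp : p ∉ tsupport φ) : partialX φ p = 0 := by
  rw [partialX, Function.notMem_support.1 fun h => hp (support_fderiv_subset ℝ h)]; rfl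

theorem continuous_partialT (hφ : ContDiff ℝ ∞ φ) : Continuous (partialT φ) :=
  (hφ.continuous_fderiv (by simp)).clm_apply continuous_const

theorem continuous_partialX (hφ : ContDiff ℝ ∞ φ) : Continuous (partialX φ) :=
  (hφ.continuous_fderiv (by simp)).clm_apply continuous_const

theorem partialT_mul (hφ : ContDiff ℝ ∞ φ) (hψ : ContDiff ℝ ∞ ψ) (p : ℝ × ℝ) :
    partialT (fun q => φ q * ψ q) p = φ p * partialT ψ p + ψ p * partialT φ p := by
  have := ((hφ.differentiable (by simp) p).hasFDerivAt.mul
    (hψ.differentiable (by simp) p).hasFDerivAt).fderiv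
  have h' : fderiv ℝ (fun q => φ q * ψ q) p = _ := this
  rw [partialT, h']; rfl

theorem partialX_mul (hφ : ContDiff ℝ ∞ φ) (hψ : ContDiff ℝ ∞ ψ) (p : ℝ × ℝ) :
    partialX (fun q => φ q * ψ q) p = φ p * partialX ψ p + ψ p * partialX φ p := by
  have := ((hφ.differentiable (by simp) p).hasFDerivAt.mul
    (hψ.differentiable (by simp) p).hasFDerivAt).fderiv
  have h' : fderiv ℝ (fun q => φ q * ψ q) p = _ := this
  rw [partialX, h']; rfl

theorem partialT_add_const_mul (hφ : ContDiff ℝ ∞ φ) (hψ : ContDiff ℝ ∞ ψ) (c : ℝ) (p : ℝ × ℝ) :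
    partialT (fun q => φ q + c * ψ q) p = partialT φ p + c * partialT ψ p := by
  have := ((hφ.differentiable (by simp) p).hasFDerivAt.add
    ((hψ.differentiable (by simp) p).hasFDerivAt.const_mul c)).fderiv
  have h' : fderiv ℝ (fun q => φ q + c * ψ q) p = _ := this
  rw [partialT, h']; rfl

theorem partialX_add_const_mul (hφ : ContDiff ℝ ∞ φ) (hψ : ContDiff ℝ ∞ ψ) (c : ℝ) (p : ℝ × ℝ) :
    partialX (fun q => φ q + c * ψ q) p = partialX φ p + c * partialX ψ p := by
  have := ((hφ.differentiable (by simp) p).hasFDerivAt.add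
    ((hψ.differentiable (by simp) p).hasFDerivAt.const_mul c)).fderiv
  have h' : fderiv ℝ (fun q => φ q + c * ψ q) p = _ := this
  rw [partialX, h']; rfl

theorem integral_fderiv_apply_eq_zero (hφ : ContDiff ℝ ∞ φ) (hc : HasCompactSupport φ)
    (v : ℝ × ℝ) : ∫ p, fderiv ℝ φ p v = 0 := by
  have hi : Integrable φ := hφ.continuous.integrable_of_hasCompactSupport hc
  have hi' : Integrable fun p => fderiv ℝ φ p v :=
    ((hφ.continuous_fderiv (by simp)).clm_apply
      continuous_const).integrable_of_hasCompactSupport (hc.fderiv_apply ℝ v)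
  have := integral_mul_fderiv_eq_neg_fderiv_mul_of_integrable (𝕜 := ℝ)
    (μ := (volume : Measure (ℝ × ℝ))) (f := fun _ => (1 : ℝ)) (g := φ) (v := v)
    (by simp) (by simpa using hi') (by simpa using hi) (by simp)
    (fun p _ => hφ.differentiable (by simp) p)
  simpa using this

theorem IsTestFunction.integral_partialT (hφ : IsTestFunction Ω φ) : ∫ p, partialT φ p = 0 :=
  integral_fderiv_apply_eq_zero hφ.smooth hφ.compact _

theorem IsTestFunction.integral_partialX (hφ : IsTestFunction Ω φ) : ∫ p, partialX φ p = 0 :=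
  integral_fderiv_apply_eq_zero hφ.smooth hφ.compact _

theorem IsTestFunction.mul_smooth (hφ : IsTestFunction Ω φ) (hψ : ContDiff ℝ ∞ ψ) :
    IsTestFunction Ω fun p => φ p * ψ p where
  smooth := hφ.smooth.mul hψ
  compact := hφ.compact.mul_right
  support_subset := (tsupport_mul_subset_left).trans hφ.support_subset

theorem IsTestFunction.add_const_mul (hφ : IsTestFunction Ω φ) (hψ : IsTestFunction Ω ψ) (c : ℝ) :
    IsTestFunction Ω fun p => φ p + c * ψ p where
  smooth := hφ.smooth.add (contDiff_const.mul hψ.smooth)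
  compact := hφ.compact.add (hψ.compact.mul_left (f := fun _ => c))
  support_subset := by
    refine (tsupport_add _ _).trans (union_subset hφ.support_subset ?_)
    exact (tsupport_mul_subset_right (f := fun _ => c)).trans hψ.support_subset

theorem IsTestFunction.notMem {p : ℝ × ℝ} (hφ : IsTestFunction Ω φ) (hp : p ∉ Ω) :
    p ∉ tsupport φ := fun h => hp (hφ.support_subset h)

/-- A zero of a nonnegative function is a minimum. Because of this, `cutSource` vanishes at every
zero of a nonnegative cutoff, and not only off its topological support. -/
theorem partialT_eq_zero_of_min {p : ℝ × ℝ} (h0 : ∀ q, 0 ≤ φ q) (hp : φ p = 0) :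
    partialT φ p = 0 := by
  have : IsLocalMin φ p := Eventually.of_forall fun q => by simp only [hp]; exact h0 q
  rw [partialT, this.fderiv_eq_zero]; rfl

theorem partialX_eq_zero_of_min {p : ℝ × ℝ} (h0 : ∀ q, 0 ≤ φ q) (hp : φ p = 0) :
    partialX φ p = 0 := by
  have : IsLocalMin φ p := Eventually.of_forall fun q => by simp only [hp]; exact h0 q
  rw [partialX, this.fderiv_eq_zero]; rfl

/-- A continuous function multiplied by a function whose support is a compact subset of its
domain of continuity. -/
theorem continuous_mul_of_tsupport_subset {a v : ℝ × ℝ → ℝ} {K : Set (ℝ × ℝ)} (hΩ : IsOpen Ω)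
    (ha : Continuous a) (hK : IsClosed K) (ha0 : ∀ p ∉ K, a p = 0) (hKΩ : K ⊆ Ω)
    (hv : ContinuousOn v Ω) :
    Continuous fun p => a p * v p := by
  refine ContinuousOn.continuous_of_tsupport_subset (s := Ω) (ha.continuousOn.mul hv) hΩ ?_
  refine (closure_minimal (fun p hp => ?_) hK).trans hKΩ
  by_contra h
  exact hp (by simp [ha0 p h])

/-- Every test function is dominated by a multiple of a nonnegative one. -/
theorem IsTestFunction.exists_nonneg_add (hΩ : IsOpen Ω) (hφ : IsTestFunction Ω φ) :
    ∃ (χ : ℝ × ℝ → ℝ) (c : ℝ), IsTestFunction Ω χ ∧ (∀ p, 0 ≤ χ p) ∧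
      ∀ p, 0 ≤ φ p + c * χ p := by
  -- The function `χ` is smooth, positive exactly on the interior of `K`, and so bounded below by
  -- some `m > 0` on the support of `φ`; the multiple `c / m` then dominates `φ`.
  obtain ⟨K, hK, hφK, hKΩ⟩ := exists_compact_between hφ.compact hΩ hφ.support_subset
  obtain ⟨χ, hχr, hχs, hχm⟩ := IsOpen.exists_contDiff_support_eq (n := ⊤) (E := ℝ × ℝ)
    (isOpen_interior (s := K))
  obtain ⟨c, hc⟩ := hφ.compact.exists_bound_of_continuous hφ.smooth.continuous
  have hχ0 : ∀ p, 0 ≤ χ p := fun p => (hχm (mem_range_self p)).1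
  have hts : tsupport χ ⊆ K := by
    rw [tsupport, hχr]
    exact closure_minimal interior_subset hK.isClosed
  obtain ⟨m, hm, hmχ⟩ : ∃ m > 0, ∀ p ∈ tsupport φ, m ≤ χ p := by
    rcases (tsupport φ).eq_empty_or_nonempty with h | h
    · exact ⟨1, one_pos, by simp [h]⟩
    · obtain ⟨q, hq, hqm⟩ := hφ.compact.exists_isMinOn h hχs.continuous.continuousOn
      refine ⟨χ q, lt_of_le_of_ne (hχ0 q) (Ne.symm ?_), fun p hp => hqm hp⟩
      have : q ∈ Function.support χ := by rw [hχr]; exact hφK hq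
      exact this
  have hc0 : 0 ≤ c := (norm_nonneg _).trans (hc 0)
  refine ⟨χ, c / m, ⟨hχs, HasCompactSupport.of_support_subset_isCompact hK (by
    rw [hχr]; exact interior_subset), hts.trans hKΩ⟩, hχ0, fun p => ?_⟩
  by_cases hp : p ∈ tsupport φ
  · have h1 : c ≤ c / m * χ p := by
      rw [div_mul_eq_mul_div, le_div_iff₀ hm]
      exact mul_le_mul_of_nonneg_left (hmχ p hp) hc0
    linarith [neg_abs_le (φ p), hc p, Real.norm_eq_abs (φ p)]
  · rw [image_eq_zero_of_notMem_tsupport hp, zero_add]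
    exact mul_nonneg (by positivity) (hχ0 p)

end TestFunction

/-! ### Entropy identities for continuous solutions -/

/-- A continuous solution of the balance law whose source is bounded and measurable everywhere. -/
structure BalanceData (f : ℝ → ℝ) (u g : ℝ × ℝ → ℝ) (Ω : Set (ℝ × ℝ)) (C : ℝ) : Prop where
  isOpen : IsOpen Ω
  continuous_f : Continuous f
  measurable_u : Measurable u
  continuousOn_u : ContinuousOn u Ω
  measurable_g : Measurable g
  bound : ∀ p, |g p| ≤ C
  equation : DistribBalance Ω u (fun p => f (u p)) g

/-- The source term of the balance law for `φ (u - k)`. -/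
noncomputable def cutSource (f : ℝ → ℝ) (u g φ : ℝ × ℝ → ℝ) (k : ℝ) (p : ℝ × ℝ) : ℝ :=
  partialT φ p * (u p - k) + partialX φ p * (f (u p) - f k) + φ p * g p

theorem IsTestFunction.exists_radius {Ω : Set (ℝ × ℝ)} {φ : ℝ × ℝ → ℝ}
    (hφ : IsTestFunction Ω φ) : ∃ R > 0, ∀ p, R ≤ ‖p‖ → p ∉ tsupport φ := by
  obtain ⟨R, hR⟩ := hφ.compact.isBounded.subset_closedBall (0 : ℝ × ℝ)
  refine ⟨max R 0 + 1, by positivity, fun p hp h => ?_⟩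
  have := hR h
  rw [Metric.mem_closedBall, dist_zero_right] at this
  linarith [le_max_left R 0]

namespace BalanceData

variable {f : ℝ → ℝ} {u g φ ψ : ℝ × ℝ → ℝ} {Ω : Set (ℝ × ℝ)} {C : ℝ}

theorem cutSource_eq_zero {p : ℝ × ℝ} (hp : p ∉ tsupport φ) (k : ℝ) :
    cutSource f u g φ k p = 0 := by
  simp [cutSource, partialT_eq_zero hp, partialX_eq_zero hp, image_eq_zero_of_notMem_tsupport hp]

theorem exists_bound_on_tsupport (H : BalanceData f u g Ω C) (hφ : IsTestFunction Ω φ) :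
    ∃ M, ∀ p ∈ tsupport φ, |u p| ≤ M := by
  obtain ⟨M, hM⟩ := IsCompact.exists_bound_of_continuousOn (s := tsupport φ) hφ.compact
    (H.continuousOn_u.mono hφ.support_subset)
  exact ⟨M, hM⟩

theorem measurable_cutSource (H : BalanceData f u g Ω C) (hφ : IsTestFunction Ω φ) (k : ℝ) :
    Measurable (cutSource f u g φ k) :=
  (((continuous_partialT hφ.smooth).measurable.mul (H.measurable_u.sub_const k)).add
    ((continuous_partialX hφ.smooth).measurable.mul
      ((H.continuous_f.measurable.comp H.measurable_u).sub_const (f k)))).add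
    (hφ.smooth.continuous.measurable.mul H.measurable_g)

/-- Uniformity of the bound in `k` is what allows dominated convergence when the level varies. -/
theorem exists_bound_cutSource (H : BalanceData f u g Ω C) (hφ : IsTestFunction Ω φ) (a b : ℝ) :
    ∃ D, ∀ k ∈ Icc a b, ∀ p, |cutSource f u g φ k p| ≤ D := by
  obtain ⟨M, hM⟩ := H.exists_bound_on_tsupport hφ
  obtain ⟨F, hF⟩ := IsCompact.exists_bound_of_continuousOn (s := tsupport φ) hφ.compact
    (f := fun p => f (u p))
    (H.continuous_f.comp_continuousOn (H.continuousOn_u.mono hφ.support_subset))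
  obtain ⟨F', hF'⟩ := isCompact_Icc.exists_bound_of_continuousOn (s := Icc a b)
    H.continuous_f.continuousOn
  obtain ⟨K, hK⟩ := isCompact_Icc.exists_bound_of_continuousOn (s := Icc a b)
    continuous_id.continuousOn
  obtain ⟨D₁, hD₁⟩ := (hφ.compact.fderiv_apply ℝ (1, 0)).exists_bound_of_continuous
    (continuous_partialT hφ.smooth)
  obtain ⟨D₂, hD₂⟩ := (hφ.compact.fderiv_apply ℝ (0, 1)).exists_bound_of_continuous
    (continuous_partialX hφ.smooth)
  obtain ⟨D₃, hD₃⟩ := hφ.compact.exists_bound_of_continuous hφ.smooth.continuous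
  have h1 : 0 ≤ D₁ := (norm_nonneg _).trans (hD₁ 0)
  have h2 : 0 ≤ D₂ := (norm_nonneg _).trans (hD₂ 0)
  have h3 : 0 ≤ D₃ := (norm_nonneg _).trans (hD₃ 0)
  have hC : 0 ≤ C := (abs_nonneg _).trans (H.bound 0)
  refine ⟨D₁ * (|M| + |K|) + D₂ * (|F| + |F'|) + D₃ * C, fun k hk p => ?_⟩
  by_cases hp : p ∈ tsupport φ
  · rw [cutSource]
    refine (abs_add_le _ _).trans (add_le_add ((abs_add_le _ _).trans (add_le_add ?_ ?_)) ?_)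
    · rw [abs_mul]
      refine mul_le_mul (hD₁ p) ((abs_sub _ _).trans (add_le_add ?_ ?_)) (abs_nonneg _) h1
      · exact (hM p hp).trans (le_abs_self _)
      · exact (hK k hk).trans (le_abs_self _)
    · rw [abs_mul]
      refine mul_le_mul (hD₂ p) ((abs_sub _ _).trans (add_le_add ?_ ?_)) (abs_nonneg _) h2
      · exact (hF p hp).trans (le_abs_self _)
      · exact (hF' k hk).trans (le_abs_self _)
    · rw [abs_mul]
      exact mul_le_mul (hD₃ p) (H.bound p) (abs_nonneg _) h3
  · rw [cutSource_eq_zero hp, abs_zero]; positivity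

theorem integrable_cutSource (H : BalanceData f u g Ω C) (hφ : IsTestFunction Ω φ) (k : ℝ) :
    Integrable (cutSource f u g φ k) := by
  obtain ⟨R, -, hR⟩ := hφ.exists_radius
  obtain ⟨D, hD⟩ := H.exists_bound_cutSource hφ k k
  exact integrable_of_bounded (H.measurable_cutSource hφ k)
    (fun p hp => cutSource_eq_zero (hR p hp) k) (hD k ⟨le_rfl, le_rfl⟩)

theorem continuous_partialT_mul (H : BalanceData f u g Ω C) (hφ : IsTestFunction Ω φ)
    {F : ℝ → ℝ} (hF : Continuous F) : Continuous fun p => partialT φ p * F (u p) :=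
  continuous_mul_of_tsupport_subset H.isOpen (continuous_partialT hφ.smooth) (isClosed_tsupport φ)
    (fun _ hp => partialT_eq_zero hp) hφ.support_subset (hF.comp_continuousOn H.continuousOn_u)

theorem continuous_partialX_mul (H : BalanceData f u g Ω C) (hφ : IsTestFunction Ω φ)
    {F : ℝ → ℝ} (hF : Continuous F) : Continuous fun p => partialX φ p * F (u p) :=
  continuous_mul_of_tsupport_subset H.isOpen (continuous_partialX hφ.smooth) (isClosed_tsupport φ)
    (fun _ hp => partialX_eq_zero hp) hφ.support_subset (hF.comp_continuousOn H.continuousOn_u)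

theorem integrable_partialT_mul (H : BalanceData f u g Ω C) (hφ : IsTestFunction Ω φ)
    {F : ℝ → ℝ} (hF : Continuous F) : Integrable fun p => partialT φ p * F (u p) :=
  (H.continuous_partialT_mul hφ hF).integrable_of_hasCompactSupport
    (hφ.compact.fderiv_apply ℝ (1, 0)).mul_right

theorem integrable_partialX_mul (H : BalanceData f u g Ω C) (hφ : IsTestFunction Ω φ)
    {F : ℝ → ℝ} (hF : Continuous F) : Integrable fun p => partialX φ p * F (u p) :=
  (H.continuous_partialX_mul hφ hF).integrable_of_hasCompactSupport
    (hφ.compact.fderiv_apply ℝ (0, 1)).mul_right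

/-- This is the equation tested with `φ`: the constants `k` and `f k` drop out because derivatives
of a compactly supported function have zero integral. -/
theorem integral_cutSource (H : BalanceData f u g Ω C) (hφ : IsTestFunction Ω φ) (k : ℝ) :
    ∫ p, cutSource f u g φ k p = 0 := by
  have h1 := H.integrable_partialT_mul hφ continuous_id
  have h2 := H.integrable_partialX_mul hφ H.continuous_f
  have h3 : Integrable (partialT φ) := by
    simpa using H.integrable_partialT_mul hφ (continuous_const (y := (1 : ℝ)))
  have h4 : Integrable (partialX φ) := by
    simpa using H.integrable_partialX_mul hφ (continuous_const (y := (1 : ℝ)))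
  have h12 : Integrable fun p => partialT φ p * u p + partialX φ p * f (u p) := h1.add h2
  have h34 : Integrable fun p => partialT φ p * k + partialX φ p * f k :=
    (h3.mul_const k).add (h4.mul_const (f k))
  have h5 : Integrable fun p => φ p * g p := by
    have := (H.integrable_cutSource hφ k).sub (h12.sub h34)
    refine this.congr (ae_of_all _ fun p => ?_)
    simp only [Pi.sub_apply, cutSource]
    ring
  have e1 := H.equation φ hφ
  rw [setIntegral_eq_integral_of_forall_compl_eq_zero fun p hp => by
      simp [partialT_eq_zero (hφ.notMem hp), partialX_eq_zero (hφ.notMem hp)],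
    setIntegral_eq_integral_of_forall_compl_eq_zero fun p hp => by
      simp [image_eq_zero_of_notMem_tsupport (hφ.notMem hp)]] at e1
  have e2 : ∫ p, (partialT φ p * k + partialX φ p * f k) = 0 := by
    rw [integral_add (h3.mul_const k) (h4.mul_const (f k)), integral_mul_const,
      integral_mul_const, hφ.integral_partialT, hφ.integral_partialX]
    simp
  have e3 : ∫ p, cutSource f u g φ k p = (∫ p, (partialT φ p * u p + partialX φ p * f (u p))) -
      (∫ p, (partialT φ p * k + partialX φ p * f k)) + ∫ p, φ p * g p := by
    have h124 : Integrable fun p => (partialT φ p * u p + partialX φ p * f (u p)) -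
      (partialT φ p * k + partialX φ p * f k) := h12.sub h34
    rw [← integral_sub h12 h34, ← integral_add h124 h5]
    refine integral_congr_ae (ae_of_all _ fun p => ?_)
    simp only [cutSource]
    ring
  rw [e3, e1, e2]; ring

/-- Localization: test the equation with `φ ψ` and use the product rule. The terms with derivatives
of `φ` become part of the source, and the balance now holds on the whole plane. -/
theorem weakBalance (H : BalanceData f u g Ω C) (hφ : IsTestFunction Ω φ) (k : ℝ) :
    ∃ R D, 0 < R ∧ WeakBalance (fun p => φ p * (u p - k)) (fun p => φ p * (f (u p) - f k))
      (cutSource f u g φ k) R D := by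
  obtain ⟨R, hR0, hR⟩ := hφ.exists_radius
  obtain ⟨D, hD⟩ := H.exists_bound_cutSource hφ k k
  have hcont : ∀ {F : ℝ → ℝ}, Continuous F → Continuous fun p => φ p * F (u p) := fun hF =>
    continuous_mul_of_tsupport_subset H.isOpen hφ.smooth.continuous (isClosed_tsupport φ)
      (fun _ hp => image_eq_zero_of_notMem_tsupport hp) hφ.support_subset
      (hF.comp_continuousOn H.continuousOn_u)
  have hcw : Continuous fun p => φ p * (u p - k) := hcont (F := fun z => z - k) (by fun_prop)
  have hcB : Continuous fun p => φ p * (f (u p) - f k) :=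
    hcont (F := fun z => f z - f k) (H.continuous_f.sub continuous_const)
  refine ⟨R, D, hR0, hcw, hcB, H.measurable_cutSource hφ k, fun p hp => ?_, fun p hp => ?_,
    fun p hp => cutSource_eq_zero (hR p hp) k, hD k ⟨le_rfl, le_rfl⟩, fun ψ hψ => ?_⟩
  · simp [image_eq_zero_of_notMem_tsupport (hR p hp)]
  · simp [image_eq_zero_of_notMem_tsupport (hR p hp)]
  · have h1 := H.integral_cutSource (hφ.mul_smooth hψ) k
    have i1 : Integrable fun p => partialT ψ p * (φ p * (u p - k)) +
        partialX ψ p * (φ p * (f (u p) - f k)) :=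
      (((continuous_partialT hψ).mul hcw).integrable_of_hasCompactSupport
        hφ.compact.mul_right.mul_left).add
      (((continuous_partialX hψ).mul hcB).integrable_of_hasCompactSupport
        hφ.compact.mul_right.mul_left)
    have e : ∀ p, cutSource f u g (fun q => φ q * ψ q) k p =
        (partialT ψ p * (φ p * (u p - k)) + partialX ψ p * (φ p * (f (u p) - f k))) +
          ψ p * cutSource f u g φ k p := fun p => by
      simp only [cutSource, partialT_mul hφ.smooth hψ, partialX_mul hφ.smooth hψ]
      ring
    have i2 : Integrable fun p => ψ p * cutSource f u g φ k p := by
      have := (H.integrable_cutSource (hφ.mul_smooth hψ) k).sub i1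
      refine this.congr (ae_of_all _ fun p => ?_)
      simp only [Pi.sub_apply, e]
      ring
    simp only [e] at h1
    rw [integral_add i1 i2] at h1
    linarith

/-- With `w = φ (u - k)`, the source vanishes where `φ = 0`, since `φ ≥ 0`; the rest of `{w = 0}`
inside `Ω` lies in the level set, which is null. Where `φ > 0`, the condition `w > 0` means `u > k`.
-/
theorem setIntegral_cutSource_of_nonneg (H : BalanceData f u g Ω C) (hφ : IsTestFunction Ω φ)
    (h0 : ∀ p, 0 ≤ φ p) {k : ℝ} (hk : volume.restrict Ω {p | u p = k} = 0) :
    ∫ p in {p | k < u p}, cutSource f u g φ k p = 0 := by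
  obtain ⟨R, D, hR, hW⟩ := H.weakBalance hφ k
  have hz : ∀ p, φ p = 0 → cutSource f u g φ k p = 0 := fun p hp => by
    simp [cutSource, partialT_eq_zero_of_min h0 hp, partialX_eq_zero_of_min h0 hp, hp]
  have hae : ∀ᵐ p, φ p * (u p - k) = 0 → cutSource f u g φ k p = 0 := by
    have h1 : ∀ᵐ p ∂(volume.restrict Ω), u p ≠ k := by
      rw [ae_iff]; simpa using hk
    rw [ae_restrict_iff' H.isOpen.measurableSet] at h1
    filter_upwards [h1] with p hp hwp
    rcases mul_eq_zero.1 hwp with h | h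
    · exact hz p h
    · by_cases hpΩ : p ∈ Ω
      · exact absurd (sub_eq_zero.1 h) (hp hpΩ)
      · exact cutSource_eq_zero (hφ.notMem hpΩ) k
  have key := hW.setIntegral_pos_eq_zero hR (fun p hp => by
    rcases mul_eq_zero.1 hp with h | h
    · simp [h]
    · simp [sub_eq_zero.1 h]) hae
  have m1 : MeasurableSet {p | k < u p} := H.measurable_u measurableSet_Ioi
  have m2 : MeasurableSet {p | 0 < φ p * (u p - k)} := hW.continuous_w.measurable measurableSet_Ioi
  rw [← integral_indicator m1, ← key, ← integral_indicator m2]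
  refine integral_congr_ae (ae_of_all _ fun p => ?_)
  simp only [indicator, mem_ofPred_eq]
  rcases (h0 p).eq_or_lt with h | h
  · rw [hz p h.symm]; simp
  · simp [mul_pos_iff_of_pos_left h]

theorem cutSource_add_const_mul (hφ : IsTestFunction Ω φ) (hψ : IsTestFunction Ω ψ) (c k : ℝ)
    (p : ℝ × ℝ) : cutSource f u g (fun q => φ q + c * ψ q) k p =
      cutSource f u g φ k p + c * cutSource f u g ψ k p := by
  simp only [cutSource, partialT_add_const_mul hφ.smooth hψ.smooth,
    partialX_add_const_mul hφ.smooth hψ.smooth]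
  ring

/-- `cutSource` is linear in the test function, and `φ` is a difference of two nonnegative test
functions. -/
theorem setIntegral_cutSource_of_measure (H : BalanceData f u g Ω C) (hφ : IsTestFunction Ω φ)
    {k : ℝ} (hk : volume.restrict Ω {p | u p = k} = 0) :
    ∫ p in {p | k < u p}, cutSource f u g φ k p = 0 := by
  obtain ⟨χ, c, hχ, hχ0, hφχ⟩ := hφ.exists_nonneg_add H.isOpen
  have h1 := H.setIntegral_cutSource_of_nonneg hχ hχ0 hk
  have h2 := H.setIntegral_cutSource_of_nonneg (hφ.add_const_mul hχ c) hφχ hk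
  simp only [cutSource_add_const_mul hφ hχ] at h2
  rw [integral_add (H.integrable_cutSource hφ k).integrableOn
    ((H.integrable_cutSource hχ k).const_mul c).integrableOn, integral_const_mul, h1] at h2
  simpa using h2

/-- The limit set `S` is left open so that levels decreasing to `k` give `{k < u}` and levels
increasing to `k` give `{k ≤ u}`. -/
theorem tendsto_setIntegral_cutSource (H : BalanceData f u g Ω C) (hφ : IsTestFunction Ω φ)
    {k : ℝ} {κ : ℕ → ℝ} (hκ : Tendsto κ atTop (𝓝 k)) {S : Set (ℝ × ℝ)} (hS : MeasurableSet S)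
    (hlim : ∀ p, ∀ᶠ n in atTop, (κ n < u p ↔ p ∈ S)) :
    Tendsto (fun n => ∫ p in {p | κ n < u p}, cutSource f u g φ (κ n) p) atTop
      (𝓝 (∫ p in S, cutSource f u g φ k p)) := by
  obtain ⟨a, b, hab⟩ : ∃ a b, ∀ n, κ n ∈ Icc a b := by
    obtain ⟨b, hb⟩ := hκ.bddAbove_range
    obtain ⟨a, ha⟩ := hκ.bddBelow_range
    exact ⟨a, b, fun n => ⟨ha (mem_range_self n), hb (mem_range_self n)⟩⟩
  obtain ⟨D, hD⟩ := H.exists_bound_cutSource hφ a b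
  obtain ⟨R, -, hR⟩ := hφ.exists_radius
  have m1 : ∀ n, MeasurableSet {p | κ n < u p} := fun n => H.measurable_u measurableSet_Ioi
  simp only [← integral_indicator (m1 _)]
  rw [← integral_indicator hS]
  refine tendsto_integral_of_dominated_convergence
    ((Metric.closedBall 0 R).indicator fun _ => D)
    (fun n => ((H.measurable_cutSource hφ _).indicator (m1 n)).aestronglyMeasurable) ?_
    (fun n => ae_of_all _ fun p => ?_) (ae_of_all _ fun p => ?_)
  · exact (integrable_indicator_iff measurableSet_closedBall).2
      (integrableOn_const measure_closedBall_lt_top.ne (by simp))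
  · refine (norm_indicator_le_norm_self _ _).trans ?_
    by_cases hp : p ∈ Metric.closedBall 0 R
    · rw [indicator_of_mem hp]; exact hD _ (hab n) p
    · rw [indicator_of_notMem hp, cutSource_eq_zero (hR p ?_), norm_zero]
      simp only [Metric.mem_closedBall, dist_zero_right, not_le] at hp
      exact hp.le
  · have hc : Tendsto (fun n => cutSource f u g φ (κ n) p) atTop
        (𝓝 (cutSource f u g φ k p)) := by
      have hf := (H.continuous_f.tendsto k).comp hκ
      exact (((hκ.const_sub _).const_mul _).add ((hf.const_sub _).const_mul _)).add_const _
    by_cases hp : p ∈ S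
    · rw [indicator_of_mem hp]
      refine hc.congr' ?_
      filter_upwards [hlim p] with n hn
      rw [indicator_of_mem (by exact hn.2 hp)]
    · rw [indicator_of_notMem hp]
      refine tendsto_const_nhds.congr' ?_
      filter_upwards [hlim p] with n hn
      rw [indicator_of_notMem (by exact fun h => hp (hn.1 h))]

/-- The level sets are disjoint, so only countably many of them have positive measure. -/
theorem dense_levels (H : BalanceData f u g Ω C) :
    Dense {k : ℝ | volume.restrict Ω {p | u p = k} = 0} := by
  have h := Measure.countable_meas_level_set_pos (μ := volume.restrict Ω) H.measurable_u
  have := h.dense_compl ℝ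
  convert! this using 1
  ext k
  simp

theorem setIntegral_cutSource_lt (H : BalanceData f u g Ω C) (hφ : IsTestFunction Ω φ) (k : ℝ) :
    ∫ p in {p | k < u p}, cutSource f u g φ k p = 0 := by
  obtain ⟨κ, -, hκ, hlim⟩ := H.dense_levels.exists_seq_strictAnti_tendsto k
  have h := H.tendsto_setIntegral_cutSource hφ hlim (S := {p | k < u p})
    (H.measurable_u measurableSet_Ioi) fun p => by
      by_cases hp : k < u p
      · filter_upwards [hlim.eventually_lt_const hp] with n hn
        simp [hn, hp]
      · refine Eventually.of_forall fun n => ?_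
        have : ¬ κ n < u p := fun h => hp ((hκ n).1.trans h)
        simp [this, hp]
  refine tendsto_nhds_unique h (tendsto_const_nhds.congr fun n => ?_)
  exact (H.setIntegral_cutSource_of_measure hφ (hκ n).2).symm

/-- Together with the strict version this shows that the source has zero integral over `{u = k}`
too, although that set may have positive measure. -/
theorem setIntegral_cutSource_le (H : BalanceData f u g Ω C) (hφ : IsTestFunction Ω φ) (k : ℝ) :
    ∫ p in {p | k ≤ u p}, cutSource f u g φ k p = 0 := by
  obtain ⟨κ, -, hκ, hlim⟩ := H.dense_levels.exists_seq_strictMono_tendsto k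
  have h := H.tendsto_setIntegral_cutSource hφ hlim (S := {p | k ≤ u p})
    (H.measurable_u measurableSet_Ici) fun p => by
      by_cases hp : k ≤ u p
      · refine Eventually.of_forall fun n => ?_
        simp [hp, (hκ n).1.trans_le hp]
      · filter_upwards [hlim.eventually_const_lt (not_le.1 hp)] with n hn
        simp [hp, hn.le]
  refine tendsto_nhds_unique h (tendsto_const_nhds.congr fun n => ?_)
  exact (H.setIntegral_cutSource_of_measure hφ (hκ n).2).symm

/-- The sign of `u - k`, with value `0` at `0`, is the indicator of `{k < u}` plus that of `{k ≤ u}`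
minus `1`, and the source integrates to zero against all three. -/
theorem integral_kruzkov (H : BalanceData f u g Ω C) (hφ : IsTestFunction Ω φ) (k : ℝ) :
    ∫ p, (partialT φ p * |u p - k| + partialX φ p * (Real.sign (u p - k) * (f (u p) - f k)) +
      φ p * (Real.sign (u p - k) * g p)) = 0 := by
  have hi := H.integrable_cutSource hφ k
  have m1 : MeasurableSet {p | k < u p} := H.measurable_u measurableSet_Ioi
  have m2 : MeasurableSet {p | k ≤ u p} := H.measurable_u measurableSet_Ici
  have e : ∀ p, partialT φ p * |u p - k| +
      partialX φ p * (Real.sign (u p - k) * (f (u p) - f k)) +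
      φ p * (Real.sign (u p - k) * g p) =
      ({p | k < u p}.indicator (cutSource f u g φ k) p +
        {p | k ≤ u p}.indicator (cutSource f u g φ k) p) - cutSource f u g φ k p := fun p => by
    simp only [indicator, mem_ofPred_eq, cutSource]
    rcases lt_trichotomy (u p) k with h | h | h
    · rw [Real.sign_of_neg (by linarith), abs_of_neg (by linarith)]
      simp [not_lt.2 h.le, not_le.2 h]; ring
    · simp [h]
    · rw [Real.sign_of_pos (by linarith), abs_of_pos (by linarith)]
      simp [h, h.le]
  have hs : Integrable fun p => {p | k < u p}.indicator (cutSource f u g φ k) p +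
      {p | k ≤ u p}.indicator (cutSource f u g φ k) p := (hi.indicator m1).add (hi.indicator m2)
  simp only [e]
  rw [integral_sub hs hi, integral_add (hi.indicator m1) (hi.indicator m2),
    integral_indicator m1, integral_indicator m2, H.setIntegral_cutSource_lt hφ,
    H.setIntegral_cutSource_le hφ, H.integral_cutSource hφ]
  simp

end BalanceData

/-! ### Entropies of class `C¹` -/

/-- The primitive, with respect to `F`, of the step function with value `e (k j)` on
`(k j, k (j + 1)]`; the constant of integration is `Q`. -/
noncomputable def stepPrimitive (e F : ℝ → ℝ) (Q : ℝ) (k : ℕ → ℝ) (m : ℕ) (z : ℝ) : ℝ :=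
  Q + e (k 0) * (F z - F (k 0)) + ∑ j ∈ Finset.range m,
    (e (k (j + 1)) - e (k j)) * (Ioi (k (j + 1))).indicator (fun z => F z - F (k (j + 1))) z

/-- The step function with value `e (k j)` on `(k j, k (j + 1)]`. -/
noncomputable def stepApprox (e : ℝ → ℝ) (k : ℕ → ℝ) (m : ℕ) (z : ℝ) : ℝ :=
  e (k 0) + ∑ j ∈ Finset.range m,
    (e (k (j + 1)) - e (k j)) * (Ioi (k (j + 1))).indicator (fun _ => 1) z

theorem stepApprox_of_lt {e : ℝ → ℝ} {k : ℕ → ℝ} (hk : Monotone k) (m : ℕ) {z : ℝ}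
    (hz : k m < z) : stepApprox e k m z = e (k m) := by
  induction m with
  | zero => simp [stepApprox]
  | succ m ih =>
    have h1 := ih ((hk m.le_succ).trans_lt hz)
    rw [stepApprox] at h1 ⊢
    rw [Finset.sum_range_succ, ← add_assoc, h1, indicator_of_mem (by exact hz)]
    ring

theorem abs_sub_stepApprox_le {e : ℝ → ℝ} {k : ℕ → ℝ} (hk : Monotone k) {ε : ℝ}
    (he : ∀ j, ∀ z ∈ Icc (k j) (k (j + 1)), |e z - e (k j)| ≤ ε) (m : ℕ) {z : ℝ}
    (hz : z ∈ Ioc (k 0) (k (m + 1))) : |e z - stepApprox e k m z| ≤ ε := by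
  induction m with
  | zero =>
    rw [stepApprox_of_lt hk 0 hz.1]
    exact he 0 z ⟨hz.1.le, hz.2⟩
  | succ m ih =>
    rcases le_or_gt z (k (m + 1)) with h | h
    · have : stepApprox e k (m + 1) z = stepApprox e k m z := by
        rw [stepApprox, Finset.sum_range_succ,
          indicator_of_notMem (by exact not_lt.2 h), mul_zero, add_zero, stepApprox]
      rw [this]
      exact ih ⟨hz.1, h⟩
    · rw [stepApprox_of_lt hk _ h]
      exact he _ z ⟨h.le, hz.2⟩

theorem stepPrimitive_succ_of_le {e F : ℝ → ℝ} {Q : ℝ} {k : ℕ → ℝ} {m : ℕ} {z : ℝ}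
    (hz : z ≤ k (m + 1)) : stepPrimitive e F Q k (m + 1) z = stepPrimitive e F Q k m z := by
  rw [stepPrimitive, Finset.sum_range_succ,
    indicator_of_notMem (by exact not_lt.2 hz), mul_zero, add_zero, stepPrimitive]

theorem stepPrimitive_of_le {e F : ℝ → ℝ} {Q : ℝ} {k : ℕ → ℝ} (hk : Monotone k) (m : ℕ) {z : ℝ}
    (hz : k m ≤ z) : stepPrimitive e F Q k m z =
      stepPrimitive e F Q k m (k m) + e (k m) * (F z - F (k m)) := by
  induction m generalizing z with
  | zero => simp [stepPrimitive]
  | succ m ih =>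
    have h1 := ih ((hk m.le_succ).trans hz)
    have h2 := ih (hk m.le_succ)
    rw [stepPrimitive_succ_of_le le_rfl, h2, stepPrimitive, Finset.sum_range_succ, ← add_assoc]
    rw [stepPrimitive] at h1
    rw [h1]
    have : (Ioi (k (m + 1))).indicator (fun z => F z - F (k (m + 1))) z = F z - F (k (m + 1)) := by
      rcases hz.eq_or_lt with h | h
      · simp [← h]
      · exact indicator_of_mem (by exact h) _
    rw [this]
    ring

/-- On each cell the derivative of the difference is `(e - e (k j)) F'`, bounded by `ε * L`. The
mean value inequality gives an error proportional to the length of the cell, and these errors add up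
along the grid. -/
theorem abs_sub_stepPrimitive_le {e F F' Q : ℝ → ℝ} {k : ℕ → ℝ} (hk : Monotone k) {ε L : ℝ}
    (hF : ∀ z, HasDerivAt F (F' z) z) (hQ : ∀ z, HasDerivAt Q (e z * F' z) z) {N : ℕ}
    (hL : ∀ z ∈ Icc (k 0) (k N), |F' z| ≤ L)
    (he : ∀ j, ∀ z ∈ Icc (k j) (k (j + 1)), |e z - e (k j)| ≤ ε) {m : ℕ} (hm : m + 1 ≤ N) {z : ℝ}
    (hz : z ∈ Icc (k 0) (k (m + 1))) :
    |Q z - stepPrimitive e F (Q (k 0)) k m z| ≤ ε * L * (z - k 0) := by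
  have hε : 0 ≤ ε := (abs_nonneg _).trans (he 0 (k 0) ⟨le_rfl, hk (Nat.zero_le _)⟩)
  have cell : ∀ j, j + 1 ≤ N → ∀ z ∈ Icc (k j) (k (j + 1)),
      |Q z - Q (k j) - e (k j) * (F z - F (k j))| ≤ ε * L * (z - k j) := by
    intro j hj z hz
    have hd : ∀ y ∈ Icc (k j) (k (j + 1)),
        HasDerivWithinAt (fun y => Q y - e (k j) * F y) (e y * F' y - e (k j) * F' y)
          (Icc (k j) (k (j + 1))) y := fun y _ =>
      ((hQ y).sub ((hF y).const_mul _)).hasDerivWithinAt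
    have hb : ∀ y ∈ Icc (k j) (k (j + 1)), ‖e y * F' y - e (k j) * F' y‖ ≤ ε * L := fun y hy => by
      rw [← sub_mul, norm_mul]
      exact mul_le_mul (he j y hy)
        (hL y ⟨(hk (Nat.zero_le j)).trans hy.1, hy.2.trans (hk hj)⟩) (norm_nonneg _) hε
    have := (convex_Icc (k j) (k (j + 1))).norm_image_sub_le_of_norm_hasDerivWithin_le hd hb
      (left_mem_Icc.2 (hk j.le_succ)) hz
    rw [Real.norm_eq_abs, Real.norm_eq_abs, abs_of_nonneg (sub_nonneg.2 hz.1)] at this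
    convert! this using 2
    ring
  induction m generalizing z with
  | zero =>
    have := cell 0 hm z hz
    convert! this using 2
    simp [stepPrimitive]
    ring
  | succ m ih =>
    rcases le_or_gt z (k (m + 1)) with h | h
    · rw [stepPrimitive_succ_of_le h]
      exact ih (by omega) ⟨hz.1, h⟩
    · have h1 := ih (by omega) (z := k (m + 1)) ⟨hk (Nat.zero_le _), le_rfl⟩
      have h2 := cell (m + 1) hm z ⟨h.le, hz.2⟩
      rw [stepPrimitive_of_le hk _ h.le, stepPrimitive_succ_of_le le_rfl]
      have e : Q z - (stepPrimitive e F (Q (k 0)) k m (k (m + 1)) +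
          e (k (m + 1)) * (F z - F (k (m + 1)))) =
          (Q (k (m + 1)) - stepPrimitive e F (Q (k 0)) k m (k (m + 1))) +
          (Q z - Q (k (m + 1)) - e (k (m + 1)) * (F z - F (k (m + 1)))) := by ring
      rw [e]
      refine (abs_add_le _ _).trans ((add_le_add h1 h2).trans (le_of_eq ?_))
      ring

namespace BalanceData

variable {f : ℝ → ℝ} {u g φ ψ : ℝ × ℝ → ℝ} {Ω : Set (ℝ × ℝ)} {C : ℝ}

/-- The entropy identity for piecewise affine entropies. -/
theorem integral_stepPrimitive (H : BalanceData f u g Ω C) (hφ : IsTestFunction Ω φ)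
    (e : ℝ → ℝ) (k : ℕ → ℝ) (m : ℕ) (a b : ℝ) :
    Integrable (fun p => partialT φ p * stepPrimitive e id a k m (u p) +
      partialX φ p * stepPrimitive e f b k m (u p) + φ p * (stepApprox e k m (u p) * g p)) ∧
    ∫ p, (partialT φ p * stepPrimitive e id a k m (u p) +
      partialX φ p * stepPrimitive e f b k m (u p) + φ p * (stepApprox e k m (u p) * g p)) = 0 := by
  have hi : ∀ j, Integrable ({p | k (j + 1) < u p}.indicator (cutSource f u g φ (k (j + 1)))) :=
    fun j => (H.integrable_cutSource hφ _).indicator (H.measurable_u measurableSet_Ioi)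
  have hT : Integrable (partialT φ) := by
    simpa using H.integrable_partialT_mul hφ (continuous_const (y := (1 : ℝ)))
  have hX : Integrable (partialX φ) := by
    simpa using H.integrable_partialX_mul hφ (continuous_const (y := (1 : ℝ)))
  -- Superposition: apart from constants, the integrand is a combination of the sources cut at the
  -- levels `k (j + 1)`, each of which integrates to zero.
  have e1 : ∀ p, partialT φ p * stepPrimitive e id a k m (u p) +
      partialX φ p * stepPrimitive e f b k m (u p) + φ p * (stepApprox e k m (u p) * g p) =
      ((partialT φ p * a + partialX φ p * b) + e (k 0) * cutSource f u g φ (k 0) p) +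
      ∑ j ∈ Finset.range m, (e (k (j + 1)) - e (k j)) *
        {p | k (j + 1) < u p}.indicator (cutSource f u g φ (k (j + 1))) p := by
    intro p
    have : ∑ j ∈ Finset.range m, (e (k (j + 1)) - e (k j)) *
        {p | k (j + 1) < u p}.indicator (cutSource f u g φ (k (j + 1))) p =
        partialT φ p * (∑ j ∈ Finset.range m, (e (k (j + 1)) - e (k j)) *
          (Ioi (k (j + 1))).indicator (fun z => id z - id (k (j + 1))) (u p)) +
        partialX φ p * (∑ j ∈ Finset.range m, (e (k (j + 1)) - e (k j)) *
          (Ioi (k (j + 1))).indicator (fun z => f z - f (k (j + 1))) (u p)) +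
        φ p * ((∑ j ∈ Finset.range m, (e (k (j + 1)) - e (k j)) *
          (Ioi (k (j + 1))).indicator (fun _ => 1) (u p)) * g p) := by
      simp only [Finset.sum_mul, Finset.mul_sum]
      rw [← Finset.sum_add_distrib, ← Finset.sum_add_distrib]
      refine Finset.sum_congr rfl fun j _ => ?_
      by_cases h : k (j + 1) < u p
      · simp [indicator, h, cutSource]; ring
      · simp [indicator, h]
    rw [this]
    simp only [stepPrimitive, stepApprox, cutSource, id]
    ring
  simp only [e1]
  have i1 : Integrable fun p => partialT φ p * a + partialX φ p * b :=
    (hT.mul_const a).add (hX.mul_const b)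
  have i2 : Integrable fun p => (partialT φ p * a + partialX φ p * b) +
      e (k 0) * cutSource f u g φ (k 0) p := i1.add ((H.integrable_cutSource hφ _).const_mul _)
  have i3 : Integrable fun p => ∑ j ∈ Finset.range m, (e (k (j + 1)) - e (k j)) *
      {p | k (j + 1) < u p}.indicator (cutSource f u g φ (k (j + 1))) p :=
    integrable_finsetSum _ fun j _ => (hi j).const_mul _
  refine ⟨i2.add i3, ?_⟩
  rw [integral_add i2 i3, integral_add i1 ((H.integrable_cutSource hφ _).const_mul _),
    integral_add (hT.mul_const a) (hX.mul_const b), integral_mul_const, integral_mul_const,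
    hφ.integral_partialT, hφ.integral_partialX, integral_const_mul, H.integral_cutSource hφ,
    integral_finsetSum _ fun j _ => (hi j).const_mul _, Finset.sum_eq_zero]
  · simp
  · intro j _
    have m1 : MeasurableSet {p | k (j + 1) < u p} := H.measurable_u measurableSet_Ioi
    rw [integral_const_mul, integral_indicator m1, H.setIntegral_cutSource_lt hφ, mul_zero]

theorem integrable_entropy (H : BalanceData f u g Ω C) (hφ : IsTestFunction Ω φ)
    {a b c : ℝ → ℝ} (ha : Continuous a) (hb : Continuous b) (hc : Continuous c) :
    Integrable fun p => partialT φ p * a (u p) + partialX φ p * b (u p) + φ p * (c (u p) * g p) := by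
  refine ((H.integrable_partialT_mul hφ ha).add (H.integrable_partialX_mul hφ hb)).add ?_
  have h1 : Continuous fun p => φ p * c (u p) :=
    continuous_mul_of_tsupport_subset H.isOpen hφ.smooth.continuous (isClosed_tsupport φ)
      (fun _ hp => image_eq_zero_of_notMem_tsupport hp) hφ.support_subset
      (hc.comp_continuousOn H.continuousOn_u)
  have h2 : Integrable fun p => φ p * c (u p) :=
    h1.integrable_of_hasCompactSupport hφ.compact.mul_right
  refine (h2.mul_bdd (c := C) H.measurable_g.aestronglyMeasurable
    (ae_of_all _ H.bound)).congr (ae_of_all _ fun p => ?_)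
  simp only
  ring

/-- Approximate `η'` within `ε` by step functions on the bounded range of `u` over the support of
`φ`. Integrating the step functions against `1` and against `f'` approximates `η` and `q`
simultaneously. -/
theorem integral_entropy (H : BalanceData f u g Ω C) (hf : ContDiff ℝ 1 f)
    (hφ : IsTestFunction Ω φ) {η q : ℝ → ℝ} (hη : IsEntropyPair f η q) :
    ∫ p, (partialT φ p * η (u p) + partialX φ p * q (u p) + φ p * (deriv η (u p) * g p)) = 0 := by
  obtain ⟨M, hM⟩ := H.exists_bound_on_tsupport hφ
  set e := deriv η with he
  have hec : Continuous e := hη.contDiff.continuous_deriv (by norm_num)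
  have hηd : ∀ z, HasDerivAt η (e z) z := fun z =>
    (hη.contDiff.differentiable (by norm_num) z).hasDerivAt
  have hfd : ∀ z, HasDerivAt f (deriv f z) z := fun z =>
    (hf.differentiable (by norm_num) z).hasDerivAt
  have hqc : Continuous q := continuous_iff_continuousAt.2 fun z => (hη.flux z).continuousAt
  have hηc : Continuous η := hη.contDiff.continuous
  have hC : 0 ≤ C := (abs_nonneg _).trans (H.bound 0)
  -- The extra `1` keeps `u` strictly above the first node `-M'`, as required by the half-open cells
  -- of `stepApprox`.
  set M' := |M| + 1 with hM'
  have hM'0 : 0 < M' := by positivity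
  have hMu : ∀ p ∈ tsupport φ, |u p| < M' := fun p hp => by
    linarith [hM p hp, le_abs_self M]
  obtain ⟨L, hL⟩ := isCompact_Icc.exists_bound_of_continuousOn (s := Icc (-M') (M' + 1))
    (hf.continuous_deriv (by norm_num)).continuousOn
  have hφi : Integrable φ := hφ.smooth.continuous.integrable_of_hasCompactSupport hφ.compact
  have hT : Integrable (partialT φ) := by
    simpa using H.integrable_partialT_mul hφ (continuous_const (y := (1 : ℝ)))
  have hX : Integrable (partialX φ) := by
    simpa using H.integrable_partialX_mul hφ (continuous_const (y := (1 : ℝ)))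
  -- This collects the three errors per unit of `ε`; it does not depend on the grid.
  set A : ℝ := ∫ p, (|partialT φ p| * (2 * M') + |partialX φ p| * (|L| * (2 * M')) + |φ p| * C)
    with hA
  have hAi : Integrable fun p =>
      |partialT φ p| * (2 * M') + |partialX φ p| * (|L| * (2 * M')) + |φ p| * C :=
    ((hT.abs.mul_const _).add (hX.abs.mul_const _)).add (hφi.abs.mul_const _)
  have key : ∀ ε > 0, |∫ p, (partialT φ p * η (u p) + partialX φ p * q (u p) +
      φ p * (e (u p) * g p))| ≤ ε * A := by
    intro ε hε
    obtain ⟨δ, hδ, hunif⟩ := Metric.uniformContinuousOn_iff.1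
      ((isCompact_Icc (a := -M') (b := M' + 1)).uniformContinuousOn_of_continuous
        hec.continuousOn) ε hε
    obtain ⟨N, hN⟩ := exists_nat_gt (max (2 * M' / δ) (2 * M'))
    have hN0 : (0 : ℝ) < N := lt_of_le_of_lt (by positivity) hN
    set σ := 2 * M' / N with hσ
    have hσ0 : 0 < σ := by positivity
    have hσδ : σ < δ := by
      have := (le_max_left _ _).trans_lt hN
      rw [div_lt_iff₀ hδ] at this
      rw [hσ, div_lt_iff₀ hN0]; linarith
    set k : ℕ → ℝ := fun j => min (-M' + j * σ) M' with hk
    have hkm : Monotone k := fun i j hij => by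
      simp only [hk]; gcongr
    have hk0 : k 0 = -M' := by simp [hk, hM'0.le]
    have hkN : k N = M' := by
      have : (N : ℝ) * σ = 2 * M' := by rw [hσ]; field_simp
      simp only [hk, this]
      exact min_eq_right (by linarith)
    have hkr : ∀ j, k j ∈ Icc (-M') M' := fun j =>
      ⟨hk0 ▸ hkm (Nat.zero_le j), min_le_right _ _⟩
    have hks : ∀ j, k (j + 1) - k j ≤ σ := fun j => by
      simp only [hk]
      push_cast
      rcases min_cases (-M' + (j : ℝ) * σ) M' with ⟨h, h'⟩ | ⟨h, h'⟩
      · rw [h]; linarith [min_le_left (-M' + ((j : ℝ) + 1) * σ) M']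
      · rw [h]; linarith [min_le_right (-M' + ((j : ℝ) + 1) * σ) M']
    have hee : ∀ j, ∀ z ∈ Icc (k j) (k (j + 1)), |e z - e (k j)| ≤ ε := fun j z hz => by
      refine (hunif z ⟨(hkr j).1.trans hz.1, by linarith [hz.2, (hkr (j + 1)).2]⟩ (k j)
        ⟨(hkr j).1, by linarith [(hkr j).2]⟩ ?_).le
      rw [Real.dist_eq, abs_of_nonneg (sub_nonneg.2 hz.1)]
      linarith [hz.2, hks j]
    obtain ⟨m, rfl⟩ : ∃ m, N = m + 1 := Nat.exists_eq_succ_of_ne_zero (by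
      rintro rfl; simp at hN0)
    obtain ⟨si, s0⟩ := H.integral_stepPrimitive hφ e k m (η (k 0)) (q (k 0))
    rw [← sub_zero (∫ p, (partialT φ p * η (u p) + partialX φ p * q (u p) +
      φ p * (e (u p) * g p))), ← s0, ← integral_sub (H.integrable_entropy hφ hηc hqc hec) si,
      hA, ← integral_const_mul, ← Real.norm_eq_abs]
    refine norm_integral_le_of_norm_le (hAi.const_mul ε) (ae_of_all _ fun p => ?_)
    by_cases hp : p ∈ tsupport φ
    · have hup := abs_lt.1 (hMu p hp)
      have z1 : u p ∈ Icc (k 0) (k (m + 1)) := by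
        rw [hk0, hkN]; exact ⟨hup.1.le, hup.2.le⟩
      have z2 : u p ∈ Ioc (k 0) (k (m + 1)) := by
        rw [hk0, hkN]; exact ⟨hup.1, hup.2.le⟩
      have b1 : |η (u p) - stepPrimitive e id (η (k 0)) k m (u p)| ≤ ε * (2 * M') := by
        refine (abs_sub_stepPrimitive_le (L := 1) (F' := fun _ => 1) hkm (fun z => hasDerivAt_id z)
          (fun z => by simpa using hηd z) (by simp) hee le_rfl z1).trans ?_
        rw [mul_one, hk0]
        gcongr
        linarith [hup.2]
      have b2 : |q (u p) - stepPrimitive e f (q (k 0)) k m (u p)| ≤ ε * (|L| * (2 * M')) := by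
        refine (abs_sub_stepPrimitive_le (L := |L|) hkm hfd hη.flux (fun z hz => ?_)
          hee le_rfl z1).trans ?_
        · refine (hL z ?_).trans (le_abs_self L)
          rw [hk0, hkN] at hz
          exact ⟨hz.1, by linarith [hz.2]⟩
        · rw [hk0, mul_assoc]
          gcongr
          linarith [hup.2]
      have b3 : |e (u p) - stepApprox e k m (u p)| ≤ ε := abs_sub_stepApprox_le hkm hee m z2
      have e1 : partialT φ p * η (u p) + partialX φ p * q (u p) + φ p * (e (u p) * g p) -
          (partialT φ p * stepPrimitive e id (η (k 0)) k m (u p) +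
            partialX φ p * stepPrimitive e f (q (k 0)) k m (u p) +
            φ p * (stepApprox e k m (u p) * g p)) =
          partialT φ p * (η (u p) - stepPrimitive e id (η (k 0)) k m (u p)) +
          partialX φ p * (q (u p) - stepPrimitive e f (q (k 0)) k m (u p)) +
          φ p * ((e (u p) - stepApprox e k m (u p)) * g p) := by ring
      rw [e1, Real.norm_eq_abs]
      refine (abs_add_le _ _).trans ((add_le_add_left (abs_add_le _ _) _).trans ?_)
      rw [abs_mul, abs_mul, abs_mul, abs_mul]
      have c1 := mul_le_mul_of_nonneg_left b1 (abs_nonneg (partialT φ p))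
      have c2 := mul_le_mul_of_nonneg_left b2 (abs_nonneg (partialX φ p))
      have c3 := mul_le_mul_of_nonneg_left
        (mul_le_mul b3 (H.bound p) (abs_nonneg _) hε.le) (abs_nonneg (φ p))
      refine (add_le_add (add_le_add c1 c2) c3).trans (le_of_eq ?_)
      ring
    · simp [partialT_eq_zero hp, partialX_eq_zero hp, image_eq_zero_of_notMem_tsupport hp]
  have hlim : Tendsto (fun ε : ℝ => ε * A) (𝓝[>] 0) (𝓝 0) := by
    have : Tendsto (fun ε : ℝ => ε * A) (𝓝 0) (𝓝 (0 * A)) := by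
      exact (continuous_id.mul continuous_const).tendsto 0
    rw [zero_mul] at this
    exact this.mono_left nhdsWithin_le_nhds
  have := ge_of_tendsto hlim (by
    filter_upwards [self_mem_nhdsWithin] with ε hε using key ε hε)
  exact abs_eq_zero.1 (le_antisymm this (abs_nonneg _))

end BalanceData

/-! ### Representatives, and the identities of part (i) on `Ω` -/

/-- A function in `L^∞(S)` agrees a.e. on `S` with a bounded measurable function. -/
theorem exists_measurable_bounded_ae_eq {S : Set (ℝ × ℝ)} {g : ℝ × ℝ → ℝ}
    (hg : MemLp g ⊤ (volume.restrict S)) :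
    ∃ (g' : ℝ × ℝ → ℝ) (C : ℝ), Measurable g' ∧ (∀ p, |g' p| ≤ C) ∧
      g' =ᵐ[volume.restrict S] g := by
  set C := (eLpNorm g ⊤ (volume.restrict S)).toReal with hC
  have hC0 : 0 ≤ C := ENNReal.toReal_nonneg
  obtain ⟨g₁, hg₁, hgg⟩ := hg.aestronglyMeasurable
  have hb : ∀ᵐ p ∂(volume.restrict S), ‖g p‖ ≤ C := by
    have h1 := enorm_ae_le_eLpNormEssSup g (volume.restrict S)
    have h2 : eLpNormEssSup g (volume.restrict S) ≠ ⊤ := by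
      rw [← eLpNorm_exponent_top]; exact hg.eLpNorm_ne_top
    filter_upwards [h1] with p hp
    have := ENNReal.toReal_mono h2 hp
    rwa [toReal_enorm, ← eLpNorm_exponent_top] at this
  -- Truncation at the essential supremum makes the bound hold everywhere and changes `g₁` only on a
  -- null subset of `S`.
  refine ⟨fun p => max (-C) (min (g₁ p) C), C,
    measurable_const.max (hg₁.measurable.min measurable_const), fun p => ?_, ?_⟩
  · rw [abs_le]
    exact ⟨le_max_left _ _, max_le (by linarith) (min_le_right _ _)⟩
  · filter_upwards [hgg, hb] with p h1 h2
    rw [← h1]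
    have := abs_le.1 h2
    rw [min_eq_left this.2, max_eq_right this.1]

/-- Extension of `u` by zero gives a function measurable on the whole plane; test functions
supported in `Ω` do not see the change. -/
theorem IsContinuousDistribSolution.exists_balanceData {f : ℝ → ℝ} (hf : Continuous f)
    {Ω : Set (ℝ × ℝ)} (hΩ : IsOpen Ω) {g u : ℝ × ℝ → ℝ}
    (H : IsContinuousDistribSolution f g Ω u) :
    ∃ (u' g' : ℝ × ℝ → ℝ) (C : ℝ), BalanceData f u' g' Ω C ∧ EqOn u' u Ω ∧
      (∀ p ∉ Ω, u' p = 0) ∧ g' =ᵐ[volume.restrict Ω] g := by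
  classical
  obtain ⟨g', C, hm, hC, hg⟩ := exists_measurable_bounded_ae_eq H.source
  have hu : EqOn (Ω.indicator u) u Ω := fun p hp => indicator_of_mem hp u
  refine ⟨Ω.indicator u, g', C, ⟨hΩ, hf, ?_, H.continuousOn.congr hu, hm, hC, fun φ hφ => ?_⟩,
    hu, fun p hp => indicator_of_notMem hp u, hg⟩
  · rw [← piecewise_eq_indicator]
    exact H.continuousOn.measurable_piecewise continuousOn_const hΩ.measurableSet
  · have e1 : ∫ p in Ω, φ p * g' p = ∫ p in Ω, φ p * g p := by
      refine integral_congr_ae ?_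
      filter_upwards [hg] with p hp
      rw [hp]
    rw [e1, ← H.equation φ hφ]
    refine setIntegral_congr_fun hΩ.measurableSet fun p hp => ?_
    simp only [hu hp]

/-- Passage from the identity in integrated form to `DistribBalance`. -/
theorem setIntegral_eq_neg_of_integral_eq_zero {Ω : Set (ℝ × ℝ)} (hΩ : IsOpen Ω)
    {φ : ℝ × ℝ → ℝ} (hφ : IsTestFunction Ω φ) {u u' g g' : ℝ × ℝ → ℝ} (hu : EqOn u' u Ω)
    (hg : g' =ᵐ[volume.restrict Ω] g) {a b c : ℝ → ℝ}
    (hi : Integrable fun p => φ p * (c (u' p) * g' p))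
    (hi' : Integrable fun p =>
      partialT φ p * a (u' p) + partialX φ p * b (u' p) + φ p * (c (u' p) * g' p))
    (h : ∫ p, (partialT φ p * a (u' p) + partialX φ p * b (u' p) + φ p * (c (u' p) * g' p)) = 0) :
    ∫ p in Ω, (partialT φ p * a (u p) + partialX φ p * b (u p)) =
      - ∫ p in Ω, φ p * (c (u p) * g p) := by
  have hi'' : Integrable fun p => partialT φ p * a (u' p) + partialX φ p * b (u' p) := by
    refine (hi'.sub hi).congr (ae_of_all _ fun p => ?_)
    simp
  have e1 : ∫ p in Ω, (partialT φ p * a (u p) + partialX φ p * b (u p)) =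
      ∫ p, (partialT φ p * a (u' p) + partialX φ p * b (u' p)) := by
    have hz : ∀ p ∉ Ω, partialT φ p * a (u' p) + partialX φ p * b (u' p) = 0 := fun p hp => by
      simp [partialT_eq_zero (hφ.notMem hp), partialX_eq_zero (hφ.notMem hp)]
    rw [← setIntegral_eq_integral_of_forall_compl_eq_zero hz]
    exact setIntegral_congr_fun hΩ.measurableSet fun p hp => by simp only [hu hp]
  have e2 : ∫ p in Ω, φ p * (c (u p) * g p) = ∫ p, φ p * (c (u' p) * g' p) := by
    have hz : ∀ p ∉ Ω, φ p * (c (u' p) * g' p) = 0 := fun p hp => by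
      simp [image_eq_zero_of_notMem_tsupport (hφ.notMem hp)]
    rw [← setIntegral_eq_integral_of_forall_compl_eq_zero hz]
    refine integral_congr_ae ?_
    filter_upwards [hg, ae_restrict_mem hΩ.measurableSet] with p hp hpΩ
    simp only [hp, hu hpΩ]
  rw [e1, e2, ← add_eq_zero_iff_eq_neg, ← integral_add hi'' hi]
  exact h

theorem IsContinuousDistribSolution.distribBalance_entropy {f : ℝ → ℝ} (hf : ContDiff ℝ 1 f)
    {Ω : Set (ℝ × ℝ)} (hΩ : IsOpen Ω) {g u : ℝ × ℝ → ℝ}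
    (H : IsContinuousDistribSolution f g Ω u) {η q : ℝ → ℝ} (hη : IsEntropyPair f η q) :
    DistribBalance Ω (fun p => η (u p)) (fun p => q (u p)) (fun p => deriv η (u p) * g p) := by
  obtain ⟨u', g', C, H', hu, -, hg⟩ := H.exists_balanceData hf.continuous hΩ
  intro φ hφ
  have hec : Continuous (deriv η) := hη.contDiff.continuous_deriv (by norm_num)
  have hqc : Continuous q := continuous_iff_continuousAt.2 fun z => (hη.flux z).continuousAt
  refine setIntegral_eq_neg_of_integral_eq_zero hΩ hφ hu hg ?_
    (H'.integrable_entropy hφ hη.contDiff.continuous hqc hec) (H'.integral_entropy hf hφ hη)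
  simpa using H'.integrable_entropy hφ (continuous_const (y := (0 : ℝ)))
    (continuous_const (y := (0 : ℝ))) hec

theorem measurable_real_sign : Measurable Real.sign := by
  unfold Real.sign
  exact Measurable.ite measurableSet_Iio measurable_const
    (Measurable.ite measurableSet_Ioi measurable_const measurable_const)

theorem abs_real_sign_le_one (x : ℝ) : |Real.sign x| ≤ 1 := by
  rcases Real.sign_apply_eq x with h | h | h <;> simp [h]

/-- The flux equals `f (max a b) - f (min a b)`: the jump of the sign sits where the other factor
vanishes. -/
theorem continuous_kruzkovFlux {f : ℝ → ℝ} (hf : Continuous f) :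
    Continuous fun z : ℝ × ℝ => Real.sign (z.1 - z.2) * (f z.1 - f z.2) := by
  have e : (fun z : ℝ × ℝ => Real.sign (z.1 - z.2) * (f z.1 - f z.2)) =
      fun z => f (max z.1 z.2) - f (min z.1 z.2) := by
    ext z
    rcases lt_trichotomy z.1 z.2 with h | h | h
    · rw [Real.sign_of_neg (by linarith), max_eq_right h.le, min_eq_left h.le]; ring
    · simp [h]
    · rw [Real.sign_of_pos (by linarith), max_eq_left h.le, min_eq_right h.le]; ring
  rw [e]
  fun_prop

theorem IsContinuousDistribSolution.distribBalance_kruzkov {f : ℝ → ℝ} (hf : Continuous f)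
    {Ω : Set (ℝ × ℝ)} (hΩ : IsOpen Ω) {g u : ℝ × ℝ → ℝ}
    (H : IsContinuousDistribSolution f g Ω u) (k : ℝ) :
    DistribBalance Ω (fun p => |u p - k|) (fun p => Real.sign (u p - k) * (f (u p) - f k))
      (fun p => Real.sign (u p - k) * g p) := by
  obtain ⟨u', g', C, H', hu, -, hg⟩ := H.exists_balanceData hf hΩ
  intro φ hφ
  have hi : Integrable fun p => φ p * (Real.sign (u' p - k) * g' p) := by
    have h1 : Integrable fun p => φ p * g' p := by
      simpa using H'.integrable_entropy hφ (continuous_const (y := (0 : ℝ)))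
        (continuous_const (y := (0 : ℝ))) (continuous_const (y := (1 : ℝ)))
    refine (h1.mul_bdd (c := 1) (measurable_real_sign.comp
      (H'.measurable_u.sub_const k)).aestronglyMeasurable
      (ae_of_all _ fun p => abs_real_sign_le_one _)).congr (ae_of_all _ fun p => ?_)
    simp only [Function.comp]
    ring
  refine setIntegral_eq_neg_of_integral_eq_zero (a := fun z => |z - k|)
    (b := fun z => Real.sign (z - k) * (f z - f k)) (c := fun z => Real.sign (z - k))
    hΩ hφ hu hg hi ?_ (H'.integral_kruzkov hφ k)
  refine Integrable.add ?_ hi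
  exact (H'.integrable_partialT_mul hφ (F := fun z => |z - k|) (by fun_prop)).add
    (H'.integrable_partialX_mul hφ (F := fun z => Real.sign (z - k) * (f z - f k))
      ((continuous_kruzkovFlux hf).comp (by fun_prop : Continuous fun z : ℝ => (z, k))))

/-! ### Doubling of variables -/

/-- Kruzkov's entropy flux for the entropy `|a - b|`. -/
noncomputable def kruzkovFlux (f : ℝ → ℝ) (a b : ℝ) : ℝ := Real.sign (a - b) * (f a - f b)

theorem kruzkovFlux_comm (f : ℝ → ℝ) (a b : ℝ) : kruzkovFlux f a b = kruzkovFlux f b a := by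
  rw [kruzkovFlux, kruzkovFlux, ← neg_sub b a, Real.sign_neg]; ring

theorem exists_bound_kruzkovFlux {f : ℝ → ℝ} (hf : Continuous f) (M : ℝ) :
    ∃ D, ∀ a b, |a| ≤ M → |b| ≤ M → |kruzkovFlux f a b| ≤ D := by
  obtain ⟨D, hD⟩ := isCompact_Icc.exists_bound_of_continuousOn (s := Icc (-M) M) hf.continuousOn
  refine ⟨1 * (D + D), fun a b ha hb => ?_⟩
  rw [kruzkovFlux, abs_mul]
  refine mul_le_mul (abs_real_sign_le_one _) ((abs_sub _ _).trans ?_) (abs_nonneg _) zero_le_one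
  exact add_le_add (hD a (abs_le.1 ha)) (hD b (abs_le.1 hb))

/-- If `z.1` and `z.1 - z.2` lie in compact sets, then so does `z.2`. -/
theorem integrable_mul_comp_sub {a b : ℝ × ℝ → ℝ} (ha : Continuous a) (hb : Continuous b)
    (ha' : HasCompactSupport a) (hb' : HasCompactSupport b) :
    Integrable fun z : (ℝ × ℝ) × (ℝ × ℝ) => a z.1 * b (z.1 - z.2) := by
  refine ((ha.comp continuous_fst).mul
    (hb.comp (continuous_fst.sub continuous_snd))).integrable_of_hasCompactSupport ?_
  have hK := ha'.isCompact.prod ((ha'.isCompact.prod hb'.isCompact).image continuous_sub)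
  refine HasCompactSupport.intro hK fun z hz => ?_
  by_contra h
  have h1 : z.1 ∈ tsupport a := by
    by_contra h1
    exact h (by simp [image_eq_zero_of_notMem_tsupport h1])
  have h2 : z.1 - z.2 ∈ tsupport b := by
    by_contra h2
    exact h (by simp [image_eq_zero_of_notMem_tsupport h2])
  exact hz ⟨h1, (z.1, z.1 - z.2), ⟨h1, h2⟩, by simp⟩

theorem partialT_comp_sub_right {r : ℝ × ℝ → ℝ} (p q : ℝ × ℝ) :
    partialT (fun p => r (p - q)) p = partialT r (p - q) := by
  rw [partialT, fderiv_comp_sub, partialT]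

theorem partialX_comp_sub_right {r : ℝ × ℝ → ℝ} (p q : ℝ × ℝ) :
    partialX (fun p => r (p - q)) p = partialX r (p - q) := by
  rw [partialX, fderiv_comp_sub, partialX]

theorem fderiv_const_mul_comp_const_sub {r : ℝ × ℝ → ℝ} (hr : ContDiff ℝ ∞ r) (c : ℝ)
    (p q v : ℝ × ℝ) : fderiv ℝ (fun q => c * r (p - q)) q v = -(c * fderiv ℝ r (p - q) v) := by
  have h1 : HasFDerivAt (fun q : ℝ × ℝ => p - q) (-ContinuousLinearMap.id ℝ (ℝ × ℝ)) q :=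
    (hasFDerivAt_id q).const_sub p
  have h2 : HasFDerivAt (fun q => c * r (p - q)) _ q :=
    ((hr.differentiable (by simp) (p - q)).hasFDerivAt.comp q h1).const_mul c
  rw [h2.fderiv]
  simp

section Doubling

variable {f : ℝ → ℝ} {u v g ψ : ℝ × ℝ → ℝ} {Ω : Set (ℝ × ℝ)} {C M : ℝ}

/-- The integrand obtained by doubling the variables. -/
noncomputable def doubledIntegrand (f : ℝ → ℝ) (u v g ψ : ℝ × ℝ → ℝ) (p q : ℝ × ℝ) : ℝ :=
  partialT ψ p * |v p - u q| + partialX ψ p * kruzkovFlux f (v p) (u q) +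
    ψ p * (Real.sign (v p - u q) * (g p - g q))

/-- Use `ψ (p) r (p - q)` as a test function of `p` with constant `u q`, and as a test function of
`q` with constant `v p`. The first gives an inequality and the second an equality; in their
combination the singular derivatives of `r` cancel. The factor `ψ` depends on `p` alone, so its
derivatives come only from the inequality for `v`. -/
theorem doubling_nonneg (H : BalanceData f u g Ω C) (hv : Measurable v) (huM : ∀ p, |u p| ≤ M)
    (hvM : ∀ p, |v p| ≤ M)
    (hent : ∀ (k : ℝ) (φ : ℝ × ℝ → ℝ), IsTestFunction Ω φ → (∀ p, 0 ≤ φ p) →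
      0 ≤ ∫ p, (partialT φ p * |v p - k| + partialX φ p * kruzkovFlux f (v p) k +
        φ p * (Real.sign (v p - k) * g p)))
    (hψ : IsTestFunction Ω ψ) (hψ0 : ∀ p, 0 ≤ ψ p) (ρ : ContDiffBump (0 : ℝ × ℝ))
    (hρ : ∀ p ∈ tsupport ψ, Metric.closedBall p ρ.rOut ⊆ Ω) :
    0 ≤ ∫ p, ∫ q, ρ.normed volume (p - q) * doubledIntegrand f u v g ψ p q := by
  set r := ρ.normed (volume : Measure (ℝ × ℝ)) with hr
  have hrs : ContDiff ℝ ∞ r := ρ.contDiff_normed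
  have hrc : HasCompactSupport r := ρ.hasCompactSupport_normed
  have hr0 : ∀ z, 0 ≤ r z := ρ.nonneg_normed
  obtain ⟨D, hD⟩ := exists_bound_kruzkovFlux H.continuous_f M
  have hvm : Measurable fun z : (ℝ × ℝ) × (ℝ × ℝ) => v z.1 := hv.comp measurable_fst
  have hum : Measurable fun z : (ℝ × ℝ) × (ℝ × ℝ) => u z.2 := H.measurable_u.comp measurable_snd
  have hg1 : Measurable fun z : (ℝ × ℝ) × (ℝ × ℝ) => g z.1 := H.measurable_g.comp measurable_fst
  have hg2 : Measurable fun z : (ℝ × ℝ) × (ℝ × ℝ) => g z.2 := H.measurable_g.comp measurable_snd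
  have hsm : Measurable fun z : (ℝ × ℝ) × (ℝ × ℝ) => Real.sign (v z.1 - u z.2) :=
    measurable_real_sign.comp (hvm.sub hum)
  have hFm : Measurable fun z : (ℝ × ℝ) × (ℝ × ℝ) => kruzkovFlux f (v z.1) (u z.2) :=
    hsm.mul ((H.continuous_f.measurable.comp hvm).sub (H.continuous_f.measurable.comp hum))
  have hAb : ∀ z : (ℝ × ℝ) × (ℝ × ℝ), ‖|v z.1 - u z.2|‖ ≤ M + M := fun z => by
    rw [Real.norm_eq_abs, abs_abs]
    exact (abs_sub _ _).trans (add_le_add (hvM _) (huM _))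
  have hFb : ∀ z : (ℝ × ℝ) × (ℝ × ℝ), ‖kruzkovFlux f (v z.1) (u z.2)‖ ≤ D := fun z =>
    hD _ _ (hvM _) (huM _)
  have hsgb : ∀ (p : ℝ × ℝ) (x : ℝ), ‖Real.sign x * g p‖ ≤ 1 * C := fun p x => by
    rw [norm_mul]
    exact mul_le_mul (abs_real_sign_le_one _) (H.bound p) (abs_nonneg _) zero_le_one
  have hTs : HasCompactSupport (partialT ψ) := hψ.compact.fderiv_apply ℝ (1, 0)
  have hXs : HasCompactSupport (partialX ψ) := hψ.compact.fderiv_apply ℝ (0, 1)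
  have hTr : HasCompactSupport (partialT r) := hrc.fderiv_apply ℝ (1, 0)
  have hXr : HasCompactSupport (partialX r) := hrc.fderiv_apply ℝ (0, 1)
  have hψc := hψ.smooth.continuous
  set Z : (ℝ × ℝ) × (ℝ × ℝ) → ℝ := fun z =>
    (partialT ψ z.1 * r (z.1 - z.2) * |v z.1 - u z.2| +
      ψ z.1 * partialT r (z.1 - z.2) * |v z.1 - u z.2|) +
    (partialX ψ z.1 * r (z.1 - z.2) * kruzkovFlux f (v z.1) (u z.2) +
      ψ z.1 * partialX r (z.1 - z.2) * kruzkovFlux f (v z.1) (u z.2)) +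
    ψ z.1 * r (z.1 - z.2) * (Real.sign (v z.1 - u z.2) * g z.1) with hZ
  -- `Y` is minus the Kruzkov integrand of `u` in the variable `q`; all derivatives in `q` fall on
  -- `r (p - q)`, with a change of sign.
  set Y : (ℝ × ℝ) × (ℝ × ℝ) → ℝ := fun z =>
    (ψ z.1 * partialT r (z.1 - z.2) * |v z.1 - u z.2| +
      ψ z.1 * partialX r (z.1 - z.2) * kruzkovFlux f (v z.1) (u z.2)) +
    ψ z.1 * r (z.1 - z.2) * (Real.sign (v z.1 - u z.2) * g z.2) with hY
  have hA : AEStronglyMeasurable (fun z : (ℝ × ℝ) × (ℝ × ℝ) => |v z.1 - u z.2|) volume :=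
    (hvm.sub hum).norm.aestronglyMeasurable
  have i1 := (integrable_mul_comp_sub (continuous_partialT hψ.smooth) hrs.continuous hTs
    hrc).mul_bdd hA (ae_of_all _ hAb)
  have i2 := (integrable_mul_comp_sub hψc (continuous_partialT hrs) hψ.compact
    hTr).mul_bdd hA (ae_of_all _ hAb)
  have i3 := (integrable_mul_comp_sub (continuous_partialX hψ.smooth) hrs.continuous hXs
    hrc).mul_bdd hFm.aestronglyMeasurable (ae_of_all _ hFb)
  have i4 := (integrable_mul_comp_sub hψc (continuous_partialX hrs) hψ.compact
    hXr).mul_bdd hFm.aestronglyMeasurable (ae_of_all _ hFb)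
  have i5 := (integrable_mul_comp_sub hψc hrs.continuous hψ.compact hrc).mul_bdd
    (hsm.mul hg1).aestronglyMeasurable (ae_of_all _ fun z => hsgb _ _)
  have i6 := (integrable_mul_comp_sub hψc hrs.continuous hψ.compact hrc).mul_bdd
    (hsm.mul hg2).aestronglyMeasurable (ae_of_all _ fun z => hsgb _ _)
  have hZi : Integrable Z := ((i1.add i2).add (i3.add i4)).add i5
  have hYi : Integrable Y := (i2.add i4).add i6
  have hZ0 : 0 ≤ ∫ z, Z z := by
    rw [Measure.volume_eq_prod, integral_prod_symm _ hZi]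
    refine integral_nonneg fun q => ?_
    have hsq : ContDiff ℝ ∞ fun p => r (p - q) := hrs.comp (by fun_prop)
    have := hent (u q) (fun p => ψ p * r (p - q)) (hψ.mul_smooth hsq)
      fun p => mul_nonneg (hψ0 p) (hr0 _)
    refine this.trans (le_of_eq (integral_congr_ae (ae_of_all _ fun p => ?_)))
    simp only [hZ, partialT_mul hψ.smooth hsq, partialX_mul hψ.smooth hsq,
      partialT_comp_sub_right, partialX_comp_sub_right]
    ring
  have hY0 : ∫ z, Y z = 0 := by
    rw [Measure.volume_eq_prod, integral_prod _ hYi]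
    refine integral_eq_zero_of_ae (ae_of_all _ fun p => ?_)
    -- For `p` in the support of `ψ` the shifted bump lives in a closed ball inside `Ω`; for other
    -- `p` the function is zero.
    have htest : IsTestFunction Ω fun q => ψ p * r (p - q) := by
      by_cases hp : p ∈ tsupport ψ
      · have hsub : Function.support (fun q => ψ p * r (p - q)) ⊆ Metric.closedBall p ρ.rOut := by
          intro q hq
          have h1 : p - q ∈ Function.support r := fun h => hq (by simp [h])
          rw [hr, ρ.support_normed_eq, Metric.mem_ball, dist_zero_right] at h1
          rw [Metric.mem_closedBall, dist_comm, dist_eq_norm]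
          exact h1.le
        exact ⟨contDiff_const.mul (hrs.comp (by fun_prop)),
          HasCompactSupport.of_support_subset_isCompact (isCompact_closedBall _ _) hsub,
          (closure_minimal hsub Metric.isClosed_closedBall).trans (hρ p hp)⟩
      · have : (fun q => ψ p * r (p - q)) = fun _ => 0 := by
          ext q; simp [image_eq_zero_of_notMem_tsupport hp]
        rw [this]
        exact ⟨contDiff_const, HasCompactSupport.zero, by simp [tsupport]⟩
    have := H.integral_kruzkov htest (v p)
    rw [Pi.zero_apply, ← neg_eq_zero, ← integral_neg, ← this]
    refine integral_congr_ae (ae_of_all _ fun q => ?_)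
    simp only [hY, partialT, partialX, fderiv_const_mul_comp_const_sub hrs]
    have e1 : Real.sign (u q - v p) * (f (u q) - f (v p)) = kruzkovFlux f (v p) (u q) :=
      kruzkovFlux_comm f _ _
    have e2 : Real.sign (u q - v p) = -Real.sign (v p - u q) := by
      rw [← Real.sign_neg, neg_sub]
    rw [e1, e2, abs_sub_comm (u q) (v p)]
    ring
  have hsub : ∫ z, (Z z - Y z) = ∫ p, ∫ q, r (p - q) * doubledIntegrand f u v g ψ p q := by
    rw [Measure.volume_eq_prod, integral_prod (fun z => Z z - Y z) (hZi.sub hYi)]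
    refine integral_congr_ae (ae_of_all _ fun p => integral_congr_ae (ae_of_all _ fun q => ?_))
    simp only [hZ, hY, doubledIntegrand]
    ring
  rw [← hsub, integral_sub hZi hYi, hY0, sub_zero]
  exact hZ0

/-! ### Passage to the diagonal -/

/-- A family of bumps at the origin with radii `1 / (n + 1)`. -/
noncomputable def shrinkingBump (n : ℕ) : ContDiffBump (0 : ℝ × ℝ) where
  rIn := 1 / ((n : ℝ) + 1) / 2
  rOut := 1 / ((n : ℝ) + 1)
  rIn_pos := by positivity
  rIn_lt_rOut := half_lt_self (by positivity)

theorem tendsto_shrinkingBump_rOut :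
    Tendsto (fun n => (shrinkingBump n).rOut) atTop (𝓝[>] 0) :=
  tendsto_nhdsWithin_iff.2 ⟨tendsto_one_div_add_atTop_nhds_zero_nat,
    Eventually.of_forall fun n => (shrinkingBump n).rOut_pos⟩

theorem integral_normed_comp_sub (ρ : ContDiffBump (0 : ℝ × ℝ)) (p : ℝ × ℝ) :
    ∫ q, ρ.normed volume (p - q) = 1 := by
  rw [integral_sub_left_eq_self (fun z => ρ.normed volume z) volume p, ρ.integral_normed]

theorem integrable_normed_comp_sub (ρ : ContDiffBump (0 : ℝ × ℝ)) (p : ℝ × ℝ) :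
    Integrable fun q => ρ.normed volume (p - q) :=
  ρ.integrable_normed.comp_sub_left p

/-- Convergence at Lebesgue points of `g`: since `rOut = 2 * rIn`, the normalized bump is at most `2
^ dim` times the uniform density on its outer ball. -/
theorem ae_tendsto_integral_normed_mul_abs_sub {C : ℝ} (hg : Measurable g) (hC : ∀ p, |g p| ≤ C) :
    ∀ᵐ p, Tendsto (fun n => ∫ q, (shrinkingBump n).normed volume (p - q) * |g q - g p|) atTop
      (𝓝 0) := by
  have hloc : LocallyIntegrable g := by
    refine (locallyIntegrable_const C).mono hg.aestronglyMeasurable (ae_of_all _ fun p => ?_)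
    exact (hC p).trans (le_abs_self C)
  filter_upwards [IsUnifLocDoublingMeasure.ae_tendsto_average_norm_sub volume hloc 1] with p hp
  have h1 := hp (fun _ : ℕ => p) (fun n => (shrinkingBump n).rOut) tendsto_shrinkingBump_rOut
    (Eventually.of_forall fun n => Metric.mem_closedBall_self
      (by rw [one_mul]; exact (shrinkingBump n).rOut_pos.le))
  have h2 := h1.const_mul ((2 : ℝ) ^ Module.finrank ℝ (ℝ × ℝ))
  rw [mul_zero] at h2
  refine squeeze_zero (fun n => integral_nonneg fun q =>
    mul_nonneg ((shrinkingBump n).nonneg_normed _) (abs_nonneg _)) (fun n => ?_) h2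
  set ρ := shrinkingBump n with hρ
  have hsupp : ∀ q ∉ Metric.closedBall p ρ.rOut, ρ.normed volume (p - q) * |g q - g p| = 0 :=
    fun q hq => by
      have : p - q ∉ Function.support (ρ.normed (volume : Measure (ℝ × ℝ))) := fun h => by
        rw [ρ.support_normed_eq, Metric.mem_ball, dist_zero_right] at h
        rw [Metric.mem_closedBall, dist_comm, dist_eq_norm] at hq
        exact hq h.le
      rw [Function.notMem_support.1 this, zero_mul]
  rw [← setIntegral_eq_integral_of_forall_compl_eq_zero hsupp, setAverage_eq, smul_eq_mul,
    ← mul_assoc, ← integral_const_mul]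
  have hbd : ∀ q, |g q - g p| ≤ C + C := fun q =>
    (abs_sub _ _).trans (add_le_add (hC q) (hC p))
  have hm : AEStronglyMeasurable (fun q => |g q - g p|)
      (volume.restrict (Metric.closedBall p ρ.rOut)) := (hg.sub_const _).norm.aestronglyMeasurable
  have hi : IntegrableOn (fun q => |g q - g p|) (Metric.closedBall p ρ.rOut) :=
    Measure.integrableOn_of_bounded (M := C + C) measure_closedBall_lt_top.ne
      (hg.sub_const _).norm.aestronglyMeasurable (ae_of_all _ fun q => by
        rw [Real.norm_eq_abs, abs_abs]; exact hbd q)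
  refine integral_mono ?_ (hi.const_mul _) fun q => ?_
  · exact (integrable_normed_comp_sub ρ p).integrableOn.mul_bdd hm (ae_of_all _ fun q => by
      rw [Real.norm_eq_abs, abs_abs]; exact hbd q)
  · simp only [Real.norm_eq_abs]
    refine mul_le_mul_of_nonneg_right ?_ (abs_nonneg _)
    have := ρ.normed_le_div_measure_closedBall_rOut (volume : Measure (ℝ × ℝ)) 2
      (le_of_eq (by rw [hρ, shrinkingBump]; ring)) (p - q)
    refine this.trans (le_of_eq ?_)
    rw [div_eq_mul_inv, Measure.real, Measure.real, Measure.addHaar_closedBall_center,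
      Measure.addHaar_closedBall_center volume p]

/-- Comparison of an entropy solution with a continuous solution. -/
theorem comparison_nonneg (H : BalanceData f u g Ω C) (hv : Measurable v) (huM : ∀ p, |u p| ≤ M)
    (hvM : ∀ p, |v p| ≤ M)
    (hent : ∀ (k : ℝ) (φ : ℝ × ℝ → ℝ), IsTestFunction Ω φ → (∀ p, 0 ≤ φ p) →
      0 ≤ ∫ p, (partialT φ p * |v p - k| + partialX φ p * kruzkovFlux f (v p) k +
        φ p * (Real.sign (v p - k) * g p)))
    (hψ : IsTestFunction Ω ψ) (hψ0 : ∀ p, 0 ≤ ψ p) :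
    0 ≤ ∫ p, (partialT ψ p * |v p - u p| + partialX ψ p * kruzkovFlux f (v p) (u p)) := by
  obtain ⟨D, hD⟩ := exists_bound_kruzkovFlux H.continuous_f M
  obtain ⟨ε, hε, hεΩ⟩ := IsCompact.exists_cthickening_subset_open hψ.compact H.isOpen
    hψ.support_subset
  have hTi : Integrable (partialT ψ) := (continuous_partialT
    hψ.smooth).integrable_of_hasCompactSupport (hψ.compact.fderiv_apply ℝ (1, 0))
  have hXi : Integrable (partialX ψ) := (continuous_partialX
    hψ.smooth).integrable_of_hasCompactSupport (hψ.compact.fderiv_apply ℝ (0, 1))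
  have hψi : Integrable ψ := hψ.smooth.continuous.integrable_of_hasCompactSupport hψ.compact
  have hdb : ∀ p q, |doubledIntegrand f u v g ψ p q| ≤
      |partialT ψ p| * (M + M) + |partialX ψ p| * D + |ψ p| * (1 * (C + C)) := fun p q => by
    rw [doubledIntegrand]
    refine (abs_add_le _ _).trans (add_le_add ((abs_add_le _ _).trans (add_le_add ?_ ?_)) ?_)
    · rw [abs_mul, abs_abs]
      exact mul_le_mul_of_nonneg_left ((abs_sub _ _).trans (add_le_add (hvM _) (huM _)))
        (abs_nonneg _)
    · rw [abs_mul]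
      exact mul_le_mul_of_nonneg_left (hD _ _ (hvM _) (huM _)) (abs_nonneg _)
    · rw [abs_mul, abs_mul]
      exact mul_le_mul_of_nonneg_left (mul_le_mul (abs_real_sign_le_one _)
        ((abs_sub _ _).trans (add_le_add (H.bound _) (H.bound _))) (abs_nonneg _) zero_le_one)
        (abs_nonneg _)
  have hdm : Measurable fun z : (ℝ × ℝ) × (ℝ × ℝ) => doubledIntegrand f u v g ψ z.1 z.2 := by
    have hvm : Measurable fun z : (ℝ × ℝ) × (ℝ × ℝ) => v z.1 := hv.comp measurable_fst
    have hum : Measurable fun z : (ℝ × ℝ) × (ℝ × ℝ) => u z.2 := H.measurable_u.comp measurable_snd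
    have hsm : Measurable fun z : (ℝ × ℝ) × (ℝ × ℝ) => Real.sign (v z.1 - u z.2) :=
      measurable_real_sign.comp (hvm.sub hum)
    refine ((((continuous_partialT hψ.smooth).measurable.comp measurable_fst).mul
      (hvm.sub hum).norm).add (((continuous_partialX hψ.smooth).measurable.comp measurable_fst).mul
      (hsm.mul ((H.continuous_f.measurable.comp hvm).sub
        (H.continuous_f.measurable.comp hum))))).add
      ((hψ.smooth.continuous.measurable.comp measurable_fst).mul
        (hsm.mul ((H.measurable_g.comp measurable_fst).sub (H.measurable_g.comp measurable_snd))))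
  have hlim : Tendsto (fun n => ∫ p, ∫ q, (shrinkingBump n).normed volume (p - q) *
      doubledIntegrand f u v g ψ p q) atTop
      (𝓝 (∫ p, (partialT ψ p * |v p - u p| + partialX ψ p * kruzkovFlux f (v p) (u p)))) := by
    refine tendsto_integral_of_dominated_convergence (fun p => |partialT ψ p| * (M + M) +
      |partialX ψ p| * D + |ψ p| * (1 * (C + C))) (fun n => ?_)
      (((hTi.abs.mul_const _).add (hXi.abs.mul_const _)).add (hψi.abs.mul_const _))
      (fun n => ae_of_all _ fun p => ?_) ?_
    · have : Measurable fun z : (ℝ × ℝ) × (ℝ × ℝ) => (shrinkingBump n).normed volume (z.1 - z.2) *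
          doubledIntegrand f u v g ψ z.1 z.2 :=
        ((shrinkingBump n).continuous_normed.measurable.comp
          (measurable_fst.sub measurable_snd)).mul hdm
      exact (this.stronglyMeasurable.integral_prod_right').aestronglyMeasurable
    · refine (norm_integral_le_of_norm_le ((integrable_normed_comp_sub (shrinkingBump n)
        p).mul_const (|partialT ψ p| * (M + M) + |partialX ψ p| * D + |ψ p| * (1 * (C + C))))
        (ae_of_all _ fun q => ?_)).trans (le_of_eq ?_)
      · rw [norm_mul, Real.norm_of_nonneg ((shrinkingBump n).nonneg_normed _)]
        exact mul_le_mul_of_nonneg_left (hdb p q) ((shrinkingBump n).nonneg_normed _)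
      · rw [integral_mul_const, integral_normed_comp_sub, one_mul]
    · filter_upwards [ae_tendsto_integral_normed_mul_abs_sub H.measurable_g H.bound] with p hp
      by_cases hpψ : p ∈ tsupport ψ
      swap
      · simp [doubledIntegrand, partialT_eq_zero hpψ, partialX_eq_zero hpψ,
          image_eq_zero_of_notMem_tsupport hpψ]
      have hpΩ := hψ.support_subset hpψ
      -- Continuity of `u` handles the terms in `u q` at the given point `p`. No regularity of `v`
      -- is needed because `v` is evaluated at the outer variable only.
      have hcu : ContinuousAt u p := H.continuousOn_u.continuousAt (H.isOpen.mem_nhds hpΩ)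
      set a : ℝ × ℝ → ℝ := fun q => partialT ψ p * |v p - u q| +
        partialX ψ p * kruzkovFlux f (v p) (u q) with ha
      have hca : ContinuousAt a p := by
        have h1 : ContinuousAt (fun q => kruzkovFlux f (v p) (u q)) p := by
          have h2 : ContinuousAt (fun q => (v p, u q)) p := continuousAt_const.prodMk hcu
          exact ContinuousAt.comp (g := fun z : ℝ × ℝ => Real.sign (z.1 - z.2) * (f z.1 - f z.2))
            (continuous_kruzkovFlux H.continuous_f).continuousAt h2
        exact (continuousAt_const.mul (continuousAt_const.sub hcu).abs).add
          (continuousAt_const.mul h1)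
      rw [Metric.tendsto_atTop]
      intro δ hδ
      obtain ⟨κ, hκ, hκa⟩ := Metric.continuousAt_iff.1 hca (δ / 2) (by positivity)
      have hp' := hp.const_mul (|ψ p|)
      rw [mul_zero] at hp'
      have ev1 := hp'.eventually_lt_const (show (0 : ℝ) < δ / 2 by positivity)
      have ev2 : ∀ᶠ n in atTop, (shrinkingBump n).rOut < κ :=
        (tendsto_nhdsWithin_iff.1 tendsto_shrinkingBump_rOut).1.eventually_lt_const hκ
      obtain ⟨N, hN⟩ := eventually_atTop.1 (ev1.and ev2)
      refine ⟨N, fun n hn => ?_⟩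
      obtain ⟨h1, h2⟩ := hN n hn
      set r := (shrinkingBump n).normed (volume : Measure (ℝ × ℝ)) with hr
      have hri : Integrable fun q => r (p - q) := integrable_normed_comp_sub _ p
      have hgi : Integrable fun q => r (p - q) * |g q - g p| :=
        hri.mul_bdd (c := C + C) (H.measurable_g.sub_const _).norm.aestronglyMeasurable
          (ae_of_all _ fun q => by
            rw [Real.norm_eq_abs, abs_abs]
            exact (abs_sub _ _).trans (add_le_add (H.bound _) (H.bound _)))
      have hdi : Integrable fun q => r (p - q) * doubledIntegrand f u v g ψ p q :=
        hri.mul_bdd (hdm.comp measurable_prodMk_left).aestronglyMeasurable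
          (ae_of_all _ fun q => hdb p q)
      have e1 : partialT ψ p * |v p - u p| + partialX ψ p * kruzkovFlux f (v p) (u p) =
          ∫ q, r (p - q) * a p := by
        rw [integral_mul_const, hr, integral_normed_comp_sub, one_mul]
      rw [Real.dist_eq, e1, ← integral_sub hdi (hri.mul_const _), ← Real.norm_eq_abs]
      have hbnd : ∀ q, ‖r (p - q) * doubledIntegrand f u v g ψ p q - r (p - q) * a p‖ ≤
          r (p - q) * (δ / 2) + |ψ p| * (r (p - q) * |g q - g p|) := fun q => by
        have hr0 : 0 ≤ r (p - q) := (shrinkingBump n).nonneg_normed _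
        by_cases hq : dist q p < κ
        · have k1 := (hκa hq).le
          rw [Real.dist_eq] at k1
          have k2 : |ψ p * (Real.sign (v p - u q) * (g p - g q))| ≤ |ψ p| * |g q - g p| := by
            rw [abs_mul, abs_mul, abs_sub_comm (g p)]
            refine mul_le_mul_of_nonneg_left ?_ (abs_nonneg _)
            exact mul_le_of_le_one_left (abs_nonneg _) (abs_real_sign_le_one _)
          have k3 : doubledIntegrand f u v g ψ p q - a p =
              (a q - a p) + ψ p * (Real.sign (v p - u q) * (g p - g q)) := by
            simp only [doubledIntegrand, ha]; ring
          rw [← mul_sub, norm_mul, Real.norm_of_nonneg hr0, k3, Real.norm_eq_abs]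
          calc _ ≤ r (p - q) * (δ / 2 + |ψ p| * |g q - g p|) :=
                mul_le_mul_of_nonneg_left ((abs_add_le _ _).trans (add_le_add k1 k2)) hr0
            _ = _ := by ring
        · have : p - q ∉ Function.support r := fun h => by
            rw [hr, (shrinkingBump n).support_normed_eq, Metric.mem_ball, dist_zero_right] at h
            rw [dist_comm, dist_eq_norm] at hq
            exact hq (h.trans h2)
          simp [Function.notMem_support.1 this]
      refine (norm_integral_le_of_norm_le ((hri.mul_const _).add (hgi.const_mul _))
        (ae_of_all _ hbnd)).trans_lt ?_
      have e2 : ∫ q, (r (p - q) * (δ / 2) + |ψ p| * (r (p - q) * |g q - g p|)) =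
          δ / 2 + |ψ p| * ∫ q, r (p - q) * |g q - g p| := by
        rw [integral_add (hri.mul_const _) (hgi.const_mul _), integral_mul_const,
          integral_const_mul, hr, integral_normed_comp_sub, one_mul]
      refine lt_of_eq_of_lt e2 ?_
      linarith
  refine ge_of_tendsto hlim ?_
  filter_upwards [(tendsto_nhdsWithin_iff.1 tendsto_shrinkingBump_rOut).1.eventually_lt_const hε]
    with n hn
  refine doubling_nonneg H hv huM hvM hent hψ hψ0 (shrinkingBump n) fun p hp => ?_
  exact (Metric.closedBall_subset_closedBall hn.le).trans
    ((Metric.closedBall_subset_cthickening hp ε).trans hεΩ)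

end Doubling

/-! ### The Cauchy problem -/

theorem isOpen_strip (T : ℝ) : IsOpen (strip T) := isOpen_Ioo.prod isOpen_univ

theorem strip_subset_strip₀ (T : ℝ) : strip T ⊆ strip₀ T :=
  prod_mono Ioo_subset_Ico_self le_rfl

theorem setIntegral_kruzkov_congr {Ω : Set (ℝ × ℝ)} {φ : ℝ × ℝ → ℝ}
    (hφ : IsTestFunction Ω φ) {f : ℝ → ℝ} {v v' g g' : ℝ × ℝ → ℝ}
    (hv : v' =ᵐ[volume.restrict Ω] v) (hg : g' =ᵐ[volume.restrict Ω] g) (k : ℝ) :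
    ∫ p in Ω, (partialT φ p * |v p - k| + partialX φ p * (Real.sign (v p - k) * (f (v p) - f k)) +
      φ p * (Real.sign (v p - k) * g p)) =
    ∫ p, (partialT φ p * |v' p - k| + partialX φ p * (Real.sign (v' p - k) * (f (v' p) - f k)) +
      φ p * (Real.sign (v' p - k) * g' p)) := by
  have hz : ∀ p ∉ Ω, partialT φ p * |v' p - k| +
      partialX φ p * (Real.sign (v' p - k) * (f (v' p) - f k)) +
      φ p * (Real.sign (v' p - k) * g' p) = 0 := fun p hp => by
    simp [partialT_eq_zero (hφ.notMem hp), partialX_eq_zero (hφ.notMem hp),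
      image_eq_zero_of_notMem_tsupport (hφ.notMem hp)]
  rw [← setIntegral_eq_integral_of_forall_compl_eq_zero hz]
  refine integral_congr_ae ?_
  filter_upwards [hv, hg] with p h1 h2
  rw [h1, h2]

theorem IsContinuousCauchySolution.continuous_slice {f : ℝ → ℝ} {g u : ℝ × ℝ → ℝ} {T : ℝ}
    {u₀ : ℝ → ℝ} (H : IsContinuousCauchySolution f g T u₀ u) {t : ℝ} (ht : t ∈ Ico 0 T) :
    Continuous fun x => u (t, x) :=
  H.continuousOn.comp_continuous (by fun_prop) fun x => ⟨ht, mem_univ _⟩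

theorem IsContinuousCauchySolution.continuous_initial {f : ℝ → ℝ} {g u : ℝ × ℝ → ℝ} {T : ℝ}
    (hT : 0 < T) {u₀ : ℝ → ℝ} (H : IsContinuousCauchySolution f g T u₀ u) : Continuous u₀ :=
  (H.continuous_slice ⟨le_rfl, hT⟩).congr H.initial

/-- Continuity up to `t = 0` gives pointwise convergence, and boundedness on a compact interval
gives domination. -/
theorem IsContinuousCauchySolution.tendsto_initial {f : ℝ → ℝ} {g u : ℝ × ℝ → ℝ} {T : ℝ}
    (hT : 0 < T) {u₀ : ℝ → ℝ} (H : IsContinuousCauchySolution f g T u₀ u) (R : ℝ) :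
    Tendsto (fun t : ℝ => ∫⁻ x in Icc (-R) R, ‖u (t, x) - u₀ x‖ₑ) (𝓝[Ioi 0] 0) (𝓝 0) := by
  obtain ⟨M, hM⟩ := H.bounded
  have hev : ∀ᶠ t in 𝓝[Ioi (0 : ℝ)] 0, t ∈ Ioo 0 T := Ioo_mem_nhdsGT hT
  have h0 : (0 : ENNReal) = ∫⁻ x in Icc (-R) R, (fun _ : ℝ => (0 : ENNReal)) x := by simp
  rw [h0]
  refine tendsto_lintegral_filter_of_dominated_convergence (fun _ => ENNReal.ofReal (M + M))
    ?_ ?_ ?_ ?_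
  · filter_upwards [hev] with t ht
    exact ((H.continuous_slice ⟨ht.1.le, ht.2⟩).sub (H.continuous_initial hT)).enorm.measurable
  · filter_upwards [hev] with t ht
    refine ae_of_all _ fun x => ?_
    rw [Real.enorm_eq_ofReal_abs]
    refine ENNReal.ofReal_le_ofReal ((abs_sub _ _).trans (add_le_add ?_ ?_))
    · exact hM _ ⟨⟨ht.1.le, ht.2⟩, mem_univ _⟩
    · rw [← H.initial]; exact hM _ ⟨⟨le_rfl, hT⟩, mem_univ _⟩
  · rw [lintegral_const]
    exact ENNReal.mul_ne_top ENNReal.ofReal_ne_top (by simp)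
  · refine ae_of_all _ fun x => ?_
    have h1 : Tendsto (fun t : ℝ => u (t, x)) (𝓝[Ioi 0] 0) (𝓝 (u (0, x))) := by
      have h2 := H.continuousOn (0, x) ⟨⟨le_rfl, hT⟩, mem_univ _⟩
      refine h2.tendsto.comp (tendsto_nhdsWithin_iff.2 ⟨?_, ?_⟩)
      · have : Continuous fun t : ℝ => (t, x) := by fun_prop
        exact (this.tendsto 0).mono_left nhdsWithin_le_nhds
      · filter_upwards [hev] with t ht using ⟨⟨ht.1.le, ht.2⟩, mem_univ _⟩
    have h3 := (h1.sub_const (u₀ x)).enorm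
    rwa [H.initial, sub_self, enorm_zero] at h3

theorem IsContinuousCauchySolution.isKruzkovEntropySolution {f : ℝ → ℝ} (hf : Continuous f)
    {g u : ℝ × ℝ → ℝ} {T : ℝ} (hT : 0 < T) {u₀ : ℝ → ℝ}
    (H : IsContinuousCauchySolution f g T u₀ u) : IsKruzkovEntropySolution f g T u₀ u where
  bounded := by
    obtain ⟨M, hM⟩ := H.bounded
    refine memLp_top_of_bound (H.solution.continuousOn.aestronglyMeasurable
      (isOpen_strip T).measurableSet) M ?_
    exact ae_restrict_of_forall_mem (isOpen_strip T).measurableSet fun p hp =>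
      hM p (strip_subset_strip₀ T hp)
  entropy k φ hφ _ := by
    obtain ⟨u', g', C, H', hu, -, hg⟩ := H.solution.exists_balanceData hf (isOpen_strip T)
    rw [setIntegral_kruzkov_congr hφ
      (ae_restrict_of_forall_mem (isOpen_strip T).measurableSet hu) hg k, H'.integral_kruzkov hφ]
  initial := ⟨∅, measure_empty, fun R => by rw [sdiff_empty]; exact H.tendsto_initial hT R⟩

/-! ### Test functions on backward cones -/

theorem partialT_eq_of_hasDerivAt {φ : ℝ × ℝ → ℝ} {p : ℝ × ℝ} {d : ℝ}
    (hφ : DifferentiableAt ℝ φ p) (h : HasDerivAt (fun s => φ (s, p.2)) d p.1) :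
    partialT φ p = d := by
  have h1 : HasDerivAt (fun s : ℝ => (s, p.2)) ((1 : ℝ), (0 : ℝ)) p.1 :=
    (hasDerivAt_id p.1).prodMk (hasDerivAt_const p.1 p.2)
  have h2 : HasDerivAt (φ ∘ fun s : ℝ => (s, p.2)) (fderiv ℝ φ p (1, 0)) p.1 :=
    HasFDerivAt.comp_hasDerivAt (p.1) hφ.hasFDerivAt h1
  exact h2.unique h

theorem partialX_eq_of_hasDerivAt {φ : ℝ × ℝ → ℝ} {p : ℝ × ℝ} {d : ℝ}
    (hφ : DifferentiableAt ℝ φ p) (h : HasDerivAt (fun y => φ (p.1, y)) d p.2) :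
    partialX φ p = d := by
  have h1 : HasDerivAt (fun y : ℝ => (p.1, y)) ((0 : ℝ), (1 : ℝ)) p.2 :=
    (hasDerivAt_const p.2 p.1).prodMk (hasDerivAt_id p.2)
  have h2 : HasDerivAt (φ ∘ fun y : ℝ => (p.1, y)) (fderiv ℝ φ p (0, 1)) p.2 :=
    HasFDerivAt.comp_hasDerivAt (p.2) hφ.hasFDerivAt h1
  exact h2.unique h

/-- A smooth cutoff of the cone `{√(1 + x²) + L t < ρ}`. -/
noncomputable def coneCutoff (L ρ : ℝ) (p : ℝ × ℝ) : ℝ :=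
  Real.smoothTransition (ρ - √(1 + p.2 ^ 2) - L * p.1)

theorem contDiff_coneCutoff (L ρ : ℝ) : ContDiff ℝ ∞ (coneCutoff L ρ) := by
  refine Real.smoothTransition.contDiff.comp ?_
  refine (contDiff_const.sub (ContDiff.sqrt ?_ fun p => ?_)).sub (contDiff_const.mul contDiff_fst)
  · exact contDiff_const.add (contDiff_snd.pow 2)
  · positivity

theorem hasDerivAt_sqrt_one_add_sq (x : ℝ) :
    HasDerivAt (fun y : ℝ => √(1 + y ^ 2)) (x / √(1 + x ^ 2)) x := by
  have h1 : HasDerivAt (fun y : ℝ => 1 + y ^ 2) (2 * x) x := by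
    simpa using (hasDerivAt_pow 2 x).const_add 1
  have h2 := h1.sqrt (by positivity)
  convert! h2 using 1
  field_simp

/-- The smooth function `√(1 + x²)` replaces `|x|` in the cone and still has slope at most `1`, so
the lateral boundary outruns every wave of speed at most `L`. -/
theorem abs_div_sqrt_le_one (x : ℝ) : |x / √(1 + x ^ 2)| ≤ 1 := by
  rw [abs_div, abs_of_nonneg (Real.sqrt_nonneg _), div_le_one (by positivity)]
  exact Real.abs_le_sqrt (by linarith)

theorem abs_le_of_coneCutoff_ne_zero {L ρ : ℝ} (hL : 0 ≤ L) {p : ℝ × ℝ} (hp : 0 ≤ p.1)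
    (h : coneCutoff L ρ p ≠ 0) : |p.2| ≤ ρ := by
  have h1 : 0 < ρ - √(1 + p.2 ^ 2) - L * p.1 := by
    by_contra h1
    exact h (Real.smoothTransition.zero_of_nonpos (not_lt.1 h1))
  have h2 : |p.2| ≤ √(1 + p.2 ^ 2) := Real.abs_le_sqrt (by linarith)
  have h3 : 0 ≤ L * p.1 := mul_nonneg hL hp
  linarith

/-- Along the cone, the terms produced by the lateral boundary have a sign. -/
theorem cone_flux_le {L ρ a a' d F : ℝ} {α : ℝ → ℝ} {p : ℝ × ℝ} (hα : ContDiff ℝ ∞ α)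
    (ha : α p.1 = a) (ha0 : 0 ≤ a) (ha' : HasDerivAt α a' p.1) (hF : |F| ≤ L * |d|) :
    partialT (fun q => α q.1 * coneCutoff L ρ q) p * |d| +
      partialX (fun q => α q.1 * coneCutoff L ρ q) p * F ≤ a' * coneCutoff L ρ p * |d| := by
  set s := ρ - √(1 + p.2 ^ 2) - L * p.1 with hs
  set S' := deriv Real.smoothTransition s with hS'
  have hS0 : 0 ≤ S' := deriv_smoothTransition_nonneg s
  have hd : DifferentiableAt ℝ (fun q : ℝ × ℝ => α q.1 * coneCutoff L ρ q) p :=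
    ((hα.comp contDiff_fst).mul (contDiff_coneCutoff L ρ)).differentiable (by simp) p
  have hT : HasDerivAt (fun t => coneCutoff L ρ (t, p.2)) (S' * -L) p.1 := by
    have h1 : HasDerivAt (fun t : ℝ => ρ - √(1 + p.2 ^ 2) - L * t) (-L) p.1 := by
      simpa using ((hasDerivAt_id p.1).const_mul L).const_sub (ρ - √(1 + p.2 ^ 2))
    exact (hasDerivAt_smoothTransition s).comp p.1 h1
  have hX : HasDerivAt (fun y => coneCutoff L ρ (p.1, y)) (S' * -(p.2 / √(1 + p.2 ^ 2))) p.2 := by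
    have h1 : HasDerivAt (fun y : ℝ => ρ - √(1 + y ^ 2) - L * p.1) (-(p.2 / √(1 + p.2 ^ 2))) p.2 :=
      ((hasDerivAt_sqrt_one_add_sq p.2).const_sub ρ).sub_const _
    exact (hasDerivAt_smoothTransition s).comp p.2 h1
  have e1 : partialT (fun q => α q.1 * coneCutoff L ρ q) p =
      a' * coneCutoff L ρ p + a * (S' * -L) := by
    refine partialT_eq_of_hasDerivAt hd ?_
    rw [← ha]
    exact ha'.mul hT
  have e2 : partialX (fun q => α q.1 * coneCutoff L ρ q) p =
      a * (S' * -(p.2 / √(1 + p.2 ^ 2))) := by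
    refine partialX_eq_of_hasDerivAt hd ?_
    rw [← ha]
    exact hX.const_mul (α p.1)
  rw [e1, e2]
  have h1 : -(p.2 / √(1 + p.2 ^ 2)) * F ≤ L * |d| := by
    refine (le_abs_self _).trans ?_
    rw [abs_mul, abs_neg]
    exact (mul_le_of_le_one_left (abs_nonneg _) (abs_div_sqrt_le_one _)).trans hF
  have h2 : 0 ≤ a * S' := mul_nonneg ha0 hS0
  -- The lateral terms are `a S' (-L |d| - (x / √(1 + x²)) F)`, which is nonpositive.
  nlinarith [mul_le_mul_of_nonneg_left h1 h2]

/-- `L` bounds `|f'|` on `[-M, M]`: it is the maximal speed of propagation for solutions bounded by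
`M`. -/
theorem abs_kruzkovFlux_le {f : ℝ → ℝ} (hf : ContDiff ℝ 1 f) (M : ℝ) :
    ∃ L, 0 ≤ L ∧ ∀ a b, |a| ≤ M → |b| ≤ M → |kruzkovFlux f a b| ≤ L * |a - b| := by
  obtain ⟨L, hL⟩ := isCompact_Icc.exists_bound_of_continuousOn (s := Icc (-M) M)
    (hf.continuous_deriv (by norm_num)).continuousOn
  refine ⟨|L|, abs_nonneg L, fun a b ha hb => ?_⟩
  have h1 := (convex_Icc (-M) M).norm_image_sub_le_of_norm_deriv_le (f := f) (C := |L|)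
    (fun z _ => hf.differentiable (by norm_num) z)
    (fun z hz => (hL z hz).trans (le_abs_self L)) (abs_le.1 hb) (abs_le.1 ha)
  rw [kruzkovFlux, abs_mul]
  exact (mul_le_of_le_one_left (abs_nonneg _) (abs_real_sign_le_one _)).trans h1

theorem hasDerivAt_expNegInvGlue (s : ℝ) :
    HasDerivAt expNegInvGlue (s⁻¹ ^ 2 * expNegInvGlue s) s := by
  have := expNegInvGlue.hasDerivAt_polynomial_eval_inv_mul 1 s
  simpa using this

/-- The time profile of the test functions: switched on after `1 / n`, decreasing up to `τ`. -/
noncomputable def timeProfile (n : ℕ) (τ t : ℝ) : ℝ :=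
  Real.smoothTransition (n * (t - 1 / n)) * expNegInvGlue (τ - t)

theorem contDiff_timeProfile (n : ℕ) (τ : ℝ) : ContDiff ℝ ∞ (timeProfile n τ) :=
  (contDiff_step n _).mul (expNegInvGlue.contDiff.comp (by fun_prop))

theorem timeProfile_nonneg (n : ℕ) (τ t : ℝ) : 0 ≤ timeProfile n τ t :=
  mul_nonneg (Real.smoothTransition.nonneg _) (expNegInvGlue.nonneg _)

/-- The decay rate of `expNegInvGlue (τ - t)`. -/
noncomputable def decayRate (τ t : ℝ) : ℝ := (τ - t)⁻¹ ^ 2 * expNegInvGlue (τ - t)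

theorem continuous_decayRate (τ : ℝ) : Continuous (decayRate τ) := by
  have h1 : Continuous (deriv expNegInvGlue) :=
    (expNegInvGlue.contDiff (n := 1)).continuous_deriv (by norm_num)
  have h2 : decayRate τ = fun t => deriv expNegInvGlue (τ - t) := by
    ext t; rw [(hasDerivAt_expNegInvGlue _).deriv, decayRate]
  rw [h2]
  exact h1.comp (by fun_prop)

theorem decayRate_nonneg (τ t : ℝ) : 0 ≤ decayRate τ t :=
  mul_nonneg (by positivity) (expNegInvGlue.nonneg _)

theorem hasDerivAt_timeProfile (n : ℕ) (τ t : ℝ) :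
    HasDerivAt (timeProfile n τ) (stepKernel n (1 / n) t * expNegInvGlue (τ - t) -
      Real.smoothTransition (n * (t - 1 / n)) * decayRate τ t) t := by
  have h1 : HasDerivAt (fun t => expNegInvGlue (τ - t)) (-decayRate τ t) t := by
    have := (hasDerivAt_expNegInvGlue (τ - t)).comp t ((hasDerivAt_id t).const_sub τ)
    simpa [decayRate, Function.comp_def] using this
  have h2 := (hasDerivAt_step n (1 / n) t).mul h1
  rw [mul_neg, ← sub_eq_add_neg] at h2
  exact h2

theorem step_eq_zero {n : ℕ} {t : ℝ} (ht : t ≤ 1 / n) :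
    Real.smoothTransition (n * (t - 1 / n)) = 0 :=
  Real.smoothTransition.zero_of_nonpos
    (mul_nonpos_of_nonneg_of_nonpos (by positivity) (by linarith))

theorem stepKernel_eq_zero_of_lt {n : ℕ} (hn : n ≠ 0) {t s : ℝ} (hs : s < t) :
    stepKernel n t s = 0 := by
  have : (0 : ℝ) < n := by positivity
  rw [stepKernel, deriv_smoothTransition_of_neg (mul_neg_of_pos_of_neg this (by linarith)),
    mul_zero]

theorem stepKernel_eq_zero_of_gt {n : ℕ} (hn : n ≠ 0) {t s : ℝ} (hs : t + 1 / n < s) :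
    stepKernel n t s = 0 := by
  have h0 : (0 : ℝ) < n := by positivity
  have : 1 < (n : ℝ) * (s - t) := by
    have h1 : 1 / (n : ℝ) < s - t := by linarith
    rw [div_lt_iff₀ h0] at h1
    linarith
  rw [stepKernel, deriv_smoothTransition_of_gt this, mul_zero]

/-- The cone test functions. -/
theorem isTestFunction_cone {T τ L ρ : ℝ} (hL : 0 ≤ L) (hτT : τ < T) {n : ℕ} (hn : n ≠ 0) :
    IsTestFunction (strip T) fun p => timeProfile n τ p.1 * coneCutoff L ρ p := by
  have hn' : (0 : ℝ) < 1 / n := by positivity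
  have hsub : Function.support (fun p : ℝ × ℝ => timeProfile n τ p.1 * coneCutoff L ρ p) ⊆
      Icc (1 / (n : ℝ)) τ ×ˢ Icc (-ρ) ρ := by
    intro p hp
    have h1 : timeProfile n τ p.1 ≠ 0 := left_ne_zero_of_mul hp
    have h2 : coneCutoff L ρ p ≠ 0 := right_ne_zero_of_mul hp
    have h3 : 1 / (n : ℝ) ≤ p.1 := by
      by_contra h
      exact left_ne_zero_of_mul h1 (step_eq_zero (not_le.1 h).le)
    have h4 : p.1 ≤ τ := by
      by_contra h
      exact right_ne_zero_of_mul h1 (expNegInvGlue.zero_of_nonpos (by linarith [not_le.1 h]))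
    exact ⟨⟨h3, h4⟩, abs_le.1 (abs_le_of_coneCutoff_ne_zero hL (hn'.le.trans h3) h2)⟩
  have hK : IsCompact (Icc (1 / (n : ℝ)) τ ×ˢ Icc (-ρ) ρ) := isCompact_Icc.prod isCompact_Icc
  refine ⟨((contDiff_timeProfile n τ).comp contDiff_fst).mul (contDiff_coneCutoff L ρ),
    HasCompactSupport.of_support_subset_isCompact hK hsub,
    (closure_minimal hsub hK.isClosed).trans fun p hp => ?_⟩
  exact ⟨⟨hn'.trans_le hp.1.1, hp.1.2.trans_lt hτT⟩, mem_univ _⟩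

theorem integrable_mul_coneCutoff {L ρ a b : ℝ} (hL : 0 ≤ L) (ha : 0 ≤ a) {α : ℝ → ℝ}
    (hα : Continuous α) (hα0 : ∀ t ∉ Icc a b, α t = 0) {d : ℝ × ℝ → ℝ} (hd : Measurable d)
    {D : ℝ} (hD : ∀ p, |d p| ≤ D) :
    Integrable fun p : ℝ × ℝ => α p.1 * coneCutoff L ρ p * |d p| := by
  have h1 : Integrable fun p : ℝ × ℝ => α p.1 * coneCutoff L ρ p := by
    refine ((hα.comp continuous_fst).mul
      (contDiff_coneCutoff L ρ).continuous).integrable_of_hasCompactSupport ?_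
    refine HasCompactSupport.intro (K := Icc a b ×ˢ Icc (-ρ) ρ)
      (isCompact_Icc.prod isCompact_Icc) fun p hp => ?_
    by_contra h
    have h1 : p.1 ∈ Icc a b := by
      by_contra h1
      exact h (by simp [hα0 _ h1])
    exact hp ⟨h1, abs_le.1 (abs_le_of_coneCutoff_ne_zero hL (ha.trans h1.1)
      (right_ne_zero_of_mul h))⟩
  exact h1.mul_bdd (c := D) hd.norm.aestronglyMeasurable (ae_of_all _ fun p => by
    rw [Real.norm_eq_abs, abs_abs]; exact hD p)

/-! ### Uniqueness -/

theorem coneCutoff_nonneg (L ρ : ℝ) (p : ℝ × ℝ) : 0 ≤ coneCutoff L ρ p :=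
  Real.smoothTransition.nonneg _

/-- The mass near the initial line tends to zero. -/
theorem integral_stepKernel_cone_le {L ρ τ κ δ D : ℝ} (hL : 0 ≤ L) {d : ℝ × ℝ → ℝ}
    (hd : Measurable d) (hD : ∀ p, |d p| ≤ D) (hδ : 0 ≤ δ)
    (h0 : ∀ᵐ t : ℝ, t ∈ Ioo 0 κ → ∫⁻ x in Icc (-ρ) ρ, ‖d (t, x)‖ₑ ≤ ENNReal.ofReal δ)
    {n : ℕ} (hn : n ≠ 0) (hnκ : 1 / (n : ℝ) + 1 / n < κ) :
    ∫ p : ℝ × ℝ, stepKernel n (1 / n) p.1 * expNegInvGlue (τ - p.1) * coneCutoff L ρ p * |d p| ≤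
      expNegInvGlue τ * δ := by
  have hn' : (0 : ℝ) < 1 / n := by positivity
  have hk0 : ∀ t ∉ Icc (1 / (n : ℝ)) (1 / n + 1 / n), stepKernel n (1 / n) t = 0 := fun t ht => by
    by_cases h : t < 1 / n
    · exact stepKernel_eq_zero_of_lt hn h
    · refine stepKernel_eq_zero_of_gt hn ?_
      by_contra h'
      exact ht ⟨not_lt.1 h, not_lt.1 h'⟩
  have hkn : ∀ t, 0 ≤ stepKernel n (1 / n) t := fun t =>
    mul_nonneg (by positivity) (deriv_smoothTransition_nonneg _)
  have hi := integrable_mul_coneCutoff (ρ := ρ) (b := 1 / (n : ℝ) + 1 / n) hL hn'.le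
    (α := fun t => stepKernel n (1 / n) t * expNegInvGlue (τ - t))
    ((continuous_stepKernel n _).mul ((expNegInvGlue.contDiff (n := 0)).continuous.comp
      (by fun_prop))) (fun t ht => by simp only [hk0 t ht, zero_mul]) hd hD
  have hi2 : Integrable fun t => stepKernel n (1 / n) t * (expNegInvGlue τ * δ) :=
    ((continuous_stepKernel n _).integrable_of_hasCompactSupport
      (HasCompactSupport.intro isCompact_Icc hk0)).mul_const _
  rw [Measure.volume_eq_prod, integral_prod _ hi]
  have hE0 : 0 ≤ expNegInvGlue τ * δ := mul_nonneg (expNegInvGlue.nonneg _) hδ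
  -- Slice by slice the integral is at most the kernel times `expNegInvGlue τ * δ`, and the kernel
  -- has unit mass.
  refine (integral_mono_ae hi.integral_prod_left hi2 ?_).trans
    ((le_abs_self _).trans (abs_integral_stepKernel_mul_le n (1 / n)
      (W := fun _ => expNegInvGlue τ * δ) fun s => (abs_of_nonneg hE0).le))
  filter_upwards [h0] with t ht
  by_cases htI : t ∈ Icc (1 / (n : ℝ)) (1 / n + 1 / n)
  swap
  · simp only [hk0 t htI, zero_mul, integral_zero, le_refl]
  have ht0 : 0 < t := hn'.trans_le htI.1
  have hmass : ∫ x, coneCutoff L ρ (t, x) * |d (t, x)| ≤ δ := by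
    have hm : Measurable fun x => coneCutoff L ρ (t, x) * |d (t, x)| :=
      ((contDiff_coneCutoff L ρ).continuous.measurable.comp measurable_prodMk_left).mul
        (hd.comp measurable_prodMk_left).norm
    rw [integral_eq_lintegral_of_nonneg_ae (ae_of_all _ fun x =>
      mul_nonneg (coneCutoff_nonneg _ _ _) (abs_nonneg _)) hm.aestronglyMeasurable]
    refine ENNReal.toReal_le_of_le_ofReal hδ (le_trans ?_ (ht ⟨ht0, htI.2.trans_lt hnκ⟩))
    rw [← lintegral_indicator measurableSet_Icc]
    refine lintegral_mono fun x => ?_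
    by_cases hx : x ∈ Icc (-ρ) ρ
    · rw [indicator_of_mem hx, Real.enorm_eq_ofReal_abs]
      exact ENNReal.ofReal_le_ofReal (mul_le_of_le_one_left (abs_nonneg _)
        (Real.smoothTransition.le_one _))
    · have : coneCutoff L ρ (t, x) = 0 := by
        by_contra h
        exact hx (abs_le.1 (abs_le_of_coneCutoff_ne_zero (p := (t, x)) hL ht0.le h))
      simp [this]
  have e : ∀ x, stepKernel n (1 / n) t * expNegInvGlue (τ - t) * coneCutoff L ρ (t, x) *
      |d (t, x)| = stepKernel n (1 / n) t * expNegInvGlue (τ - t) *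
        (coneCutoff L ρ (t, x) * |d (t, x)|) := fun x => by ring
  simp only [e]
  rw [integral_const_mul, mul_assoc]
  refine mul_le_mul_of_nonneg_left ?_ (hkn t)
  refine mul_le_mul (expNegInvGlue.monotone (by linarith)) hmass
    (integral_nonneg fun x => mul_nonneg (coneCutoff_nonneg _ _ _) (abs_nonneg _))
    (expNegInvGlue.nonneg _)

/-- The time factor has a strictly negative logarithmic derivative before `τ`, so comparison bounds
a weighted integral of `|v - u|` over the cone directly by the mass near the initial line. That mass
tends to zero, and the weight is positive inside the cone; no Gronwall argument is needed. -/
theorem ae_eq_zero_of_cone {f : ℝ → ℝ} {u v : ℝ × ℝ → ℝ} {T M L ρ τ : ℝ} (hL : 0 ≤ L)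
    (hu : Measurable u) (hv : Measurable v) (huM : ∀ p, |u p| ≤ M) (hvM : ∀ p, |v p| ≤ M)
    (hLf : ∀ a b, |a| ≤ M → |b| ≤ M → |kruzkovFlux f a b| ≤ L * |a - b|)
    (hf : Continuous f)
    (hcomp : ∀ ψ : ℝ × ℝ → ℝ, IsTestFunction (strip T) ψ → (∀ p, 0 ≤ ψ p) →
      0 ≤ ∫ p, (partialT ψ p * |v p - u p| + partialX ψ p * kruzkovFlux f (v p) (u p)))
    (h0 : ∀ δ > 0, ∃ κ > 0, ∀ᵐ t : ℝ, t ∈ Ioo 0 κ →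
      ∫⁻ x in Icc (-ρ) ρ, ‖v (t, x) - u (t, x)‖ₑ ≤ ENNReal.ofReal δ)
    (hτT : τ < T) {n : ℕ} (hn : n ≠ 0) :
    ∀ᵐ p : ℝ × ℝ, 1 / (n : ℝ) < p.1 → p.1 < τ → √(1 + p.2 ^ 2) + L * p.1 < ρ → v p = u p := by
  have hd : Measurable fun p => v p - u p := hv.sub hu
  have hD : ∀ p, |v p - u p| ≤ M + M := fun p =>
    (abs_sub _ _).trans (add_le_add (hvM p) (huM p))
  have hFm : Measurable fun p => kruzkovFlux f (v p) (u p) :=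
    (measurable_real_sign.comp hd).mul ((hf.measurable.comp hv).sub (hf.measurable.comp hu))
  set P : ℕ → ℝ × ℝ → ℝ := fun m p => Real.smoothTransition (m * (p.1 - 1 / m)) *
    decayRate τ p.1 * coneCutoff L ρ p * |v p - u p| with hP
  have hPi : ∀ m : ℕ, m ≠ 0 → Integrable (P m) := fun m hm => by
    have hm' : (0 : ℝ) < 1 / m := by positivity
    refine integrable_mul_coneCutoff hL hm'.le (b := τ)
      (α := fun t => Real.smoothTransition (m * (t - 1 / m)) * decayRate τ t)
      ((contDiff_step m _).continuous.mul (continuous_decayRate τ)) (fun t ht => ?_) hd hD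
    by_cases h : t < 1 / m
    · simp only [step_eq_zero h.le, zero_mul]
    · have : τ < t := by
        by_contra h'
        exact ht ⟨not_lt.1 h, not_lt.1 h'⟩
      simp [decayRate, expNegInvGlue.zero_of_nonpos (show τ - t ≤ 0 by linarith)]
  have hP0 : ∀ m p, 0 ≤ P m p := fun m p =>
    mul_nonneg (mul_nonneg (mul_nonneg (Real.smoothTransition.nonneg _) (decayRate_nonneg _ _))
      (coneCutoff_nonneg _ _ _)) (abs_nonneg _)
  have hQ : ∀ m : ℕ, m ≠ 0 → ∫ p, P m p ≤ ∫ p : ℝ × ℝ,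
      stepKernel m (1 / m) p.1 * expNegInvGlue (τ - p.1) * coneCutoff L ρ p * |v p - u p| := by
    intro m hm
    have hm' : (0 : ℝ) < 1 / m := by positivity
    have hQi := integrable_mul_coneCutoff (ρ := ρ) hL hm'.le (b := 1 / (m : ℝ) + 1 / m)
      (α := fun t => stepKernel m (1 / m) t * expNegInvGlue (τ - t))
      ((continuous_stepKernel m _).mul ((expNegInvGlue.contDiff (n := 0)).continuous.comp
        (by fun_prop))) (fun t ht => by
          by_cases h : t < 1 / m
          · simp only [stepKernel_eq_zero_of_lt hm h, zero_mul]
          · have : 1 / (m : ℝ) + 1 / m < t := by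
              by_contra h'
              exact ht ⟨not_lt.1 h, not_lt.1 h'⟩
            simp only [stepKernel_eq_zero_of_gt hm this, zero_mul]) hd hD
    have htest := isTestFunction_cone (ρ := ρ) hL hτT hm
    have h1 := hcomp _ htest fun p => mul_nonneg (timeProfile_nonneg _ _ _) (coneCutoff_nonneg _ _ _)
    rw [← sub_nonneg, ← integral_sub hQi (hPi m hm)]
    refine h1.trans (integral_mono ?_ (hQi.sub (hPi m hm)) fun p => ?_)
    · have i1 : Integrable (partialT fun p => timeProfile m τ p.1 * coneCutoff L ρ p) :=
        (continuous_partialT htest.smooth).integrable_of_hasCompactSupport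
          (htest.compact.fderiv_apply ℝ (1, 0))
      have i2 : Integrable (partialX fun p => timeProfile m τ p.1 * coneCutoff L ρ p) :=
        (continuous_partialX htest.smooth).integrable_of_hasCompactSupport
          (htest.compact.fderiv_apply ℝ (0, 1))
      exact (i1.mul_bdd (c := M + M) hd.norm.aestronglyMeasurable (ae_of_all _ fun p => by
          rw [norm_norm]; exact hD p)).add
        (i2.mul_bdd (c := L * (M + M)) hFm.aestronglyMeasurable (ae_of_all _ fun p =>
          (hLf _ _ (hvM p) (huM p)).trans (mul_le_mul_of_nonneg_left (hD p) hL)))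
    · refine (cone_flux_le (contDiff_timeProfile m τ) rfl (timeProfile_nonneg _ _ _)
        (hasDerivAt_timeProfile m τ p.1) (hLf _ _ (hvM p) (huM p))).trans (le_of_eq ?_)
      simp only [hP]
      ring
  -- `n` is kept fixed while the switch-on time `1 / m` tends to zero: for positive times `m t - 1`
  -- increases with `m`, so the integrals for `m` dominate the one for `n`.
  have hmono : ∀ m, n ≤ m → ∀ p, P n p ≤ P m p := fun m hm p => by
    have hm0 : m ≠ 0 := fun h => hn (Nat.le_zero.1 (h ▸ hm))
    by_cases hp : p.1 ≤ 1 / n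
    · refine le_of_eq_of_le ?_ (hP0 m p)
      simp only [hP, step_eq_zero hp, zero_mul]
    · have hn' : (0 : ℝ) < 1 / n := by positivity
      have hp0 : 0 < p.1 := hn'.trans (not_le.1 hp)
      refine mul_le_mul_of_nonneg_right (mul_le_mul_of_nonneg_right (mul_le_mul_of_nonneg_right
        (Real.smoothTransition.monotone ?_) (decayRate_nonneg _ _)) (coneCutoff_nonneg _ _ _))
        (abs_nonneg _)
      have e1 : (n : ℝ) * (p.1 - 1 / n) = n * p.1 - 1 := by field_simp
      have e2 : (m : ℝ) * (p.1 - 1 / m) = m * p.1 - 1 := by field_simp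
      have : (n : ℝ) ≤ m := by exact_mod_cast hm
      rw [e1, e2]
      gcongr
  have hzero : ∫ p, P n p = 0 := by
    refine le_antisymm ?_ (integral_nonneg (hP0 n))
    have hδ : ∀ δ > 0, ∫ p, P n p ≤ expNegInvGlue τ * δ := fun δ hδ => by
      obtain ⟨κ, hκ, hκ0⟩ := h0 δ hδ
      obtain ⟨m, hm⟩ := exists_nat_gt (max (2 / κ) n)
      have hm1 : 2 / κ < m := (le_max_left _ _).trans_lt hm
      have hm2 : n ≤ m := by exact_mod_cast ((le_max_right _ _).trans_lt hm).le
      have hm0 : m ≠ 0 := fun h => hn (Nat.le_zero.1 (h ▸ hm2))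
      have hm' : (0 : ℝ) < m := by positivity
      have hmκ : 1 / (m : ℝ) + 1 / m < κ := by
        rw [div_lt_iff₀ hκ] at hm1
        rw [← add_div, div_lt_iff₀ hm']
        linarith
      exact (integral_mono (hPi n hn) (hPi m hm0) (hmono m hm2)).trans ((hQ m hm0).trans
        (integral_stepKernel_cone_le hL hd hD hδ.le hκ0 hm0 hmκ))
    have hlim : Tendsto (fun δ : ℝ => expNegInvGlue τ * δ) (𝓝[>] 0) (𝓝 0) := by
      have : Tendsto (fun δ : ℝ => expNegInvGlue τ * δ) (𝓝 0) (𝓝 (expNegInvGlue τ * 0)) :=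
        (continuous_const.mul continuous_id).tendsto 0
      rw [mul_zero] at this
      exact this.mono_left nhdsWithin_le_nhds
    exact ge_of_tendsto hlim (by filter_upwards [self_mem_nhdsWithin] with δ hδ' using hδ δ hδ')
  have hae := (integral_eq_zero_iff_of_nonneg (hP0 n) (hPi n hn)).1 hzero
  filter_upwards [hae] with p hp h1 h2 h3
  have k1 : 0 < Real.smoothTransition (n * (p.1 - 1 / n)) :=
    Real.smoothTransition.pos_of_pos (mul_pos (by positivity) (by linarith))
  have k2 : 0 < decayRate τ p.1 :=
    mul_pos (by have : 0 < τ - p.1 := by linarith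
                positivity) (expNegInvGlue.pos_of_pos (by linarith))
  have k3 : 0 < coneCutoff L ρ p := Real.smoothTransition.pos_of_pos (by linarith)
  have k4 : |v p - u p| = 0 := by
    rcases mul_eq_zero.1 hp with h | h
    · exact absurd h (mul_pos (mul_pos k1 k2) k3).ne'
    · exact h
  exact sub_eq_zero.1 (abs_eq_zero.1 k4)

/-- Replace `u`, `v` and `g` by bounded measurable representatives, compare them on cones with the
speed `L` belonging to their common bound, and exhaust the strip by countably many truncated cones.
-/
theorem IsKruzkovEntropySolution.ae_eq {f : ℝ → ℝ} (hf : ContDiff ℝ 1 f) {g u v : ℝ × ℝ → ℝ}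
    {T : ℝ} (hT : 0 < T) {u₀ : ℝ → ℝ} (V : IsKruzkovEntropySolution f g T u₀ v)
    (H : IsContinuousCauchySolution f g T u₀ u) : v =ᵐ[volume.restrict (strip T)] u := by
  obtain ⟨u', g', C, H', hu, hu0, hg⟩ :=
    H.solution.exists_balanceData hf.continuous (isOpen_strip T)
  obtain ⟨v', M₁, hv'm, hv'M, hv⟩ := exists_measurable_bounded_ae_eq V.bounded
  obtain ⟨M₂, hM₂⟩ := H.bounded
  set M := max M₁ |M₂| with hM
  have hvM : ∀ p, |v' p| ≤ M := fun p => (hv'M p).trans (le_max_left _ _)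
  have huM : ∀ p, |u' p| ≤ M := fun p => by
    by_cases hp : p ∈ strip T
    · rw [hu hp]
      exact ((hM₂ p (strip_subset_strip₀ T hp)).trans (le_abs_self _)).trans (le_max_right _ _)
    · rw [hu0 p hp, abs_zero]
      exact (abs_nonneg M₂).trans (le_max_right _ _)
  obtain ⟨L, hL, hLf⟩ := abs_kruzkovFlux_le hf M
  have hcomp := fun ψ hψ hψ0 => comparison_nonneg (ψ := ψ) H' hv'm huM hvM (fun k φ hφ hφ0 => by
    have := V.entropy k φ hφ hφ0
    rwa [setIntegral_kruzkov_congr hφ hv hg k] at this) hψ hψ0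
  -- The initial condition concerns slices of the original `v`; by Fubini its representative has the
  -- same slices for almost every time.
  have hslice : ∀ᵐ t : ℝ, t ∈ Ioo 0 T → ∀ᵐ x : ℝ, v' (t, x) = v (t, x) := by
    have h1 : v' =ᵐ[((volume : Measure ℝ).restrict (Ioo 0 T)).prod
        ((volume : Measure ℝ).restrict univ)] v := by
      rw [Measure.prod_restrict]; exact hv
    have h2 := Measure.ae_ae_of_ae_prod h1
    rw [Measure.restrict_univ] at h2
    exact (ae_restrict_iff' measurableSet_Ioo).1 h2
  obtain ⟨E, hE, hEv⟩ := V.initial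
  have h0 : ∀ ρ, ∀ δ > 0, ∃ κ > 0, ∀ᵐ t : ℝ, t ∈ Ioo 0 κ →
      ∫⁻ x in Icc (-ρ) ρ, ‖v' (t, x) - u' (t, x)‖ₑ ≤ ENNReal.ofReal δ := by
    intro ρ δ hδ
    have hδ2 : (0 : ENNReal) < ENNReal.ofReal (δ / 2) := ENNReal.ofReal_pos.2 (by positivity)
    have ev1 := (hEv ρ).eventually_lt_const hδ2
    have ev2 := (H.tendsto_initial hT ρ).eventually_lt_const hδ2
    rw [eventually_nhdsWithin_iff, Metric.eventually_nhds_iff] at ev1 ev2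
    obtain ⟨κ₁, hκ₁, h1⟩ := ev1
    obtain ⟨κ₂, hκ₂, h2⟩ := ev2
    refine ⟨min (min κ₁ κ₂) T, by positivity, ?_⟩
    have hEae : ∀ᵐ t : ℝ, t ∉ E := measure_eq_zero_iff_ae_notMem.1 hE
    filter_upwards [hslice, hEae] with t ht htE htI
    have ht1 : t < κ₁ := htI.2.trans_le ((min_le_left _ _).trans (min_le_left _ _))
    have ht2 : t < κ₂ := htI.2.trans_le ((min_le_left _ _).trans (min_le_right _ _))
    have ht3 : t < T := htI.2.trans_le (min_le_right _ _)
    have hdist : dist t 0 = t := by rw [Real.dist_eq, sub_zero, abs_of_pos htI.1]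
    have b1 := (h1 (y := t) (by rwa [hdist]) ⟨htI.1, htE⟩).le
    have b2 := (h2 (y := t) (by rwa [hdist]) htI.1).le
    have hmeas : Measurable fun x => ‖u (t, x) - u₀ x‖ₑ :=
      ((H.continuous_slice ⟨htI.1.le, ht3⟩).sub (H.continuous_initial hT)).enorm.measurable
    calc ∫⁻ x in Icc (-ρ) ρ, ‖v' (t, x) - u' (t, x)‖ₑ
        ≤ ∫⁻ x in Icc (-ρ) ρ, (‖v (t, x) - u₀ x‖ₑ + ‖u (t, x) - u₀ x‖ₑ) := by
          refine lintegral_mono_ae (ae_restrict_of_ae ?_)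
          filter_upwards [ht ⟨htI.1, ht3⟩] with x hx
          rw [hx, hu ⟨⟨htI.1, ht3⟩, mem_univ _⟩,
            show v (t, x) - u (t, x) = (v (t, x) - u₀ x) - (u (t, x) - u₀ x) by ring]
          exact enorm_sub_le
      _ = (∫⁻ x in Icc (-ρ) ρ, ‖v (t, x) - u₀ x‖ₑ) + ∫⁻ x in Icc (-ρ) ρ, ‖u (t, x) - u₀ x‖ₑ :=
          lintegral_add_right _ hmeas
      _ ≤ ENNReal.ofReal (δ / 2) + ENNReal.ofReal (δ / 2) := add_le_add b1 b2
      _ = ENNReal.ofReal δ := by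
          rw [← ENNReal.ofReal_add (by positivity) (by positivity), add_halves]
  -- The indices `n` and `N` move away from the ends of the time interval and enlarge the cone;
  -- being countable, they cost only one null set.
  have hall : ∀ᵐ p : ℝ × ℝ, ∀ n N : ℕ, 1 / ((n + 1 : ℕ) : ℝ) < p.1 →
      p.1 < T - 1 / ((n + 1 : ℕ) : ℝ) → √(1 + p.2 ^ 2) + L * p.1 < N → v' p = u' p := by
    rw [ae_all_iff]
    intro n
    rw [ae_all_iff]
    intro N
    refine ae_eq_zero_of_cone hL H'.measurable_u hv'm huM hvM hLf hf.continuous hcomp (h0 N)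
      ?_ (Nat.succ_ne_zero n)
    have : (0 : ℝ) < 1 / ((n + 1 : ℕ) : ℝ) := by positivity
    linarith
  have hall' : ∀ᵐ p ∂(volume.restrict (strip T)), v' p = u' p := by
    rw [ae_restrict_iff' (isOpen_strip T).measurableSet]
    filter_upwards [hall] with p hp hpT
    have hpos : 0 < min p.1 (T - p.1) := lt_min hpT.1.1 (by linarith [hpT.1.2])
    obtain ⟨n, hn⟩ := exists_nat_one_div_lt hpos
    obtain ⟨N, hN⟩ := exists_nat_gt (√(1 + p.2 ^ 2) + L * p.1)
    refine hp n N ?_ ?_ hN <;> push_cast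
    · exact hn.trans_le (min_le_left _ _)
    · linarith [hn.trans_le (min_le_right _ _)]
  filter_upwards [hall', hv, ae_restrict_mem (isOpen_strip T).measurableSet] with p h1 h2 h3
  rw [← h2, h1, hu h3]

/-- A continuous solution is also an entropy solution, and continuous functions that agree a.e. on
an open set agree everywhere on it. The line `t = 0` is covered by the common datum. -/
theorem IsContinuousCauchySolution.eqOn {f : ℝ → ℝ} (hf : ContDiff ℝ 1 f) {g u v : ℝ × ℝ → ℝ}
    {T : ℝ} (hT : 0 < T) {u₀ : ℝ → ℝ} (V : IsContinuousCauchySolution f g T u₀ v)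
    (H : IsContinuousCauchySolution f g T u₀ u) : EqOn v u (strip₀ T) := by
  have h1 := (V.isKruzkovEntropySolution hf.continuous hT).ae_eq hf hT H
  have h2 := Measure.eqOn_open_of_ae_eq h1 (isOpen_strip T) V.solution.continuousOn
    H.solution.continuousOn
  rintro ⟨t, x⟩ hp
  rcases hp.1.1.eq_or_lt with h | h
  · simp only at h
    rw [← h, V.initial, H.initial]
  · exact h2 ⟨⟨h, hp.1.2⟩, mem_univ _⟩

theorem lemmaL (f : ℝ → ℝ) (hf : ContDiff ℝ 2 f) :
    (∀ Ω : Set (ℝ × ℝ), IsOpen Ω → Ω ⊆ Ioi 0 ×ˢ univ →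
      ∀ g u : ℝ × ℝ → ℝ, IsContinuousDistribSolution f g Ω u →
        (∀ η q : ℝ → ℝ, IsEntropyPair f η q →
          DistribBalance Ω (fun p => η (u p)) (fun p => q (u p))
            (fun p => deriv η (u p) * g p)) ∧
        (∀ k : ℝ,
          DistribBalance Ω (fun p => |u p - k|)
            (fun p => Real.sign (u p - k) * (f (u p) - f k))
            (fun p => Real.sign (u p - k) * g p))) ∧
    (∀ T : ℝ, 0 < T → ∀ (g : ℝ × ℝ → ℝ) (u₀ : ℝ → ℝ) (u : ℝ × ℝ → ℝ),
      IsContinuousCauchySolution f g T u₀ u →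
        IsKruzkovEntropySolution f g T u₀ u ∧
        (∀ v : ℝ × ℝ → ℝ, IsKruzkovEntropySolution f g T u₀ v →
          v =ᵐ[volume.restrict (strip T)] u) ∧
        (∀ v : ℝ × ℝ → ℝ, IsContinuousCauchySolution f g T u₀ v →
          EqOn v u (strip₀ T))) := by
  have hf1 : ContDiff ℝ 1 f := hf.of_le (by norm_num)
  refine ⟨fun Ω hΩ _ g u H => ⟨fun η q hη => H.distribBalance_entropy hf1 hΩ hη,
    fun k => H.distribBalance_kruzkov hf1.continuous hΩ k⟩, fun T hT g u₀ u H => ⟨?_, ?_, ?_⟩⟩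
  · exact H.isKruzkovEntropySolution hf1.continuous hT
  · exact fun v V => V.ae_eq hf1 hT H
  · exact fun v V => V.eqOn hf1 hT H
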